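/- Let $\mathcal C$ be a cocomplete (locally small) category and let $J=\{f_j\colon A_j\to B_j\}_{j\in J}$ be a small set of maps of $\mathcal C$. **Functorial factorisations.** Let $\mathbf{Ff}_{\mathcal C}$ be the category of functorial factorisations $(E,\lambda,\rho)$ on $\mathcal C$: a functor $E\colon\mathcal C^{\mathbf 2}\to\mathcal C$ with natural maps $\mathrm{dom}\xrightarrow{\lambda}E\xrightarrow{\rho}\mathrm{cod}$ such that $\rho_f\lambda_f=f$; its morphisms are the natural transformations $E\to E'$ commuting with the $\lambda$'s and $\rho$'s. Write $Lf=\lambda_f$, $Rf=\rho_f$ for the induced endofunctors of $\mathcal C^{\mathbf 2}$, $\Phi\colon L\Rightarrow 1$ for the transformation with components $(1,\rho_f)$ and $\Lambda\colon 1\Rightarrow R$ for that with components $(\lambda_f,1)$. There are two strict monoidal structures on $\mathbf{Ff}_{\mathcal C}$: the factorisation of $f$ given by $X\odot Y$ has middle object $E_X(L_Yf)$ and left half $L_XL_Yf$; that given by $X\otimes Y$ has middle object $E_X(R_Yf)$ and right half $R_XR_Yf$. The structure $\otimes$, whose unit $I$ has $E=\mathrm{dom}$, lifts to the category $\mathbf{Comon}_\odot(\mathbf{Ff}_{\mathcal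 C})$ of $\odot$-comonoids, and its unit $I$ is initial there, so every object $X$ has a unique point $\tau\colon I\to X$. **Natural weak factorisation systems.** An n.w.f.s. on $\mathcal C$ is a functorial factorisation with natural families $\sigma_f\colon Ef\to ELf$ and $\pi_f\colon ERf\to Ef$ such that $(L,\Phi,\Sigma)$ with $\Sigma_f=(1,\sigma_f)$ is a comonad, $(R,\Lambda,\Pi)$ with $\Pi_f=(\pi_f,1)$ is a monad, and the squares $(\sigma_f,\pi_f)\colon LRf\to RLf$ are the components of a distributive law of $L$ over $R$. Each n.w.f.s. is a $\otimes$-monoid in $\mathbf{Comon}_\odot(\mathbf{Ff}_{\mathcal C})$, with comultiplication $\sigma$ and multiplication $\pi$. **The one-step comonad.** For $g\in\mathcal C^{\mathbf 2}$ let $S_g$ be the set of all pairs $x=(j,(h,k))$ where $(h,k)\colon f_j\to g$ is a commutative square, and let $E^1g$ be the pushout of $\sum_{x\in S_g}f_{j}\colon\sum_x A_{j}\to\sum_x B_{j}$ along the map $\sum_xA_{j}\to\mathrm{dom}\,g$ with components $h$. Let $\lambda^1_g\colon \mathrm{dom}\,g\to E^1g$ be the pushout injection, let $\mathrm{in}_x\colon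 B_{j}\to E^1g$ be the inclusions of the cells, and let $\rho^1_g\colon E^1g\to\mathrm{cod}\,g$ be the map with $\rho^1_g\lambda^1_g=g$ and $\rho^1_g\,\mathrm{in}_x=k$. This is a functorial factorisation, and a $\odot$-comonoid $\mathsf L^1$ with comultiplication $E^1g\to E^1\lambda^1_g$ the map which restricts to $\lambda^1_{\lambda^1_g}$ on $\mathrm{dom}\,g$ and to $\mathrm{in}_{(j,(h,\mathrm{in}_x))}$ on the cell $x$. **The n.w.f.s. generated by $J$.** For a pointed object $(T,\tau)$ of a monoidal category, the free monoid on $(T,\tau)$ is a monoid $U$ with a map $\chi\colon T\to U$ such that $\chi\tau$ is the unit of $U$ and such that every $g\colon T\to W$ into a monoid $W$ with $g\tau$ the unit of $W$ factors as $g=h\chi$ for a unique monoid map $h\colon U\to W$. The n.w.f.s. generated by $J$ is the n.w.f.s. whose associated $\otimes$-monoid in $\mathbf{Comon}_\odot(\mathbf{Ff}_{\mathcal C})$ is the free monoid on $(\mathsf L^1,\tau)$; it exists if this free monoid does. **Free module sequences.** The free $T$-module sequence for $A$ is the functor $X$ from the ordered class of (small) ordinals, with maps $s_\beta\colon T\otimes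 X_\beta\to X_{\beta^+}$ natural in $\beta$ and satisfying $s_\beta\cdot(\tau\otimes X_\beta)=X_{\beta,\beta^+}$, determined up to isomorphism by: $X_0\cong A$ and $s_0$ is invertible; $s_{\beta^+}$ is the coequaliser of $(\tau\otimes X_{\beta^+})\cdot s_\beta$ and $(T\otimes s_\beta)\cdot(T\otimes\tau\otimes X_\beta)\colon T\otimes X_\beta\rightrightarrows T\otimes X_{\beta^+}$; and for a limit ordinal $\gamma$, $X_\gamma=\operatorname{colim}_{\beta<\gamma}X_\beta$ and $s_\gamma$ is the universal map out of $T\otimes X_\gamma$ that equalises, for every $\beta<\gamma$, the maps $(\tau\otimes X_\gamma)\cdot X_{\beta^+,\gamma}\cdot s_\beta$ and $T\otimes X_{\beta,\gamma}\colon T\otimes X_\beta\rightrightarrows T\otimes X_\gamma$. **Smallness.** For a cardinal $\alpha$, a limit ordinal $\beta$ is $\alpha$-filtered if every $S\subset\beta$ of cardinality $\leqslant\alpha$ has $\sup S<\beta$. A functor is $\alpha$-small if it preserves colimits of chains indexed by $\alpha$-filtered ordinals, and $\alpha$-small relative to a class $\mathcal M$ of maps if it preserves colimits of such chains in which all maps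 are in $\mathcal M$. An orthogonal factorisation system $(\mathcal E,\mathcal M)$ is cowellpowered if every object is the domain of only a small set of isomorphism classes of $\mathcal E$-maps. **Proposition.** Suppose that 1. for every $j$ there is a cardinal $\alpha_j$ such that $\mathcal C(A_j,-)\colon\mathcal C\to\mathbf{Set}$ is $\alpha_j$-small; or 2. there is a cowellpowered orthogonal factorisation system $(\mathcal E,\mathcal M)$ on $\mathcal C$ such that for every $j$ there is a cardinal $\alpha_j$ for which $\mathcal C(A_j,-)$ is $\alpha_j$-small relative to $\mathcal M$. Then the n.w.f.s. generated by $J$ exists: there is an n.w.f.s. $N$ on $\mathcal C$ and a map $\chi\colon\mathsf L^1\to N$ exhibiting $N$ as the free $\otimes$-monoid on $(\mathsf L^1,\tau)$ in $\mathbf{Comon}_\odot(\mathbf{Ff}_{\mathcal C})$. Moreover, there is a free $\mathsf L^1$-module sequence $(X,s)$ for the unit $I$ in $\mathbf{Comon}_\odot(\mathbf{Ff}_{\mathcal C})$ and a colimit cocone $c_\beta\colon X_\beta\to N$ on it such that $I\cong X_0\xrightarrow{c_0}N$ is the unit of $N$ and $c_{\beta^+}\cdot s_\beta=\mu\cdot(\chi\otimes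 c_\beta)$ for all $\beta$, where $\mu$ is the multiplication of $N$. For each $g\in\mathcal C^{\mathbf 2}$ there is a $\beta$ such that the component at $g$ of $X_{\beta,\delta}$ is invertible for all $\delta\geqslant\beta$; and under hypothesis 1 there is a $\beta$ such that $X_{\beta,\delta}$ is invertible for all $\delta\geqslant\beta$. -/

import Mathlib

open CategoryTheory Limits MonoidalCategory

universe w v u

namespace Nwfs

/-! ## Functorial factorisations -/

/-- A functorial factorisation `(E, lam, rho)` on `C`: a functor `E` on the arrow category together
with natural transformations `dom ⟶ E ⟶ cod` whose composite is the canonical one, with component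
`f` at `f`. -/
structure Ff (C : Type u) [Category.{v} C] where
  /-- The middle object of the factorisation. -/
  E : Arrow C ⥤ C
  /-- The left half of the factorisation. -/
  lam (f : Arrow C) : f.left ⟶ E.obj f
  /-- The right half of the factorisation. -/
  rho (f : Arrow C) : E.obj f ⟶ f.right
  lam_nat {f g : Arrow C} (φ : f ⟶ g) : φ.left ≫ lam g = lam f ≫ E.map φ
  rho_nat {f g : Arrow C} (φ : f ⟶ g) : E.map φ ≫ rho g = rho f ≫ φ.right
  fac (f : Arrow C) : lam f ≫ rho f = f.hom

namespace Ff

variable {C : Type u} [Category.{v} C]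

/-- The functor `L : f ↦ lam_f` on the arrow category. -/
abbrev L (X : Ff C) : Arrow C ⥤ Arrow C where
  obj f := Arrow.mk (X.lam f)
  map φ := Arrow.homMk' φ.left (X.E.map φ) (X.lam_nat φ)
  map_id f := Arrow.hom_ext _ _ rfl (X.E.map_id f)
  map_comp φ ψ := Arrow.hom_ext _ _ rfl (X.E.map_comp φ ψ)

/-- The functor `R : f ↦ rho_f` on the arrow category. -/
abbrev R (X : Ff C) : Arrow C ⥤ Arrow C where
  obj f := Arrow.mk (X.rho f)
  map φ := Arrow.homMk' (X.E.map φ) φ.right (X.rho_nat φ)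
  map_id f := Arrow.hom_ext _ _ (X.E.map_id f) rfl
  map_comp φ ψ := Arrow.hom_ext _ _ (X.E.map_comp φ ψ) rfl

/-- The square `Phi : L f ⟶ f` with identity domain part. -/
abbrev Phi (X : Ff C) (f : Arrow C) : Arrow.mk (X.lam f) ⟶ f :=
  Arrow.homMk (f := Arrow.mk (X.lam f)) (𝟙 _) (X.rho f)
    ((Category.id_comp _).trans (X.fac f).symm)

/-- The square `Lam : f ⟶ R f` with identity codomain part. -/
abbrev Lam (X : Ff C) (f : Arrow C) : f ⟶ Arrow.mk (X.rho f) :=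
  Arrow.homMk (g := Arrow.mk (X.rho f)) (X.lam f) (𝟙 _)
    ((X.fac f).trans (Category.comp_id _).symm)

/-- A morphism of functorial factorisations: a natural transformation between the middle objects
that commutes with both halves of the factorisations. -/
@[ext]
structure Hom (X Y : Ff C) where
  /-- The components of the natural transformation. -/
  app (f : Arrow C) : X.E.obj f ⟶ Y.E.obj f
  nat {f g : Arrow C} (φ : f ⟶ g) : X.E.map φ ≫ app g = app f ≫ Y.E.map φ
  lam_app (f : Arrow C) : X.lam f ≫ app f = Y.lam f
  app_rho (f : Arrow C) : app f ≫ Y.rho f = X.rho f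

instance : Category (Ff C) where
  Hom := Hom
  id X := ⟨fun _ => 𝟙 _, by simp, by simp, by simp⟩
  comp a b := ⟨fun f => a.app f ≫ b.app f,
    fun φ => by rw [← Category.assoc, a.nat, Category.assoc, b.nat, Category.assoc],
    fun f => by rw [← Category.assoc, a.lam_app, b.lam_app],
    fun f => by rw [Category.assoc, b.app_rho, a.app_rho]⟩
  id_comp a := Hom.ext (funext fun _ => Category.id_comp _)
  comp_id a := Hom.ext (funext fun _ => Category.comp_id _)
  assoc a b c := Hom.ext (funext fun _ => Category.assoc _ _ _)

@[ext]
theorem hom_ext {X Y : Ff C} {a b : X ⟶ Y} (h : ∀ f, Hom.app a f = Hom.app b f) : a = b :=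
  Hom.ext (funext h)

@[simp]
theorem id_app (X : Ff C) (f : Arrow C) : Hom.app (𝟙 X) f = 𝟙 (X.E.obj f) := rfl

@[simp]
theorem comp_app {X Y Z : Ff C} (a : X ⟶ Y) (b : Y ⟶ Z) (f : Arrow C) :
    Hom.app (a ≫ b) f = Hom.app a f ≫ Hom.app b f := rfl

/-- The morphism `L f ⟶ L' f` of arrows, with identity domain part, induced by a morphism. -/
abbrev Hom.left {X Y : Ff C} (a : Hom X Y) (f : Arrow C) :
    Arrow.mk (X.lam f) ⟶ Arrow.mk (Y.lam f) :=
  Arrow.homMk' (𝟙 f.left) (a.app f) ((Category.id_comp _).trans (a.lam_app f).symm)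

/-- The morphism `R f ⟶ R' f` of arrows, with identity codomain part, induced by a morphism. -/
abbrev Hom.right {X Y : Ff C} (a : Hom X Y) (f : Arrow C) :
    Arrow.mk (X.rho f) ⟶ Arrow.mk (Y.rho f) :=
  Arrow.homMk' (a.app f) (𝟙 f.right) ((a.app_rho f).trans (Category.comp_id _).symm)

theorem left_id (X : Ff C) (f : Arrow C) : Hom.left (𝟙 X) f = 𝟙 _ := rfl

theorem right_id (X : Ff C) (f : Arrow C) : Hom.right (𝟙 X) f = 𝟙 _ := rfl

theorem left_comp {X Y Z : Ff C} (a : X ⟶ Y) (b : Y ⟶ Z) (f : Arrow C) :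
    Hom.left (a ≫ b) f = Hom.left a f ≫ Hom.left b f :=
  Arrow.hom_ext _ _ (Category.comp_id _).symm rfl

theorem right_comp {X Y Z : Ff C} (a : X ⟶ Y) (b : Y ⟶ Z) (f : Arrow C) :
    Hom.right (a ≫ b) f = Hom.right a f ≫ Hom.right b f :=
  Arrow.hom_ext _ _ rfl (Category.comp_id _).symm

/-- Two squares with equal images under `E`, from equality of their two halves. -/
theorem map_congr (X : Ff C) {f g : Arrow C} {φ ψ : f ⟶ g} (h : φ.left = ψ.left)
    (h' : φ.right = ψ.right) : X.E.map φ = X.E.map ψ :=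
  congrArg _ (Arrow.hom_ext _ _ h h')

theorem map_eq_id (X : Ff C) {f : Arrow C} {φ : f ⟶ f} (h : φ.left = 𝟙 _)
    (h' : φ.right = 𝟙 _) : X.E.map φ = 𝟙 _ :=
  (X.map_congr (ψ := 𝟙 f) h h').trans (X.E.map_id f)

theorem comp_map (X : Ff C) {Z : C} {f g h : Arrow C} (s : Z ⟶ X.E.obj f) (φ : f ⟶ g)
    (ψ : g ⟶ h) : (s ≫ X.E.map φ) ≫ X.E.map ψ = s ≫ X.E.map (φ ≫ ψ) := by
  rw [X.E.map_comp, Category.assoc]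

/-! ### The monoidal structure `⊙` -/

/-- `X ⊙ Y` factorises `f` by applying `Y` to `f` and then `X` to the left half of the result. -/
abbrev odot (X Y : Ff C) : Ff C where
  E :=
    { obj := fun f => X.E.obj (Y.L.obj f)
      map := fun φ => X.E.map (Y.L.map φ)
      map_id := fun f => by rw [Y.L.map_id, X.E.map_id]
      map_comp := fun φ ψ => by rw [Y.L.map_comp, X.E.map_comp] }
  lam f := X.lam (Y.L.obj f)
  rho f := X.rho (Y.L.obj f) ≫ Y.rho f
  lam_nat φ := X.lam_nat (Y.L.map φ)
  rho_nat φ := by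
    rw [← Category.assoc, X.rho_nat, Category.assoc, Category.assoc]
    exact congrArg _ (Y.rho_nat φ)
  fac f := by
    rw [← Category.assoc, X.fac]
    exact Y.fac f

/-- The unit for `⊙`, which factorises `f` as `f` followed by an identity. -/
abbrev bot : Ff C where
  E :=
    { obj := fun f => f.right
      map := fun φ => φ.right
      map_id := fun _ => rfl
      map_comp := fun _ _ => rfl }
  lam f := f.hom
  rho _ := 𝟙 _
  lam_nat φ := φ.w
  rho_nat _ := (Category.comp_id _).trans (Category.id_comp _).symm
  fac _ := Category.comp_id _

/-- The action of `⊙` on morphisms. -/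
abbrev odotHom {X X' Y Y' : Ff C} (a : X ⟶ X') (b : Y ⟶ Y') : odot X Y ⟶ odot X' Y' where
  app f := X.E.map (Hom.left b f) ≫ Hom.app a (Y'.L.obj f)
  nat φ := by
    rw [Category.assoc, ← a.nat, ← Category.assoc, ← Category.assoc, ← X.E.map_comp,
        ← X.E.map_comp]
    congr 2
    exact Arrow.hom_ext _ _ ((Category.comp_id _).trans (Category.id_comp _).symm) (b.nat φ)
  lam_app _ := by
    rw [← Category.assoc, ← X.lam_nat, Category.assoc, a.lam_app]
    exact Category.id_comp _
  app_rho f := by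
    rw [Category.assoc, ← Category.assoc (a.app _), a.app_rho, ← Category.assoc, X.rho_nat,
        Category.assoc]
    exact congrArg _ (b.app_rho f)

/-- The monoidal category structure `(⊙, bot)` on functorial factorisations; throughout, Mathlib's
tensor product on `Ff C` is this one. All structural isomorphisms have identity components. -/
instance : MonoidalCategory (Ff C) where
  tensorObj := odot
  tensorUnit := bot
  tensorHom := odotHom
  whiskerLeft X _ _ b := odotHom (𝟙 X) b
  whiskerRight a Y := odotHom a (𝟙 Y)
  associator X Y Z :=
    { hom := ⟨fun f => 𝟙 (X.E.obj (Y.L.obj (Z.L.obj f))), by simp, by simp, by simp⟩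
      inv := ⟨fun f => 𝟙 (X.E.obj (Y.L.obj (Z.L.obj f))), by simp, by simp, by simp⟩
      hom_inv_id := by ext; simp
      inv_hom_id := by ext; simp }
  leftUnitor X :=
    { hom := ⟨fun f => 𝟙 (X.E.obj f), by simp, by simp, by simp⟩
      inv := ⟨fun f => 𝟙 (X.E.obj f), by simp, by simp, by simp⟩
      hom_inv_id := by ext; simp
      inv_hom_id := by ext; simp }
  rightUnitor X :=
    { hom := ⟨fun f => 𝟙 (X.E.obj f),
        fun _ => (Category.comp_id _).trans (Category.id_comp _).symm,
        fun _ => Category.comp_id _,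
        fun _ => (Category.id_comp _).trans (Category.comp_id _).symm⟩
      inv := ⟨fun f => 𝟙 (X.E.obj f),
        fun _ => (Category.comp_id _).trans (Category.id_comp _).symm,
        fun _ => Category.comp_id _,
        fun _ => (Category.id_comp _).trans (Category.comp_id _)⟩
      hom_inv_id := hom_ext fun _ => Category.comp_id _
      inv_hom_id := hom_ext fun _ => Category.comp_id _ }
  tensorHom_def a b := hom_ext fun f => by
    simp [left_id, a.nat]
  id_tensorHom_id X Y := hom_ext fun f => by
    simp [left_id]
  tensorHom_comp_tensorHom {X X' X'' Y Y' Y''} a b c d := hom_ext fun f => by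
    simp only [comp_app, left_comp, Functor.map_comp, Category.assoc]
    rw [← Category.assoc (a.app _), ← a.nat, Category.assoc]
  whiskerLeft_id X Y := hom_ext fun f => by
    simp [left_id]
  id_whiskerRight X Y := hom_ext fun f => by
    simp [left_id]
  associator_naturality {X Y Z X' Y' Z'} a b c := hom_ext fun f => by
    simp only [comp_app, Category.comp_id, Category.id_comp]
    rw [← Category.assoc, ← X.E.map_comp]
    congr 1
    exact X.map_congr (Category.comp_id _) rfl
  leftUnitor_naturality a := hom_ext fun f => by
    simp
  rightUnitor_naturality {X Y} a := hom_ext fun f =>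
    ((Category.comp_id _).trans (congrArg (· ≫ a.app f) (X.map_eq_id rfl rfl))).trans
      rfl
  pentagon W X Y Z := hom_ext fun f => by
    simp only [comp_app, id_app, Category.comp_id, Category.id_comp]
    rw [W.map_eq_id, W.map_eq_id]
    · exact Category.comp_id _
    · rfl
    · rfl
    · rfl
    · exact X.map_eq_id rfl (Y.map_eq_id rfl rfl)
  triangle X Y := hom_ext fun f => by
    simp only [comp_app, id_app, Category.comp_id, Category.id_comp]
    exact (X.map_congr rfl rfl).trans (Category.comp_id _).symm

@[simp]
theorem tensorHom_app {X X' Y Y' : Ff C} (a : X ⟶ X') (b : Y ⟶ Y') (f : Arrow C) :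
    Hom.app (a ⊗ₘ b) f = X.E.map (Hom.left b f) ≫ Hom.app a (Arrow.mk (Y'.lam f)) := rfl

@[simp]
theorem whiskerLeft_app (X : Ff C) {Y Y' : Ff C} (b : Y ⟶ Y') (f : Arrow C) :
    Hom.app (X ◁ b) f = X.E.map (Hom.left b f) := Category.comp_id _

@[simp]
theorem whiskerRight_app {X X' : Ff C} (a : X ⟶ X') (Y : Ff C) (f : Arrow C) :
    Hom.app (a ▷ Y) f = Hom.app a (Arrow.mk (Y.lam f)) :=
  (congrArg (· ≫ _) (X.map_eq_id rfl rfl)).trans (Category.id_comp _)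

theorem associator_hom_app (X Y Z : Ff C) (f : Arrow C) :
    Hom.app (α_ X Y Z).hom f = 𝟙 (X.E.obj (Y.L.obj (Z.L.obj f))) := rfl

theorem leftUnitor_inv_app (X : Ff C) (f : Arrow C) :
    Hom.app (λ_ X).inv f = 𝟙 (X.E.obj f) := rfl

theorem rightUnitor_inv_app (X : Ff C) (f : Arrow C) :
    Hom.app (ρ_ X).inv f = 𝟙 (X.E.obj f) := rfl

/-! ### The second tensor product `⊗` -/

/-- `X ⊗ Y` factorises `f` by applying `Y` to `f` and then `X` to the right half of the result. -/
abbrev tens (X Y : Ff C) : Ff C where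
  E :=
    { obj := fun f => X.E.obj (Y.R.obj f)
      map := fun φ => X.E.map (Y.R.map φ)
      map_id := fun f => by rw [Y.R.map_id, X.E.map_id]
      map_comp := fun φ ψ => by rw [Y.R.map_comp, X.E.map_comp] }
  lam f := Y.lam f ≫ X.lam (Y.R.obj f)
  rho f := X.rho (Y.R.obj f)
  lam_nat φ := by
    rw [Category.assoc, ← X.lam_nat, ← Category.assoc, ← Category.assoc]
    exact congrArg (· ≫ _) (Y.lam_nat φ)
  rho_nat φ := X.rho_nat (Y.R.map φ)
  fac f := by
    rw [Category.assoc, X.fac]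
    exact Y.fac f

/-- The unit for `⊗`, which factorises `f` as an identity followed by `f`. -/
abbrev unit : Ff C where
  E :=
    { obj := fun f => f.left
      map := fun φ => φ.left
      map_id := fun _ => rfl
      map_comp := fun _ _ => rfl }
  lam _ := 𝟙 _
  rho f := f.hom
  lam_nat _ := (Category.comp_id _).trans (Category.id_comp _).symm
  rho_nat φ := φ.w
  fac _ := Category.id_comp _

/-- The action of `⊗` on morphisms. -/
abbrev tensHom {X X' Y Y' : Ff C} (a : X ⟶ X') (b : Y ⟶ Y') : tens X Y ⟶ tens X' Y' where
  app f := X.E.map (Hom.right b f) ≫ Hom.app a (Y'.R.obj f)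
  nat φ := by
    rw [Category.assoc, ← a.nat, ← Category.assoc, ← Category.assoc, ← X.E.map_comp,
        ← X.E.map_comp]
    congr 2
    exact Arrow.hom_ext _ _ (b.nat φ) ((Category.comp_id _).trans (Category.id_comp _).symm)
  lam_app f := by
    rw [Category.assoc, ← Category.assoc (X.lam _), ← X.lam_nat, Category.assoc, a.lam_app,
      ← Category.assoc]
    exact congrArg (· ≫ _) (b.lam_app f)
  app_rho _ := by
    rw [Category.assoc, a.app_rho, X.rho_nat]
    exact Category.comp_id _

/-- The associativity isomorphism for `⊗`; its components are identities. -/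
def tensAssoc (X Y Z : Ff C) : tens (tens X Y) Z ≅ tens X (tens Y Z) where
  hom := ⟨fun f => 𝟙 (X.E.obj (Y.R.obj (Z.R.obj f))), by simp, by simp, by simp⟩
  inv := ⟨fun f => 𝟙 (X.E.obj (Y.R.obj (Z.R.obj f))), by simp, by simp, by simp⟩
  hom_inv_id := by ext; simp
  inv_hom_id := by ext; simp

/-- The left unit isomorphism for `⊗`; its components are identities. -/
def tensLeftUnitor (X : Ff C) : tens unit X ≅ X where
  hom := ⟨fun f => 𝟙 (X.E.obj f), by simp, by simp, by simp⟩
  inv := ⟨fun f => 𝟙 (X.E.obj f), by simp, by simp, by simp⟩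
  hom_inv_id := by ext; simp
  inv_hom_id := by ext; simp

/-- The right unit isomorphism for `⊗`; its components are identities. -/
def tensRightUnitor (X : Ff C) : tens X unit ≅ X where
  hom := ⟨fun f => 𝟙 (X.E.obj f),
    fun _ => (Category.comp_id _).trans (Category.id_comp _).symm,
    fun _ => (Category.comp_id _).trans (Category.id_comp _),
    fun _ => Category.id_comp _⟩
  inv := ⟨fun f => 𝟙 (X.E.obj f),
    fun _ => (Category.comp_id _).trans (Category.id_comp _).symm,
    fun _ => (Category.comp_id _).trans (Category.id_comp _).symm,
    fun _ => Category.id_comp _⟩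
  hom_inv_id := hom_ext fun _ => Category.comp_id _
  inv_hom_id := hom_ext fun _ => Category.comp_id _

/-- The square from the left half of `Y` to the left half of `X ⊗ Y`. -/
abbrev leftInto (X Y : Ff C) (f : Arrow C) :
    Arrow.mk (Y.lam f) ⟶ Arrow.mk (Y.lam f ≫ X.lam (Arrow.mk (Y.rho f))) :=
  Arrow.homMk' (𝟙 _) (X.lam (Arrow.mk (Y.rho f))) (Category.id_comp _)

/-- The square from the right half of `X ⊙ Y` to the right half of `Y`. -/
abbrev rightOnto (X Y : Ff C) (f : Arrow C) :
    Arrow.mk (X.rho (Arrow.mk (Y.lam f)) ≫ Y.rho f) ⟶ Arrow.mk (Y.rho f) :=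
  Arrow.homMk' (X.rho (Arrow.mk (Y.lam f))) (𝟙 _) (Category.comp_id _).symm

/-- The square whose image under `A` is the component of the interchange morphism. -/
abbrev interchangeSquare (B D F : Ff C) (f : Arrow C) :
    Arrow.mk (B.lam ((odot D F).R.obj f)) ⟶ Arrow.mk (D.rho ((tens B F).L.obj f)) :=
  Arrow.homMk' (D.E.map (leftInto B F f)) (B.E.map (rightOnto D F f))
    ((D.rho_nat (leftInto B F f)).trans (B.lam_nat (rightOnto D F f)))

theorem interchangeSquare_nat (B D F : Ff C) {f g : Arrow C} (φ : f ⟶ g) :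
    B.L.map ((odot D F).R.map φ) ≫ interchangeSquare B D F g =
      interchangeSquare B D F f ≫ D.R.map ((tens B F).L.map φ) := by
  refine Arrow.hom_ext _ _ ?_ ?_
  · refine (D.E.map_comp _ _).symm.trans (Eq.trans (D.map_congr ?_ ?_) (D.E.map_comp _ _))
    · exact (Category.comp_id _).trans (Category.id_comp _).symm
    · exact B.lam_nat (F.R.map φ)
  · refine (B.E.map_comp _ _).symm.trans (Eq.trans (B.map_congr ?_ ?_) (B.E.map_comp _ _))
    · exact D.rho_nat (F.L.map φ)
    · exact (Category.comp_id _).trans (Category.id_comp _).symm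

/-- The interchange morphism `(A ⊙ B) ⊗ (D ⊙ F) ⟶ (A ⊗ D) ⊙ (B ⊗ F)`. -/
abbrev interchange (A B D F : Ff C) : tens (odot A B) (odot D F) ⟶ odot (tens A D) (tens B F) where
  app f := A.E.map (interchangeSquare B D F f)
  nat φ := (A.E.map_comp _ _).symm.trans
    ((congrArg _ (interchangeSquare_nat B D F φ)).trans (A.E.map_comp _ _))
  lam_app f := by
    rw [Category.assoc, ← A.lam_nat, ← Category.assoc]
    refine congrArg (· ≫ _) ((D.lam_nat (leftInto B F f)).symm.trans (Category.id_comp _))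
  app_rho f := by
    rw [← Category.assoc, A.rho_nat, Category.assoc]
    refine congrArg (_ ≫ ·) ((B.rho_nat (rightOnto D F f)).trans (Category.comp_id _))

/-- The unique morphism to the terminal object `bot`. -/
abbrev toBot (X : Ff C) : X ⟶ bot where
  app f := X.rho f
  nat φ := X.rho_nat φ
  lam_app f := X.fac f
  app_rho _ := Category.comp_id _

/-- The unique morphism from the initial object `unit`. -/
abbrev fromUnit (X : Ff C) : unit ⟶ X where
  app f := X.lam f
  nat φ := X.lam_nat φ
  lam_app _ := Category.id_comp _
  app_rho f := X.fac f

end Ff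

/-! ## Comonoids for `⊙` -/

section Comonoids

open ComonObj

variable {C : Type u} [Category.{v} C]

theorem counit_app (X : Ff C) [ComonObj X] (f : Arrow C) : (ε[X]).app f = X.rho f :=
  (Category.comp_id _).symm.trans ((ε[X]).app_rho f)

theorem comul_rho (X : Ff C) [ComonObj X] (f : Arrow C) :
    (Δ[X]).app f ≫ X.rho (Arrow.mk (X.lam f)) = 𝟙 _ := by
  have h := congrArg (fun t => Ff.Hom.app t f) (counit_comul X)
  rw [Ff.comp_app, Ff.whiskerRight_app, counit_app, Ff.leftUnitor_inv_app] at h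
  exact h

theorem comul_map_rho (X : Ff C) [ComonObj X] (f : Arrow C) :
    (Δ[X]).app f ≫ X.E.map (X.Phi f) = 𝟙 (X.E.obj f) := by
  have h := congrArg (fun t => Ff.Hom.app t f) (comul_counit X)
  rw [Ff.comp_app, Ff.whiskerLeft_app, Ff.rightUnitor_inv_app] at h
  refine Eq.trans (congrArg (_ ≫ ·) ?_) h
  exact congrArg X.E.map (Arrow.hom_ext _ _ rfl (counit_app X f).symm)

theorem comul_comul (X : Ff C) [ComonObj X] (f : Arrow C) :
    (Δ[X]).app f ≫ X.E.map (Ff.Hom.left Δ[X] f) =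
      (Δ[X]).app f ≫ (Δ[X]).app (Arrow.mk (X.lam f)) := by
  have h := congrArg (fun t => Ff.Hom.app t f) (comul_assoc X)
  rw [Ff.comp_app, Ff.whiskerLeft_app, Ff.comp_app, Ff.comp_app, Ff.whiskerRight_app,
    Ff.associator_hom_app] at h
  exact h.trans (congrArg (_ ≫ ·) (Category.comp_id _))

/-- A `⊙`-comonoid structure from its comultiplication, whose counit is forced to be `rho`. -/
abbrev comonObjMk (X : Ff C) (s : X ⟶ Ff.odot X X)
    (h₁ : ∀ f, s.app f ≫ X.rho (Arrow.mk (X.lam f)) = 𝟙 _)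
    (h₂ : ∀ f, s.app f ≫ X.E.map (X.Phi f) = 𝟙 (X.E.obj f))
    (h₃ : ∀ f, s.app f ≫ X.E.map (Ff.Hom.left s f) = s.app f ≫ s.app (Arrow.mk (X.lam f))) :
    ComonObj X where
  counit := X.toBot
  comul := s
  counit_comul := Ff.hom_ext fun f => by
    rw [Ff.comp_app, Ff.whiskerRight_app]
    exact h₁ f
  comul_counit := Ff.hom_ext fun f => by
    rw [Ff.comp_app, Ff.whiskerLeft_app]
    exact h₂ f
  comul_assoc := Ff.hom_ext fun f => by
    rw [Ff.comp_app, Ff.whiskerLeft_app, Ff.comp_app, Ff.comp_app, Ff.whiskerRight_app,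
      Ff.associator_hom_app]
    exact (h₃ f).trans (congrArg (_ ≫ ·) (Category.comp_id _).symm)

theorem isComonHom_mk {X Y : Ff C} [ComonObj X] [ComonObj Y] (a : X ⟶ Y)
    (h : ∀ f, a.app f ≫ (Δ[Y]).app f =
      (Δ[X]).app f ≫ X.E.map (Ff.Hom.left a f) ≫ a.app (Arrow.mk (Y.lam f))) :
    IsComonHom a where
  hom_counit := Ff.hom_ext fun f => by
    rw [Ff.comp_app, counit_app, counit_app]
    exact a.app_rho f
  hom_comul := Ff.hom_ext h

theorem comul_hom {X Y : Ff C} [ComonObj X] [ComonObj Y] (a : X ⟶ Y) [IsComonHom a] (f : Arrow C) :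
    a.app f ≫ (Δ[Y]).app f =
      (Δ[X]).app f ≫ X.E.map (Ff.Hom.left a f) ≫ a.app (Arrow.mk (Y.lam f)) :=
  congrArg (fun t => Ff.Hom.app t f) (IsComonHom.hom_comul a)

/-- The comultiplication of `A ⊗ B`: the tensor product of the comultiplications followed by the
interchange morphism. -/
abbrev tensComul (A B : Ff C) [ComonObj A] [ComonObj B] :
    Ff.tens A B ⟶ Ff.odot (Ff.tens A B) (Ff.tens A B) :=
  Ff.tensHom (Y' := Ff.odot B B) (X' := Ff.odot A A) Δ[A] Δ[B] ≫ Ff.interchange A A B B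

/-- The square whose image under `A` is the second part of `tensComul A B`. -/
abbrev comulSquare (A B : Ff C) [ComonObj B] (f : Arrow C) :
    Arrow.mk (A.lam (Arrow.mk (B.rho f))) ⟶ Arrow.mk (B.rho (Arrow.mk ((Ff.tens A B).lam f))) :=
  Arrow.homMk' ((Δ[B]).app f ≫ B.E.map (Ff.leftInto A B f)) (𝟙 _) (by
    rw [Category.assoc, B.rho_nat, ← Category.assoc, comul_rho]
    exact (Category.id_comp _).trans (Category.comp_id _).symm)

theorem tensComul_app (A B : Ff C) [ComonObj A] [ComonObj B] (f : Arrow C) :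
    (tensComul A B).app f =
      (Δ[A]).app (Arrow.mk (B.rho f)) ≫ A.E.map (comulSquare A B f) := by
  have h := (Δ[A]).nat (Ff.Hom.right Δ[B] f)
  refine (congrArg (· ≫ A.E.map (Ff.interchangeSquare A B B f)) h).trans ?_
  refine (Category.assoc _ _ _).trans (congrArg (_ ≫ ·) ?_)
  refine (A.E.map_comp _ _).symm.trans (A.map_congr rfl ?_)
  refine (A.E.map_comp _ _).symm.trans (A.map_eq_id (comul_rho B f) ?_)
  exact Category.comp_id _

theorem comulSquare_left (A B : Ff C) [ComonObj A] [ComonObj B] (f : Arrow C) :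
    (comulSquare A B f).left ≫ (comulSquare A B (Arrow.mk ((Ff.tens A B).lam f))).left =
      (comulSquare A B f).left ≫ B.E.map (Ff.Hom.left (tensComul A B) f) := by
  have h : Ff.Hom.left Δ[B] f ≫ B.L.map (Ff.leftInto A B f) ≫
      Ff.leftInto A B (Arrow.mk ((Ff.tens A B).lam f)) =
      Ff.leftInto A B f ≫ Ff.Hom.left (tensComul A B) f := by
    refine Arrow.hom_ext _ _ ((Category.id_comp _).trans rfl) ?_
    refine (Category.assoc _ _ _).symm.trans ?_
    refine (A.lam_nat (comulSquare A B f)).trans ?_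
    refine Eq.trans ?_ (congrArg (A.lam (Arrow.mk (B.rho f)) ≫ ·) (tensComul_app A B f).symm)
    refine Eq.trans ?_ (Category.assoc _ _ _)
    exact congrArg (· ≫ _) ((Δ[A]).lam_app (Arrow.mk (B.rho f))).symm
  refine (Category.assoc _ _ _).trans (Eq.trans ?_ (Category.assoc _ _ _).symm)
  refine Eq.trans ?_ (congrArg ((Δ[B]).app f ≫ ·)
    ((congrArg B.E.map h).trans (B.E.map_comp _ _)))
  refine Eq.trans ?_ (congrArg (_ ≫ ·) (B.E.map_comp _ _).symm)
  refine Eq.trans ?_ (Category.assoc _ _ _)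
  refine Eq.trans ?_ (congrArg (· ≫ _) (comul_comul B f).symm)
  refine Eq.trans ?_ (Category.assoc _ _ _).symm
  refine congrArg (_ ≫ ·) ?_
  refine (Category.assoc _ _ _).symm.trans ?_
  refine (congrArg (· ≫ _) ((Δ[B]).nat (Ff.leftInto A B f))).trans ?_
  refine (Category.assoc _ _ _).trans (congrArg (_ ≫ ·) ?_)
  exact (B.E.map_comp _ _).symm

instance tensComon (A B : Ff C) [ComonObj A] [ComonObj B] : ComonObj (Ff.tens A B) :=
  comonObjMk _ (tensComul A B)
    (fun f => by
      rw [tensComul_app, Category.assoc, A.rho_nat, ← Category.assoc, comul_rho]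
      exact Category.id_comp _)
    (fun f => by
      rw [tensComul_app, Category.assoc]
      refine Eq.trans (congrArg (_ ≫ ·) ?_) (comul_map_rho A (Arrow.mk (B.rho f)))
      refine (A.E.map_comp _ _).symm.trans (A.map_congr ?_ (Category.id_comp _))
      refine Eq.trans (Category.assoc _ _ _) ?_
      refine Eq.trans (congrArg (_ ≫ ·) ?_) (comul_map_rho B f)
      refine (B.E.map_comp _ _).symm.trans (B.map_congr (Category.comp_id _) ?_)
      exact A.fac _)
    (fun f => by
      have h : comulSquare A B f ≫ B.R.map (Ff.Hom.left (tensComul A B) f) =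
          Ff.Hom.left Δ[A] (Arrow.mk (B.rho f)) ≫ A.L.map (comulSquare A B f) ≫
            comulSquare A B (Arrow.mk ((Ff.tens A B).lam f)) := by
        refine Arrow.hom_ext _ _ ?_ ?_
        · exact (comulSquare_left A B f).symm.trans (Category.id_comp _).symm
        · refine (Category.id_comp _).trans ((tensComul_app A B f).trans ?_)
          exact congrArg (_ ≫ ·) (Category.comp_id _).symm
      rw [tensComul_app, tensComul_app, Category.assoc, Category.assoc]
      refine (congrArg (_ ≫ ·) ((A.E.map_comp _ _).symm.trans
        ((congrArg A.E.map h).trans (A.E.map_comp _ _)))).trans ?_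
      refine (Category.assoc _ _ _).symm.trans ?_
      refine (congrArg (· ≫ _) (comul_comul A (Arrow.mk (B.rho f)))).trans ?_
      refine (Category.assoc _ _ _).trans (congrArg (_ ≫ ·) ?_)
      refine (congrArg (_ ≫ ·) (A.E.map_comp _ _)).trans ?_
      refine (Category.assoc _ _ _).symm.trans (Eq.trans ?_ (Category.assoc _ _ _))
      exact congrArg (· ≫ _) ((Δ[A]).nat (comulSquare A B f)).symm)

instance unitComon : ComonObj (Ff.unit : Ff C) :=
  comonObjMk _ (Ff.fromUnit _)
    (fun _ => Category.id_comp _) (fun _ => Category.id_comp _) (fun _ => rfl)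

theorem paste_eq {x₀ x₁ x₂ x₃ x₄ y₃ y₄ y₅ z₁ z₂ z₃ : C} {P : x₀ ⟶ x₁} {a₁ : x₁ ⟶ x₂} {D' : x₂ ⟶ x₃}
    {Q' : x₃ ⟶ x₄} {d : x₁ ⟶ y₃} {l : y₃ ⟶ y₄} {a₃ : y₄ ⟶ x₃} {q : y₄ ⟶ y₅} {a₂ : y₅ ⟶ x₄}
    {d₀ : x₀ ⟶ z₁} {p : z₁ ⟶ y₃} {c : z₁ ⟶ z₂} {r : z₂ ⟶ z₃} {t : z₃ ⟶ y₅}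
    (e₁ : a₁ ≫ D' = d ≫ l ≫ a₃) (e₂ : q ≫ a₂ = a₃ ≫ Q') (e₃ : P ≫ d = d₀ ≫ p)
    (e₄ : p ≫ l ≫ q = c ≫ r ≫ t) :
    (P ≫ a₁) ≫ D' ≫ Q' = (d₀ ≫ c) ≫ r ≫ t ≫ a₂ := by
  calc (P ≫ a₁) ≫ D' ≫ Q' = P ≫ (a₁ ≫ D') ≫ Q' := by simp
    _ = (P ≫ d) ≫ l ≫ a₃ ≫ Q' := by rw [e₁]; simp
    _ = d₀ ≫ (p ≫ l ≫ q) ≫ a₂ := by rw [e₃, ← e₂]; simp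
    _ = (d₀ ≫ c) ≫ r ≫ t ≫ a₂ := by rw [e₄]; simp

instance tensHom_isComonHom {A A' B B' : Ff C} [ComonObj A] [ComonObj A'] [ComonObj B]
    [ComonObj B'] (a : A ⟶ A') (b : B ⟶ B') [IsComonHom a] [IsComonHom b] :
    IsComonHom (Ff.tensHom a b) :=
  isComonHom_mk _ fun f => by
    have hb : b.app f ≫ (comulSquare A' B' f).left = (comulSquare A B f).left ≫
        B.E.map (Ff.Hom.left (Ff.tensHom a b) f) ≫
          b.app (Arrow.mk ((Ff.tens A' B').lam f)) := by
      refine (Category.assoc _ _ _).symm.trans ?_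
      refine (congrArg (· ≫ _) (comul_hom b f)).trans ?_
      refine (Category.assoc _ _ _).trans (Eq.trans ?_ (Category.assoc _ _ _).symm)
      refine congrArg (_ ≫ ·) ?_
      refine (Category.assoc _ _ _).trans ?_
      refine (congrArg (_ ≫ ·) (b.nat (Ff.leftInto A' B' f)).symm).trans ?_
      refine (Category.assoc _ _ _).symm.trans (Eq.trans ?_ (Category.assoc _ _ _))
      refine congrArg (· ≫ _) ?_
      refine (B.E.map_comp _ _).symm.trans (Eq.trans (B.map_congr
        (ψ := Ff.leftInto A B f ≫ Ff.Hom.left (Ff.tensHom a b) f) rfl ?_) (B.E.map_comp _ _))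
      refine (congrArg (b.app f ≫ ·) (a.lam_app (Arrow.mk (B'.rho f))).symm).trans ?_
      refine (Category.assoc _ _ _).symm.trans ?_
      exact (congrArg (· ≫ _) (A.lam_nat (Ff.Hom.right b f))).trans (Category.assoc _ _ _)
    have hs : A.L.map (Ff.Hom.right b f) ≫ Ff.Hom.left a (Arrow.mk (B'.rho f)) ≫
        comulSquare A' B' f = comulSquare A B f ≫ B.R.map (Ff.Hom.left (Ff.tensHom a b) f) ≫
          Ff.Hom.right b (Arrow.mk ((Ff.tens A' B').lam f)) := by
      refine Arrow.hom_ext _ _ ((congrArg (_ ≫ ·) (Category.id_comp _)).trans hb) ?_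
      refine (congrArg (_ ≫ ·) (Category.comp_id _)).trans ?_
      exact ((Category.id_comp _).trans (Category.comp_id _)).symm
    change (_ ≫ _) ≫ (tensComul A' B').app f = (tensComul A B).app f ≫ A.E.map _ ≫ _ ≫ _
    rw [tensComul_app, tensComul_app]
    have hs' := congrArg A.E.map hs
    rw [A.E.map_comp, A.E.map_comp, A.E.map_comp, A.E.map_comp] at hs'
    exact paste_eq (comul_hom a (Arrow.mk (B'.rho f))) (a.nat (comulSquare A' B' f))
      ((Δ[A]).nat (Ff.Hom.right b f)) hs'

instance fromUnit_isComonHom (A : Ff C) [ComonObj A] : IsComonHom (Ff.fromUnit A) :=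
  isComonHom_mk _ fun f => by
    exact ((Δ[A]).lam_app f).trans
      (Eq.trans (Category.id_comp _).symm (Category.id_comp _).symm)

instance tensAssoc_isComonHom (A B D : Ff C) [ComonObj A] [ComonObj B] [ComonObj D] :
    IsComonHom (Ff.tensAssoc A B D).hom :=
  isComonHom_mk _ fun f => by
    have hd : Ff.leftInto B D f ≫ Ff.leftInto A (Ff.tens B D) f =
        Ff.leftInto (Ff.tens A B) D f ≫ Ff.Hom.left (Ff.tensAssoc A B D).hom f :=
      Arrow.hom_ext _ _ rfl (Category.comp_id _).symm
    have hb : comulSquare B D f ≫ D.R.map (Ff.leftInto A (Ff.tens B D) f) =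
        Ff.leftInto A B (Arrow.mk (D.rho f)) ≫ comulSquare (Ff.tens A B) D f ≫
          D.R.map (Ff.Hom.left (Ff.tensAssoc A B D).hom f) := by
      refine Arrow.hom_ext _ _ ?_ ?_
      · refine (D.comp_map _ _ _).trans (Eq.trans ?_ (Category.id_comp _).symm)
        exact (congrArg (fun t => _ ≫ D.E.map t) hd).trans (D.comp_map _ _ _).symm
      · exact (Category.id_comp _).trans
          ((congrArg (_ ≫ ·) (Category.comp_id _)).trans (Category.comp_id _)).symm
    have ha : comulSquare A (Ff.tens B D) f =
        comulSquare A B (Arrow.mk (D.rho f)) ≫ B.R.map (comulSquare (Ff.tens A B) D f) ≫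
          B.R.map (D.R.map (Ff.Hom.left (Ff.tensAssoc A B D).hom f)) := by
      refine Arrow.hom_ext _ _ ?_ ((congrArg (_ ≫ ·) (Category.comp_id _)).trans
        (Category.comp_id _)).symm
      refine (congrArg (· ≫ _) (tensComul_app B D f)).trans ?_
      refine (B.comp_map _ _ _).trans ((congrArg (fun t => _ ≫ B.E.map t) hb).trans ?_)
      refine (B.comp_map _ _ _).symm.trans (congrArg (_ ≫ ·) (B.E.map_comp _ _))
    refine (Category.id_comp _).trans ((tensComul_app A (Ff.tens B D) f).trans ?_)
    refine Eq.trans ?_ (congrArg (_ ≫ ·) (Category.comp_id _).symm)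
    refine Eq.trans ?_ (congrArg (· ≫ _) (tensComul_app (Ff.tens A B) D f).symm)
    refine Eq.trans ?_ (congrArg (fun t => (t ≫ _) ≫ _)
      (tensComul_app A B (Arrow.mk (D.rho f))).symm)
    refine Eq.trans ?_ (congrArg (· ≫ _) (A.comp_map _ _ _).symm)
    refine Eq.trans ?_ (A.comp_map _ _ _).symm
    exact congrArg (fun t => _ ≫ A.E.map t) (ha.trans (Category.assoc _ _ _).symm)

instance tensLeftUnitor_isComonHom (A : Ff C) [ComonObj A] :
    IsComonHom (Ff.tensLeftUnitor A).hom :=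
  isComonHom_mk _ fun f => by
    refine (Category.id_comp _).trans ?_
    refine Eq.trans ?_ (congrArg (· ≫ _) (tensComul_app Ff.unit A f).symm)
    refine Eq.trans ?_ (congrArg (_ ≫ ·) (Category.comp_id _).symm)
    refine Eq.trans ?_ (congrArg (· ≫ _) (Category.id_comp _).symm)
    refine Eq.trans ?_ (A.comp_map _ _ _).symm
    refine (Category.comp_id _).symm.trans (congrArg (_ ≫ ·) (A.map_eq_id ?_ ?_).symm)
    · exact Category.comp_id _
    · exact Category.comp_id _

instance tensRightUnitor_isComonHom (A : Ff C) [ComonObj A] :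
    IsComonHom (Ff.tensRightUnitor A).hom :=
  isComonHom_mk _ fun f => by
    refine (Category.id_comp _).trans ?_
    refine Eq.trans ?_ (congrArg (· ≫ _) (tensComul_app A Ff.unit f).symm)
    refine Eq.trans ?_ (congrArg (_ ≫ ·) (Category.comp_id _).symm)
    refine Eq.trans ?_ (A.comp_map _ _ _).symm
    refine (Category.comp_id _).symm.trans (congrArg (_ ≫ ·) (A.map_eq_id ?_ ?_).symm)
    · exact (Category.comp_id _).trans (Category.comp_id _)
    · exact Category.comp_id _

/-- The monoidal category structure `(⊗, unit)` on the category of `⊙`-comonoids. -/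
instance : MonoidalCategory (Comon (Ff C)) where
  tensorObj A B := ⟨Ff.tens A.X B.X⟩
  tensorUnit := ⟨Ff.unit⟩
  tensorHom a b := ⟨Ff.tensHom a.hom b.hom⟩
  whiskerLeft A _ _ b := ⟨Ff.tensHom (𝟙 A.X) b.hom⟩
  whiskerRight a B := ⟨Ff.tensHom a.hom (𝟙 B.X)⟩
  associator A B D :=
    { hom := ⟨(Ff.tensAssoc A.X B.X D.X).hom⟩
      inv := ⟨(Ff.tensAssoc A.X B.X D.X).inv⟩
      hom_inv_id := Comon.ext (Ff.tensAssoc A.X B.X D.X).hom_inv_id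
      inv_hom_id := Comon.ext (Ff.tensAssoc A.X B.X D.X).inv_hom_id }
  leftUnitor A :=
    { hom := ⟨(Ff.tensLeftUnitor A.X).hom⟩
      inv := ⟨(Ff.tensLeftUnitor A.X).inv⟩
      hom_inv_id := Comon.ext (Ff.tensLeftUnitor A.X).hom_inv_id
      inv_hom_id := Comon.ext (Ff.tensLeftUnitor A.X).inv_hom_id }
  rightUnitor A :=
    { hom := ⟨(Ff.tensRightUnitor A.X).hom⟩
      inv := ⟨(Ff.tensRightUnitor A.X).inv⟩
      hom_inv_id := Comon.ext (Ff.tensRightUnitor A.X).hom_inv_id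
      inv_hom_id := Comon.ext (Ff.tensRightUnitor A.X).inv_hom_id }
  tensorHom_def {A A' B B'} a b := Comon.ext (Ff.hom_ext fun f => by
    refine Eq.trans ?_ (congrArg (_ ≫ ·) (Category.comp_id _).symm)
    refine Eq.trans ?_ (congrArg (fun t => (t ≫ _) ≫ _) (A.X.map_eq_id rfl rfl).symm)
    refine Eq.trans ?_ (congrArg (· ≫ _) (Category.id_comp _).symm)
    exact a.hom.nat _)
  id_tensorHom_id A B := Comon.ext (Ff.hom_ext fun f =>
    (Category.comp_id _).trans (A.X.map_eq_id rfl rfl))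
  tensorHom_comp_tensorHom {A A' A'' B B' B''} a b c d := Comon.ext (Ff.hom_ext fun f => by
    refine Eq.trans ?_ (congrArg (· ≫ _) ((congrArg A.X.E.map
      (Ff.right_comp b.hom d.hom f)).trans (A.X.E.map_comp _ _)).symm)
    refine (Category.assoc _ _ _).trans (Eq.trans ?_ (Category.assoc _ _ _).symm)
    refine congrArg (_ ≫ ·) ((Category.assoc _ _ _).symm.trans (Eq.trans ?_ (Category.assoc _ _ _)))
    exact congrArg (· ≫ _) (a.hom.nat _).symm)
  whiskerLeft_id A B := Comon.ext (Ff.hom_ext fun f =>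
    (Category.comp_id _).trans (A.X.map_eq_id rfl rfl))
  id_whiskerRight A B := Comon.ext (Ff.hom_ext fun f =>
    (Category.comp_id _).trans (A.X.map_eq_id rfl rfl))
  associator_naturality {A B D A' B' D'} a b c := Comon.ext (Ff.hom_ext fun f => by
    refine (Category.comp_id _).trans (Eq.trans ?_ (Category.id_comp _).symm)
    refine (Category.assoc _ _ _).symm.trans (congrArg (· ≫ _) ?_)
    refine (A.X.E.map_comp _ _).symm.trans (A.X.map_congr rfl ?_)
    exact Category.comp_id _)
  leftUnitor_naturality a := Comon.ext (Ff.hom_ext fun f => by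
    refine (Category.comp_id _).trans ?_
    exact (Category.comp_id _).trans (Category.id_comp _).symm)
  rightUnitor_naturality {A B} a := Comon.ext (Ff.hom_ext fun f => by
    refine (Category.comp_id _).trans ?_
    exact congrArg (· ≫ a.hom.app f) (A.X.map_eq_id rfl rfl))
  pentagon A B D F := Comon.ext (Ff.hom_ext fun f => by
    refine Eq.trans ?_ (Category.comp_id _).symm
    refine (congrArg (· ≫ _) ((Category.comp_id _).trans (A.X.map_eq_id
      (B.X.map_eq_id (D.X.map_eq_id rfl rfl) rfl) rfl))).trans ?_
    refine (Category.id_comp _).trans ((Category.id_comp _).trans ?_)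
    exact (Category.comp_id _).trans (A.X.map_eq_id rfl rfl))
  triangle A B := Comon.ext (Ff.hom_ext fun f => by
    refine (Category.id_comp _).trans ?_
    exact congrArg (· ≫ _) (A.X.map_congr rfl rfl))

end Comonoids
/-- The pointing of a `⊙`-comonoid, that is, the unique morphism from the unit for `⊗`. -/
abbrev point {C : Type u} [Category.{v} C] (A : Comon (Ff C)) : 𝟙_ (Comon (Ff C)) ⟶ A where
  hom := Ff.fromUnit A.X
  isComonHom_hom := fromUnit_isComonHom A.X

/-! ## Natural weak factorisation systems -/

/-- A natural weak factorisation system on `C`: a functorial factorisation with a comultiplication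
`sig : E f ⟶ E (L f)` making `L` a comonad, a multiplication `pi : E (R f) ⟶ E f` making `R` a
monad, and such that the squares `(sig f, pi f) : L (R f) ⟶ R (L f)` form a distributive law. -/
structure NWFS (C : Type u) [Category.{v} C] extends Ff C where
  /-- The comultiplication. -/
  sig (f : Arrow C) : E.obj f ⟶ E.obj (toFf.L.obj f)
  /-- The multiplication. -/
  pi (f : Arrow C) : E.obj (toFf.R.obj f) ⟶ E.obj f
  sig_nat {f g : Arrow C} (φ : f ⟶ g) : E.map φ ≫ sig g = sig f ≫ E.map (toFf.L.map φ)
  pi_nat {f g : Arrow C} (φ : f ⟶ g) : E.map (toFf.R.map φ) ≫ pi g = pi f ≫ E.map φ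
  lam_sig (f : Arrow C) : lam f ≫ sig f = lam (toFf.L.obj f)
  pi_rho (f : Arrow C) : pi f ≫ rho f = rho (toFf.R.obj f)
  sig_rho (f : Arrow C) : sig f ≫ rho (toFf.L.obj f) = 𝟙 (E.obj f)
  sig_map_rho (f : Arrow C) : sig f ≫ E.map (toFf.Phi f) = 𝟙 (E.obj f)
  sig_sig (f : Arrow C) :
    sig f ≫ E.map (Arrow.homMk' (f := lam f) (g := lam (toFf.L.obj f)) (𝟙 f.left) (sig f)
      ((Category.id_comp _).trans (lam_sig f).symm)) = sig f ≫ sig (toFf.L.obj f)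
  lam_pi (f : Arrow C) : lam (toFf.R.obj f) ≫ pi f = 𝟙 (E.obj f)
  map_lam_pi (f : Arrow C) : E.map (toFf.Lam f) ≫ pi f = 𝟙 (E.obj f)
  pi_pi (f : Arrow C) :
    E.map (Arrow.homMk' (f := rho (toFf.R.obj f)) (g := rho f) (pi f) (𝟙 f.right)
      ((pi_rho f).trans (Category.comp_id _).symm)) ≫ pi f = pi (toFf.R.obj f) ≫ pi f
  distrib (f : Arrow C) :
    pi f ≫ sig f = sig (toFf.R.obj f) ≫ E.map (Arrow.homMk' (f := lam (toFf.R.obj f))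
      (g := rho (toFf.L.obj f)) (sig f) (pi f) ((sig_rho f).trans (lam_pi f).symm)) ≫
        pi (toFf.L.obj f)

namespace NWFS

variable {C : Type u} [Category.{v} C]

/-- The comultiplication of a natural weak factorisation system, as a morphism. -/
abbrev comulHom (N : NWFS C) : N.toFf ⟶ Ff.odot N.toFf N.toFf where
  app := N.sig
  nat := N.sig_nat
  lam_app := N.lam_sig
  app_rho f := by rw [← Category.assoc, N.sig_rho]; exact Category.id_comp _

/-- The multiplication of a natural weak factorisation system, as a morphism. -/
abbrev mulHom (N : NWFS C) : Ff.tens N.toFf N.toFf ⟶ N.toFf where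
  app := N.pi
  nat := N.pi_nat
  lam_app f := by rw [Category.assoc, N.lam_pi]; exact Category.comp_id _
  app_rho := N.pi_rho

instance (N : NWFS C) : ComonObj N.toFf :=
  comonObjMk N.toFf N.comulHom N.sig_rho N.sig_map_rho N.sig_sig

/-- The comonad half of a natural weak factorisation system, as a `⊙`-comonoid. -/
abbrev toComon (N : NWFS C) : Comon (Ff C) := ⟨N.toFf⟩

instance mulHom_isComonHom (N : NWFS C) : IsComonHom N.mulHom :=
  isComonHom_mk _ fun f => by
    have h : comulSquare N.toFf N.toFf f ≫ N.R.map (Ff.Hom.left N.mulHom f) =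
        Arrow.homMk' (f := N.lam (Arrow.mk (N.rho f))) (g := N.rho (Arrow.mk (N.lam f)))
          (N.sig f) (N.pi f) ((N.sig_rho f).trans (N.lam_pi f).symm) := by
      refine Arrow.hom_ext _ _ ?_ (Category.id_comp _)
      refine (N.toFf.comp_map _ _ _).trans
        ((congrArg (_ ≫ ·) (N.toFf.map_eq_id ?_ ?_)).trans (Category.comp_id _))
      · exact Category.comp_id _
      · exact N.lam_pi f
    refine (N.distrib f).trans ?_
    refine Eq.trans ?_ (congrArg (· ≫ _) (tensComul_app N.toFf N.toFf f).symm)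
    refine Eq.trans ?_ (Category.assoc _ _ _)
    refine (Category.assoc _ _ _).symm.trans (congrArg (· ≫ _) ?_)
    refine Eq.trans ?_ (N.toFf.comp_map _ _ _).symm
    exact congrArg (fun t => _ ≫ N.E.map t) h.symm

/-- A natural weak factorisation system as a `⊗`-monoid in the category of `⊙`-comonoids. -/
abbrev toMon (N : NWFS C) : Mon (Comon (Ff C)) where
  X := N.toComon
  mon :=
    { one := point N.toComon
      mul := ⟨N.mulHom⟩
      one_mul := Comon.ext (Ff.hom_ext fun f => by
        refine (congrArg (· ≫ _) ((congrArg (· ≫ _) (Ff.unit.map_eq_id rfl rfl)).trans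
          (Category.id_comp _))).trans ?_
        exact N.lam_pi f)
      mul_one := Comon.ext (Ff.hom_ext fun f => by
        refine (congrArg (· ≫ _) (Category.comp_id _)).trans ?_
        exact N.map_lam_pi f)
      mul_assoc := Comon.ext (Ff.hom_ext fun f => by
        refine (congrArg (· ≫ _) ((congrArg (· ≫ _)
          (N.toFf.map_eq_id (N.toFf.map_eq_id rfl rfl) rfl)).trans (Category.id_comp _))).trans ?_
        refine (N.pi_pi f).symm.trans (Eq.trans ?_ (Category.id_comp _).symm)
        exact congrArg (· ≫ _) (Category.comp_id _).symm) }

end NWFS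

/-! ## The one-step comonad -/

section OneStep

variable {C : Type u} [Category.{v} C] [HasColimits C] {J : Type v} {A B : J → C}
  (i : ∀ j, A j ⟶ B j)

/-- The set of lifting problems from some member of the family `i` to `g`. -/
abbrev LiftingProblem (g : Arrow C) : Type v := Σ j, (Arrow.mk (i j) ⟶ g)

/-- The object `E¹ g` obtained by glueing to the domain of `g` one cell for each lifting problem:
the pushout of `∐ A ⟶ dom g` along `∐ A ⟶ ∐ B`, the coproducts being over all lifting problems. -/
noncomputable def cellObj (g : Arrow C) : C :=
  pushout (Sigma.desc fun x : LiftingProblem i g => (x.2.left : A x.1 ⟶ g.left))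
    (Limits.Sigma.map fun x : LiftingProblem i g => i x.1)

/-- The inclusion of the domain of `g` into `E¹ g`. -/
noncomputable def cellLam (g : Arrow C) : g.left ⟶ cellObj i g := pushout.inl _ _

/-- The inclusion into `E¹ g` of the cell attached along a lifting problem. -/
noncomputable def cell (g : Arrow C) (x : LiftingProblem i g) : B x.1 ⟶ cellObj i g :=
  Sigma.ι (fun x : LiftingProblem i g => B x.1) x ≫ pushout.inr _ _

theorem cell_w (g : Arrow C) (x : LiftingProblem i g) :
    x.2.left ≫ cellLam i g = i x.1 ≫ cell i g x := by
  have h := congrArg (Sigma.ι (fun x : LiftingProblem i g => A x.1) x ≫ ·)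
    (pushout.condition (f := Sigma.desc fun x : LiftingProblem i g => (x.2.left : A x.1 ⟶ g.left))
      (g := Limits.Sigma.map fun x : LiftingProblem i g => i x.1))
  rw [Sigma.ι_desc_assoc, Sigma.ι_map_assoc] at h
  exact h

/-- The morphism out of `E¹ g` given by a morphism out of the domain of `g` and compatible morphisms
out of the cells. -/
noncomputable def cellDesc (g : Arrow C) {Z : C} (a : g.left ⟶ Z)
    (b : ∀ x : LiftingProblem i g, B x.1 ⟶ Z)
    (h : ∀ x : LiftingProblem i g, x.2.left ≫ a = i x.1 ≫ b x) : cellObj i g ⟶ Z :=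
  pushout.desc a (Sigma.desc b) (Sigma.hom_ext _ _ fun x => by simpa using h x)

theorem cellLam_desc (g : Arrow C) {Z : C} (a : g.left ⟶ Z)
    (b : ∀ x : LiftingProblem i g, B x.1 ⟶ Z) (h) :
    cellLam i g ≫ cellDesc i g a b h = a :=
  pushout.inl_desc _ _ _

theorem cell_desc (g : Arrow C) {Z : C} (a : g.left ⟶ Z)
    (b : ∀ x : LiftingProblem i g, B x.1 ⟶ Z) (h) (x : LiftingProblem i g) :
    cell i g x ≫ cellDesc i g a b h = b x :=
  (Category.assoc _ _ _).trans
    ((congrArg (_ ≫ ·) (pushout.inr_desc _ _ _)).trans (Sigma.ι_desc _ _))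

theorem cell_hom_ext (g : Arrow C) {Z : C} {s t : cellObj i g ⟶ Z}
    (h : cellLam i g ≫ s = cellLam i g ≫ t)
    (h' : ∀ x, cell i g x ≫ s = cell i g x ≫ t) : s = t :=
  pushout.hom_ext h (Sigma.hom_ext _ _ fun x =>
    (Category.assoc _ _ _).symm.trans ((h' x).trans (Category.assoc _ _ _)))

/-- The action on squares of the functor `E¹`. -/
noncomputable def cellMap {g g' : Arrow C} (γ : g ⟶ g') : cellObj i g ⟶ cellObj i g' :=
  cellDesc i g (γ.left ≫ cellLam i g') (fun x => cell i g' ⟨x.1, x.2 ≫ γ⟩) fun x =>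
    (Category.assoc _ _ _).symm.trans (cell_w i g' ⟨x.1, x.2 ≫ γ⟩)

theorem cellLam_map {g g' : Arrow C} (γ : g ⟶ g') :
    cellLam i g ≫ cellMap i γ = γ.left ≫ cellLam i g' :=
  cellLam_desc i g _ _ _

theorem cell_map {g g' : Arrow C} (γ : g ⟶ g') (x : LiftingProblem i g) :
    cell i g x ≫ cellMap i γ = cell i g' ⟨x.1, x.2 ≫ γ⟩ :=
  cell_desc i g _ _ _ x

/-- The right half `E¹ g ⟶ cod g` of the one-step factorisation of `g`. -/
noncomputable def cellRho (g : Arrow C) : cellObj i g ⟶ g.right :=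
  cellDesc i g g.hom (fun x => x.2.right) fun x => x.2.w

theorem cellLam_rho (g : Arrow C) : cellLam i g ≫ cellRho i g = g.hom :=
  cellLam_desc i g _ _ _

theorem cell_rho (g : Arrow C) (x : LiftingProblem i g) : cell i g x ≫ cellRho i g = x.2.right :=
  cell_desc i g _ _ _ x

theorem cell_congr (g : Arrow C) {j : J} {φ ψ : Arrow.mk (i j) ⟶ g} (h : φ.left = ψ.left)
    (h' : φ.right = ψ.right) : cell i g ⟨j, φ⟩ = cell i g ⟨j, ψ⟩ := by
  rw [Arrow.hom_ext φ ψ h h']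

/-- The one-step functorial factorisation `(E¹, lam¹, rho¹)`. -/
noncomputable abbrev oneStepFf : Ff C where
  E :=
    { obj := cellObj i
      map := cellMap i
      map_id := fun g => cell_hom_ext i g
        ((cellLam_map i _).trans ((Category.id_comp _).trans (Category.comp_id _).symm))
        fun x => (cell_map i _ x).trans (by rw [Category.comp_id, Category.comp_id])
      map_comp := fun γ γ' => cell_hom_ext i _
        (by rw [cellLam_map, ← Category.assoc, cellLam_map, Category.assoc, cellLam_map,
          ← Category.assoc]; rfl)
        fun x => by
          rw [← Category.assoc]
          have h : cell i _ ⟨x.1, x.2 ≫ γ ≫ γ'⟩ = cell i _ ⟨x.1, (x.2 ≫ γ) ≫ γ'⟩ := by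
            rw [Category.assoc]
          exact (cell_map i (γ ≫ γ') x).trans (h.trans ((cell_map i γ' ⟨x.1, x.2 ≫ γ⟩).symm.trans
            (congrArg (· ≫ cellMap i γ') (cell_map i γ x).symm))) }
  lam := cellLam i
  rho := cellRho i
  lam_nat γ := (cellLam_map i γ).symm
  rho_nat γ := cell_hom_ext i _
    (by rw [← Category.assoc, cellLam_map, Category.assoc, cellLam_rho, ← Category.assoc,
      cellLam_rho]; exact γ.w)
    fun x => by rw [← Category.assoc, cell_map, cell_rho, ← Category.assoc, cell_rho]; rfl
  fac := cellLam_rho i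

/-- The lifting problem in `lam¹ g` given by the cell attached along a lifting problem in `g`. -/
noncomputable abbrev cellProblem (g : Arrow C) (x : LiftingProblem i g) :
    LiftingProblem i (Arrow.mk (cellLam i g)) :=
  ⟨x.1, Arrow.homMk' x.2.left (cell i g x) (cell_w i g x)⟩

/-- The comultiplication of the one-step comonad, which sends each cell attached to `g` to the cell
attached to `lam¹ g` along it. -/
noncomputable def cellComul (g : Arrow C) : cellObj i g ⟶ cellObj i (Arrow.mk (cellLam i g)) :=
  cellDesc i g (cellLam i (Arrow.mk (cellLam i g)))
    (fun x => cell i (Arrow.mk (cellLam i g)) (cellProblem i g x))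
    (fun x => cell_w i (Arrow.mk (cellLam i g)) (cellProblem i g x))

theorem cellLam_comul (g : Arrow C) :
    cellLam i g ≫ cellComul i g = cellLam i (Arrow.mk (cellLam i g)) :=
  cellLam_desc i g _ _ _

theorem cell_comul (g : Arrow C) (x : LiftingProblem i g) :
    cell i g x ≫ cellComul i g = cell i (Arrow.mk (cellLam i g)) (cellProblem i g x) :=
  cell_desc i g _ _ _ x

theorem cellComul_rho (g : Arrow C) :
    cellComul i g ≫ cellRho i (Arrow.mk (cellLam i g)) = 𝟙 (cellObj i g) :=
  cell_hom_ext i g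
    (by rw [← Category.assoc, cellLam_comul, cellLam_rho]; exact (Category.comp_id _).symm)
    fun x => by rw [← Category.assoc, cell_comul, cell_rho]; exact (Category.comp_id _).symm

/-- `cellComul`, as a morphism of functorial factorisations. -/
noncomputable abbrev oneStepComul : oneStepFf i ⟶ Ff.odot (oneStepFf i) (oneStepFf i) where
  app := cellComul i
  nat {g g'} γ := cell_hom_ext i _
    (((Category.assoc _ _ _).symm.trans (congrArg (· ≫ _) (cellLam_map i γ))).trans
      ((Category.assoc _ _ _).trans ((congrArg (γ.left ≫ ·) (cellLam_comul i g')).trans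
        (Eq.trans (cellLam_map i ((oneStepFf i).L.map γ)).symm
          ((congrArg (· ≫ _) (cellLam_comul i g).symm).trans (Category.assoc _ _ _))))))
    fun x => by
      refine ((Category.assoc _ _ _).symm.trans (congrArg (· ≫ _) (cell_map i γ x))).trans
        ((cell_comul i g' _).trans (Eq.symm (Eq.trans ((Category.assoc _ _ _).symm.trans
          ((congrArg (· ≫ _) (cell_comul i g x)).trans (cell_map i _ _))) ?_)))
      exact cell_congr i _ rfl (cell_map i γ x)
  lam_app := cellLam_comul i
  app_rho g := by
    rw [← Category.assoc, cellComul_rho]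
    exact Category.id_comp _

/-- The one-step comonad generated by the family `i`, as a `⊙`-comonoid. -/
noncomputable def oneStep : Comon (Ff C) where
  X := oneStepFf i
  comon := comonObjMk (oneStepFf i) (oneStepComul i) (cellComul_rho i)
    (fun g => cell_hom_ext i g
      ((Category.assoc _ _ _).symm.trans ((congrArg (· ≫ _) (cellLam_comul i g)).trans
        ((cellLam_map i _).trans ((Category.id_comp _).trans (Category.comp_id _).symm))))
      fun x => by
        refine (Category.assoc _ _ _).symm.trans ((congrArg (· ≫ _) (cell_comul i g x)).trans
          ((cell_map i _ _).trans (Eq.trans ?_ (Category.comp_id _).symm)))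
        exact cell_congr i _ (Category.comp_id _) (cell_rho i g x))
    (fun g => cell_hom_ext i g
      ((Category.assoc _ _ _).symm.trans ((congrArg (· ≫ _) (cellLam_comul i g)).trans
        ((cellLam_map i _).trans ((Category.id_comp _).trans
          ((cellLam_comul i (Arrow.mk (cellLam i g))).symm.trans
            ((congrArg (· ≫ _) (cellLam_comul i g).symm).trans (Category.assoc _ _ _)))))))
      fun x => by
        refine (Category.assoc _ _ _).symm.trans ((congrArg (· ≫ _) (cell_comul i g x)).trans
          ((cell_map i _ _).trans (Eq.symm (Eq.trans ((Category.assoc _ _ _).symm.trans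
            ((congrArg (· ≫ _) (cell_comul i g x)).trans (cell_comul i _ _))) ?_))))
        exact cell_congr i _ (Category.comp_id _).symm (cell_comul i g x).symm)

end OneStep

/-! ## Free monoids and free module sequences -/

section FreeMonoid

variable {V : Type u} [Category.{v} V] [MonoidalCategory V]

open MonObj

/-- The monoid `U` with `χ : T ⟶ U` is the free monoid on the pointed object `(T, τ)`: `χ` is a map
of pointed objects, and every map of pointed objects from `(T, τ)` to a monoid factors through `χ`
by a unique map of monoids. -/
structure IsFreeMonoid {T : V} (τ : 𝟙_ V ⟶ T) (U : Mon V) (χ : T ⟶ U.X) : Prop where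
  pointed : τ ≫ χ = η[U.X]
  existsUnique (W : Mon V) (g : T ⟶ W.X) (hg : τ ≫ g = η[W.X]) : ∃! h : U ⟶ W, χ ≫ h.hom = g

/-- The morphism `X ⟶ T ⊗ X` induced by a pointing of `T`. -/
abbrev pointTensor {T : V} (τ : 𝟙_ V ⟶ T) (X : V) : X ⟶ T ⊗ X := (λ_ X).inv ≫ τ ▷ X

/-- The free `T`-module sequence on `A`, for a pointed object `(T, τ)`, indexed by all ordinals. -/
structure FreeModuleSequence {T : V} (τ : 𝟙_ V ⟶ T) (A : V) where
  /-- The underlying transfinite sequence. -/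
  X : Ordinal.{w} ⥤ V
  /-- The maps from `T ⊗ X β` to the next stage. -/
  act (β : Ordinal.{w}) : T ⊗ X.obj β ⟶ X.obj (Order.succ β)
  act_nat {β ν : Ordinal.{w}} (h : β ≤ ν) :
    T ◁ X.map (homOfLE h) ≫ act ν = act β ≫ X.map (homOfLE (Order.succ_le_succ h))
  point_act (β : Ordinal.{w}) :
    pointTensor τ (X.obj β) ≫ act β = X.map (homOfLE (Order.le_succ β))
  /-- The sequence starts at `A`. -/
  zero : A ≅ X.obj 0
  isIso_act_zero : IsIso (act 0)
  /-- At a successor ordinal, the next map is the coequaliser of the two given maps. -/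
  succ_w (β : Ordinal.{w}) :
    (act β ≫ pointTensor τ (X.obj (Order.succ β))) ≫ act (Order.succ β) =
      (T ◁ pointTensor τ (X.obj β) ≫ T ◁ act β) ≫ act (Order.succ β)
  isColimit_succ (β : Ordinal.{w}) : Nonempty (IsColimit (Cofork.ofπ _ (succ_w β)))
  /-- At a limit ordinal `ν`, the stage `X ν` is the colimit of the previous ones. -/
  continuous : X.IsWellOrderContinuous
  /-- At a limit ordinal `ν`, the map `act ν` is the coequaliser of the two morphisms to `T ⊗ X ν`
  from the colimit of the `T ⊗ X β` for `β < ν`; these two are given by their components. -/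
  limit_w {β ν : Ordinal.{w}} (hν : Order.IsSuccLimit ν) (h : β < ν) :
    (act β ≫ X.map (homOfLE (Order.succ_le_of_lt h)) ≫ pointTensor τ (X.obj ν)) ≫ act ν =
      T ◁ X.map (homOfLE h.le) ≫ act ν
  existsUnique_limit {ν : Ordinal.{w}} (hν : Order.IsSuccLimit ν) {Z : V} (g : T ⊗ X.obj ν ⟶ Z)
    (hg : ∀ (β : Ordinal.{w}) (h : β < ν),
      (act β ≫ X.map (homOfLE (Order.succ_le_of_lt h)) ≫ pointTensor τ (X.obj ν)) ≫ g =
        T ◁ X.map (homOfLE h.le) ≫ g) :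
    ∃! k : X.obj (Order.succ ν) ⟶ Z, act ν ≫ k = g

end FreeMonoid

/-! ## Smallness and orthogonal factorisation systems -/

section Smallness

/-- A limit ordinal `β` is `α`-filtered if every subset of `β` of cardinality at most `α` has
supremum less than `β`. -/
def IsFilteredOrdinal (α : Cardinal.{w}) (β : Ordinal.{w}) : Prop :=
  Order.IsSuccLimit β ∧ ∀ S : Set Ordinal.{w}, S ⊆ Set.Iio β →
    Cardinal.mk S ≤ Cardinal.lift.{w + 1} α → sSup S < β

variable {K : Type u} [Category.{v} K] {D : Type*} [Category* D]

/-- A functor is `α`-small if it preserves colimits of chains indexed by `α`-filtered ordinals. -/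
def IsSmallFunctor (α : Cardinal.{w}) (T : K ⥤ D) : Prop :=
  ∀ β : Ordinal.{w}, IsFilteredOrdinal α β → ∀ F : β.ToType ⥤ K, PreservesColimit F T

/-- A functor is `α`-small relative to `M` if it preserves colimits of chains of `M`-maps indexed by
`α`-filtered ordinals. -/
def IsSmallFunctorRel (M : MorphismProperty K) (α : Cardinal.{w}) (T : K ⥤ D) : Prop :=
  ∀ β : Ordinal.{w}, IsFilteredOrdinal α β → ∀ F : β.ToType ⥤ K,
    (∀ ⦃x y : β.ToType⦄ (h : x ⟶ y), M (F.map h)) → PreservesColimit F T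

/-- An orthogonal factorisation system: two classes of maps, closed under retracts, such that every
map factors as a map in `P` followed by a map in `M`, and such that every square from a map in `P`
to a map in `M` has a unique diagonal filler. -/
structure IsOrthogonalFactorisationSystem (P M : MorphismProperty K) : Prop where
  retract_left : P.IsStableUnderRetracts
  retract_right : M.IsStableUnderRetracts
  factorisation : P.HasFactorization M
  unique_lifting {X Y Z W : K} (e : X ⟶ Y) (m : Z ⟶ W) (he : P e) (hm : M m) (a : X ⟶ Z) (b : Y ⟶ W)
    (h : a ≫ m = e ≫ b) : ∃! d : Y ⟶ Z, e ≫ d = a ∧ d ≫ m = b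

/-- A class `P` of maps is cowellpowered if the maps in `P` out of any given object form a small set
up to isomorphism under that object. -/
def IsCowellpowered (P : MorphismProperty K) : Prop :=
  ∀ X : K, ObjectProperty.EssentiallySmall.{w} fun Y : Under X => P Y.hom

end Smallness

end Nwfs

/-!
The natural weak factorisation system generated by a family `i` of maps is the free `⊗`-monoid on
the pointed object `oneStep i` of the category `Comon (Ff C)` of `⊙`-comonoids, and it is obtained
as the colimit of the free module sequence `X 0 ⟶ X 1 ⟶ ⋯` of `oneStep i` on the unit for `⊗`.

*Reduction to `C`.* Connected colimits of `⊙`-comonoids are formed pointwise, that is, they are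
preserved and jointly reflected by the functors `ev f : X ↦ E f` (`exists_pointwise_colimit`,
`isColimit_of_pointwise`), and a pointwise jointly epimorphic family of morphisms of comonoids is
universal as soon as it is so pointwise (`existsUnique_hom_of_pointwise`). The sequence exists by a
transfinite recursion (`exists_functor_of_next`), which produces at each stage the universal partial
action compatible with all the previous ones. It is free as seen by each `ev f` (`exists_isFreeAt`),
hence also after tensoring on the right with any `Y`, because `- ⊗ Y` followed by `ev f` is `ev (R_Y
f)`.

*Convergence.* Fix an arrow `f`. If each map from some `A j` to the stage `X β f` factors through an
earlier stage, essentially uniquely (`IsSmallAt`), then a lifting problem for `X β f ⟶ cod f` comes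
from an earlier stage and is solved in the next one. The solutions assemble to a retraction of the
attachment of the cells at `X β f` (`exists_retraction_of_isSmallAt`), by which the sequence stops
at `β` (`AlgSeq.IsFreeAt.isIso_map_of_isSmallAt`). If homming out of each `A j` is small, then one
`β` is good for all `f`. If it is only small relative to the right class of a cowellpowered
factorisation system, then the left class consists of epimorphisms
(`IsOrthogonalFactorisationSystem.epi`), so that the images of `X β f` in the later stages are
eventually constant by cowellpoweredness; these stable images form a chain of maps in the right
class that is interleaved with the given sequence, and smallness of the latter follows from that of
the former (`isSmallAt_of_interleaving`).

*The free monoid.* Since the sequence is eventually constant at each arrow, it has a colimit `N`,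
although it is indexed by all ordinals, and this colimit is preserved by `T ⊗ -` and by `- ⊗ Y`,
where `T` is `oneStep i`. Therefore `N ⊗ Y` is the free `T`-module on `Y` for every `Y`
(`AlgSeq.existsUnique_extension`). This universal property yields the multiplication of `N`, its
axioms, and its freeness as a monoid (`IsStablyFree.isFreeMonoid`). Finally, a `⊗`-monoid in
`⊙`-comonoids is the same thing as a natural weak factorisation system (`ofMon_toMon`).
-/

namespace Nwfs

/-! ### Colimits of `⊙`-comonoids -/

section Pointwise

open ComonObj

variable {C : Type u} [Category.{v} C]

/-- Evaluation of the middle object of a `⊙`-comonoid at an arrow. -/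
abbrev ev (f : Arrow C) : Comon (Ff C) ⥤ C where
  obj X := X.X.E.obj f
  map a := Ff.Hom.app a.hom f

theorem ev_nat {X Y : Comon (Ff C)} (a : X ⟶ Y) {f g : Arrow C} (φ : f ⟶ g) :
    X.X.E.map φ ≫ (ev g).map a = (ev f).map a ≫ Y.X.E.map φ :=
  Ff.Hom.nat a.hom φ

theorem lam_ev {X Y : Comon (Ff C)} (a : X ⟶ Y) (f : Arrow C) :
    X.X.lam f ≫ (ev f).map a = Y.X.lam f :=
  Ff.Hom.lam_app a.hom f

theorem ev_rho {X Y : Comon (Ff C)} (a : X ⟶ Y) (f : Arrow C) :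
    (ev f).map a ≫ Y.X.rho f = X.X.rho f :=
  Ff.Hom.app_rho a.hom f

theorem ev_comul {X Y : Comon (Ff C)} (a : X ⟶ Y) (f : Arrow C) :
    (ev f).map a ≫ Ff.Hom.app Δ[Y.X] f = Ff.Hom.app Δ[X.X] f ≫
      X.X.E.map (Ff.Hom.left a.hom f) ≫ (ev (Arrow.mk (Y.X.lam f))).map a :=
  comul_hom a.hom f

theorem comon_hom_ext {X Y : Comon (Ff C)} {a b : X ⟶ Y}
    (h : ∀ f, (ev f).map a = (ev f).map b) : a = b :=
  Comon.ext (Ff.hom_ext h)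

/-- A family of morphisms of `⊙`-comonoids that is pointwise jointly epimorphic has the following
universal property: a family of morphisms that factors through it pointwise does so uniquely, by a
morphism of `⊙`-comonoids. -/
theorem existsUnique_hom_of_pointwise {D : Type*} [Nonempty D] {A : D → Comon (Ff C)}
    {B Z : Comon (Ff C)} (p : ∀ d, A d ⟶ B) (q : ∀ d, A d ⟶ Z)
    (hp : ∀ (f : Arrow C) {W : C} (a b : (ev f).obj B ⟶ W),
      (∀ d, (ev f).map (p d) ≫ a = (ev f).map (p d) ≫ b) → a = b)
    (hk : ∀ f : Arrow C, ∃ k : (ev f).obj B ⟶ (ev f).obj Z,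
      ∀ d, (ev f).map (p d) ≫ k = (ev f).map (q d)) :
    ∃! k : B ⟶ Z, ∀ d, p d ≫ k = q d := by
  choose k hk using hk
  have nat {f g : Arrow C} (φ : f ⟶ g) : B.X.E.map φ ≫ k g = k f ≫ Z.X.E.map φ := hp f _ _ fun d => by
    rw [← Category.assoc, ← ev_nat, Category.assoc, hk, ev_nat, ← hk, Category.assoc]
  have lam (f : Arrow C) : B.X.lam f ≫ k f = Z.X.lam f := by
    obtain ⟨d⟩ := ‹Nonempty D›
    rw [← lam_ev (p d), Category.assoc, hk, lam_ev]
  have rho (f : Arrow C) : k f ≫ Z.X.rho f = B.X.rho f := hp f _ _ fun d => by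
    rw [← Category.assoc, hk, ev_rho, ev_rho]
  let k' : B.X ⟶ Z.X := ⟨k, nat, lam, rho⟩
  have hk' : IsComonHom k' := isComonHom_mk _ fun f => hp f _ _ fun d => by
    refine (Category.assoc _ _ _).symm.trans ((congrArg (· ≫ _) (hk f d)).trans
      ((ev_comul (q d) f).trans ?_))
    refine Eq.symm ((Category.assoc _ _ _).symm.trans ((congrArg (· ≫ _) (ev_comul (p d) f)).trans ?_))
    refine (Category.assoc _ _ _).trans (congrArg (_ ≫ ·) ?_)
    refine (Category.assoc _ _ _).trans ((congrArg (_ ≫ ·) ((Category.assoc _ _ _).symm.trans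
      (congrArg (· ≫ _) (ev_nat (p d) (Ff.Hom.left k' f)).symm))).trans ?_)
    refine (congrArg (_ ≫ ·) ((Category.assoc _ _ _).trans (congrArg (_ ≫ ·) (hk _ d)))).trans ?_
    refine (Category.assoc _ _ _).symm.trans (congrArg (· ≫ _) ?_)
    refine ((A d).X.E.map_comp _ _).symm.trans ((A d).X.map_congr (Category.comp_id _) (hk f d))
  refine ⟨⟨k'⟩, fun d => comon_hom_ext fun f => hk f d, fun l hl => comon_hom_ext fun f => ?_⟩
  exact hp f _ _ fun d => (congrArg (ev f).map (hl d)).trans (hk f d).symm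

theorem isIso_of_pointwise {X Y : Comon (Ff C)} (a : X ⟶ Y) (h : ∀ f, IsIso ((ev f).map a)) :
    IsIso a := by
  obtain ⟨b, hb, -⟩ := existsUnique_hom_of_pointwise (D := Unit) (fun _ => a) (fun _ => 𝟙 X)
    (fun f W s t hst => (cancel_epi ((ev f).map a)).1 (hst ⟨⟩))
    (fun f => ⟨inv ((ev f).map a), fun _ => by simp⟩)
  refine ⟨b, hb ⟨⟩, comon_hom_ext fun f => ?_⟩
  have := congrArg (ev f).map (hb ⟨⟩)
  rw [(ev f).map_comp, (ev f).map_id] at this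
  rw [← cancel_epi ((ev f).map a), (ev f).map_comp, ← Category.assoc, this, (ev f).map_id]
  simp

/-- A cocone of `⊙`-comonoids is a colimit as soon as it is one pointwise. -/
theorem isColimit_of_pointwise {D : Type*} [Category* D] [Nonempty D] {F : D ⥤ Comon (Ff C)}
    (c : Cocone F) (hc : ∀ f, Nonempty (IsColimit ((ev f).mapCocone c))) :
    Nonempty (IsColimit c) := by
  have key (s : Cocone F) : ∃! k : c.pt ⟶ s.pt, ∀ d, c.ι.app d ≫ k = s.ι.app d :=
    existsUnique_hom_of_pointwise _ _
      (fun f W a b hab => (hc f).some.hom_ext hab)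
      (fun f => ⟨(hc f).some.desc ((ev f).mapCocone s), (hc f).some.fac ((ev f).mapCocone s)⟩)
  exact ⟨{ desc := fun s => (key s).choose
           fac := fun s => (key s).choose_spec.1
           uniq := fun s => (key s).choose_spec.2 }⟩

section Construction

variable {D : Type*} [Category* D] [IsConnected D] {F : D ⥤ Comon (Ff C)}
  (c : ∀ f, Cocone (F ⋙ ev f)) (hc : ∀ f, IsColimit (c f))

theorem lam_ι_eq (f : Arrow C) (d d' : D) :
    (F.obj d).X.lam f ≫ (c f).ι.app d = (F.obj d').X.lam f ≫ (c f).ι.app d' := by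
  refine constant_of_preserves_morphisms
    (fun d => ((F.obj d).X.lam f ≫ (c f).ι.app d : f.left ⟶ (c f).pt)) (fun d d' a => ?_) d d'
  rw [← (c f).w a]
  exact (Category.assoc _ _ _).symm.trans (congrArg (· ≫ _) (lam_ev (F.map a) f))

/-- The functorial factorisation obtained by forming a connected colimit pointwise. -/
noncomputable abbrev colimFf : Ff C where
  E :=
    { obj := fun f => (c f).pt
      map := fun {f g} φ => (hc f).desc ⟨(c g).pt,
        { app := fun d => (F.obj d).X.E.map φ ≫ (c g).ι.app d
          naturality := fun d d' a => by
            refine (Category.assoc _ _ _).symm.trans ((congrArg (· ≫ _)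
              (ev_nat (F.map a) φ).symm).trans ((Category.assoc _ _ _).trans ?_))
            exact (congrArg (_ ≫ ·) ((c g).w a)).trans (Category.comp_id _).symm }⟩
      map_id := fun f => (hc f).hom_ext fun d => by
        refine ((hc f).fac _ _).trans ?_
        simp
      map_comp := fun {f g h} φ ψ => (hc f).hom_ext fun d => by
        refine ((hc f).fac _ _).trans ?_
        refine Eq.symm ((Category.assoc _ _ _).symm.trans ?_)
        refine (congrArg (· ≫ _) ((hc f).fac _ _)).trans ?_
        refine (Category.assoc _ _ _).trans ((congrArg (_ ≫ ·) ((hc g).fac _ _)).trans ?_)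
        simp }
  lam f := (F.obj (Classical.arbitrary D)).X.lam f ≫ (c f).ι.app (Classical.arbitrary D)
  rho f := (hc f).desc ⟨f.right,
    { app := fun d => (F.obj d).X.rho f
      naturality := fun d d' a => (ev_rho (F.map a) f).trans (Category.comp_id _).symm }⟩
  lam_nat {f g} φ := by
    refine Eq.symm ((Category.assoc _ _ _).trans ((congrArg (_ ≫ ·) ((hc f).fac _ _)).trans ?_))
    exact (Category.assoc _ _ _).symm.trans ((congrArg (· ≫ _) (Ff.lam_nat _ φ).symm).trans
      (Category.assoc _ _ _))
  rho_nat {f g} φ := (hc f).hom_ext fun d => by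
    refine (Category.assoc _ _ _).symm.trans ((congrArg (· ≫ _) ((hc f).fac _ _)).trans ?_)
    refine (Category.assoc _ _ _).trans ((congrArg (_ ≫ ·) ((hc g).fac _ _)).trans ?_)
    refine (Ff.rho_nat _ φ).trans ?_
    exact Eq.symm ((Category.assoc _ _ _).symm.trans (congrArg (· ≫ _) ((hc f).fac _ _)))
  fac f := by
    refine (Category.assoc _ _ _).trans ((congrArg (_ ≫ ·) ((hc f).fac _ _)).trans ?_)
    exact Ff.fac _ f

theorem ι_colimFf_map {f g : Arrow C} (φ : f ⟶ g) (d : D) :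
    (c f).ι.app d ≫ (colimFf c hc).E.map φ = (F.obj d).X.E.map φ ≫ (c g).ι.app d :=
  ((hc f).fac _ d).trans rfl

/-- The inclusions into a pointwise colimit of functorial factorisations. -/
noncomputable abbrev colimι (d : D) : (F.obj d).X ⟶ colimFf c hc where
  app f := (c f).ι.app d
  nat φ := (ι_colimFf_map c hc φ d).symm
  lam_app f := lam_ι_eq c f _ _
  app_rho f := ((hc f).fac _ d).trans rfl

/-- The comultiplication of a pointwise colimit of `⊙`-comonoids. -/
noncomputable abbrev colimComul : colimFf c hc ⟶ Ff.odot (colimFf c hc) (colimFf c hc) where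
  app f := (hc f).desc ⟨(c (Arrow.mk ((colimFf c hc).lam f))).pt,
    { app := fun d => Ff.Hom.app Δ[(F.obj d).X] f ≫ (F.obj d).X.E.map (Ff.Hom.left (colimι c hc d) f) ≫
        (c (Arrow.mk ((colimFf c hc).lam f))).ι.app d
      naturality := fun d d' a => by
        refine (Category.assoc _ _ _).symm.trans ((congrArg (· ≫ _) (ev_comul (F.map a) f)).trans ?_)
        refine Eq.trans ?_ (Category.comp_id _).symm
        refine (Category.assoc _ _ _).trans (congrArg (_ ≫ ·) ?_)
        refine (Category.assoc _ _ _).trans ((congrArg (_ ≫ ·) ((Category.assoc _ _ _).symm.trans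
          (congrArg (· ≫ _) (ev_nat (F.map a) _).symm))).trans ?_)
        refine (congrArg (_ ≫ ·) ((Category.assoc _ _ _).trans (congrArg (_ ≫ ·)
          ((c (Arrow.mk ((colimFf c hc).lam f))).w a)))).trans ?_
        refine (Category.assoc _ _ _).symm.trans (congrArg (· ≫ _) ?_)
        refine ((F.obj d).X.E.map_comp _ _).symm.trans ((F.obj d).X.map_congr (Category.comp_id _) ?_)
        exact ((congrArg (· ≫ _) rfl).trans ((c f).w a) :) }⟩
  nat {f g} φ := (hc f).hom_ext fun d => by
    refine (Category.assoc _ _ _).symm.trans ((congrArg (· ≫ _) ((hc f).fac _ _)).trans ?_)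
    refine (Category.assoc _ _ _).trans ((congrArg (_ ≫ ·) ((hc g).fac _ _)).trans ?_)
    refine Eq.symm ((Category.assoc _ _ _).symm.trans ((congrArg (· ≫ _) ((hc f).fac _ _)).trans ?_))
    refine (Category.assoc _ _ _).trans ((congrArg (_ ≫ ·) ((Category.assoc _ _ _).trans
      (congrArg (_ ≫ ·) (ι_colimFf_map c hc _ d)))).trans ?_)
    refine Eq.symm ((Category.assoc _ _ _).symm.trans ((congrArg (· ≫ _)
      (Ff.Hom.nat Δ[(F.obj d).X] φ)).trans ((Category.assoc _ _ _).trans (congrArg (_ ≫ ·) ?_))))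
    refine (Category.assoc _ _ _).symm.trans (Eq.trans (congrArg (· ≫ _) ?_) (Category.assoc _ _ _))
    refine ((F.obj d).X.E.map_comp _ _).symm.trans (Eq.trans ((F.obj d).X.map_congr ?_ ?_)
      ((F.obj d).X.E.map_comp _ _))
    · exact (Category.comp_id _).trans (Category.id_comp _).symm
    · exact (colimι c hc d).nat φ
  lam_app f := by
    refine (Category.assoc _ _ _).trans ((congrArg (_ ≫ ·) ((hc f).fac _ _)).trans ?_)
    refine (Category.assoc _ _ _).symm.trans ((congrArg (· ≫ _)
      (Ff.Hom.lam_app Δ[(F.obj _).X] f)).trans ?_)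
    refine (Category.assoc _ _ _).symm.trans ((congrArg (· ≫ _)
      (Ff.lam_nat (F.obj _).X (Ff.Hom.left (colimι c hc _) f)).symm).trans ?_)
    exact (congrArg (· ≫ _) (Category.id_comp _))
  app_rho f := (hc f).hom_ext fun d => by
    refine (Category.assoc _ _ _).symm.trans ((congrArg (· ≫ _) ((hc f).fac _ _)).trans ?_)
    refine Eq.trans ?_ ((colimι c hc d).app_rho f).symm
    refine (Category.assoc _ _ _).trans ((congrArg (_ ≫ ·) ((Category.assoc _ _ _).trans
      (congrArg (_ ≫ ·) ((Category.assoc _ _ _).symm.trans (congrArg (· ≫ _)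
        ((colimι c hc d).app_rho _)))))).trans ?_)
    refine (congrArg (_ ≫ ·) ((Category.assoc _ _ _).symm.trans (congrArg (· ≫ _)
      ((F.obj d).X.rho_nat (Ff.Hom.left (colimι c hc d) f))))).trans ?_
    refine (Category.assoc _ _ _).symm.trans ((congrArg (· ≫ _)
      ((Category.assoc _ _ _).symm.trans (congrArg (· ≫ _) (comul_rho (F.obj d).X f)))).trans ?_)
    refine (congrArg (· ≫ _) (Category.id_comp _)).trans ((colimι c hc d).app_rho f)

theorem ι_colimComul (f : Arrow C) (d : D) :
    (c f).ι.app d ≫ (colimComul c hc).app f = Ff.Hom.app Δ[(F.obj d).X] f ≫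
      (F.obj d).X.E.map (Ff.Hom.left (colimι c hc d) f) ≫
        (c (Arrow.mk ((colimFf c hc).lam f))).ι.app d :=
  (hc f).fac _ d

theorem paste_comul {x x₁ x₂ x₃ y₁ y₂ y₃ z₁ z₂ : C} {ι : x ⟶ y₁} {D : y₁ ⟶ y₂} {D' m : y₂ ⟶ y₃}
    {d : x ⟶ x₁} {e : x₁ ⟶ x₂} {ι' : x₂ ⟶ y₂} {m' : x₂ ⟶ x₃} {ι'' : x₃ ⟶ y₃} {d' : x₂ ⟶ z₂}
    {e' : z₂ ⟶ x₃} {d'' n : x₁ ⟶ z₁} {e'' : z₁ ⟶ z₂} (h₁ : ι ≫ D = d ≫ e ≫ ι')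
    (h₂ : ι' ≫ m = m' ≫ ι'') (h₃ : ι' ≫ D' = d' ≫ e' ≫ ι'') (h₄ : e ≫ d' = d'' ≫ e'')
    (h₅ : d ≫ n = d ≫ d'') (h₆ : e ≫ m' = n ≫ e'' ≫ e') : ι ≫ D ≫ m = ι ≫ D ≫ D' := by
  calc ι ≫ D ≫ m = (ι ≫ D) ≫ m := by simp
    _ = d ≫ (e ≫ m') ≫ ι'' := by rw [h₁]; simp [h₂]
    _ = (d ≫ d'') ≫ e'' ≫ e' ≫ ι'' := by rw [h₆, ← h₅]; simp
    _ = d ≫ (e ≫ d') ≫ e' ≫ ι'' := by rw [h₄]; simp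
    _ = (ι ≫ D) ≫ D' := by rw [h₁]; simp [h₃]
    _ = ι ≫ D ≫ D' := by simp

/-- The pointwise colimit of a connected diagram of `⊙`-comonoids. -/
noncomputable abbrev colimComon : Comon (Ff C) where
  X := colimFf c hc
  comon := comonObjMk _ (colimComul c hc)
    (fun f => (hc f).hom_ext fun d => by
      refine (Category.assoc _ _ _).symm.trans ((congrArg (· ≫ _) (ι_colimComul c hc f d)).trans ?_)
      refine (Category.assoc _ _ _).trans ((congrArg (_ ≫ ·) ((Category.assoc _ _ _).trans
        (congrArg (_ ≫ ·) ((colimι c hc d).app_rho _)))).trans ?_)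
      refine (congrArg (_ ≫ ·) ((F.obj d).X.rho_nat (Ff.Hom.left (colimι c hc d) f))).trans ?_
      refine (Category.assoc _ _ _).symm.trans ((congrArg (· ≫ _) (comul_rho (F.obj d).X f)).trans ?_)
      exact (Category.id_comp _).trans (Category.comp_id _).symm)
    (fun f => (hc f).hom_ext fun d => by
      refine (Category.assoc _ _ _).symm.trans ((congrArg (· ≫ _) (ι_colimComul c hc f d)).trans ?_)
      refine (Category.assoc _ _ _).trans ((congrArg (_ ≫ ·) ((Category.assoc _ _ _).trans
        (congrArg (_ ≫ ·) (ι_colimFf_map c hc _ d)))).trans ?_)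
      refine (congrArg (_ ≫ ·) ((Category.assoc _ _ _).symm.trans (congrArg (· ≫ _)
        ((F.obj d).X.E.map_comp _ _).symm))).trans ?_
      refine (Category.assoc _ _ _).symm.trans ((congrArg (· ≫ _) ?_).trans
        ((Category.id_comp _).trans (Category.comp_id _).symm))
      refine Eq.trans (congrArg (_ ≫ ·) ?_) (comul_map_rho (F.obj d).X f)
      exact (F.obj d).X.map_congr (Category.comp_id _) ((colimι c hc d).app_rho f))
    (fun f => (hc f).hom_ext fun d => by
      refine paste_comul (ι_colimComul c hc f d) (ι_colimFf_map c hc _ d) (ι_colimComul c hc _ d)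
        (Ff.Hom.nat Δ[(F.obj d).X] (Ff.Hom.left (colimι c hc d) f)) (comul_comul (F.obj d).X f) ?_
      refine ((F.obj d).X.E.map_comp _ _).symm.trans (Eq.trans ((F.obj d).X.map_congr ?_ ?_)
        (((F.obj d).X.E.map_comp _ _).trans (congrArg (_ ≫ ·) ((F.obj d).X.E.map_comp _ _))))
      · exact (congrArg (_ ≫ ·) (Category.comp_id _)).symm
      · exact ι_colimComul c hc f d)

/-- Connected colimits of `⊙`-comonoids are formed pointwise. -/
theorem exists_pointwise_colimit (c : ∀ f, Cocone (F ⋙ ev f)) (hc : ∀ f, IsColimit (c f)) :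
    ∃ s : Cocone F, ∀ f, Nonempty (IsColimit ((ev f).mapCocone s)) := by
  let := (colimComon c hc).comon
  have h (d : D) : IsComonHom (colimι c hc d) :=
    isComonHom_mk _ fun f => ι_colimComul c hc f d
  refine ⟨⟨colimComon c hc, { app := fun d => ⟨colimι c hc d⟩, naturality := fun d d' a => ?_ }⟩,
    fun f => ⟨hc f⟩⟩
  exact comon_hom_ext fun f => ((c f).w a).trans (Category.comp_id _).symm

end Construction

section Shapes

variable (D : Type*) [Category* D] [IsConnected D] [HasColimitsOfShape D C]

theorem exists_pointwise_colimit' (F : D ⥤ Comon (Ff C)) :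
    ∃ s : Cocone F, ∀ f, Nonempty (IsColimit ((ev f).mapCocone s)) :=
  exists_pointwise_colimit (fun f => colimit.cocone (F ⋙ ev f)) (fun _ => colimit.isColimit _)

theorem hasColimitsOfShape_comon : HasColimitsOfShape D (Comon (Ff C)) where
  has_colimit F := by
    obtain ⟨s, hs⟩ := exists_pointwise_colimit' D F
    exact ⟨⟨⟨s, (isColimit_of_pointwise s hs).some⟩⟩⟩

theorem preservesColimitsOfShape_ev (f : Arrow C) : PreservesColimitsOfShape D (ev f) where
  preservesColimit {F} := by
    obtain ⟨s, hs⟩ := exists_pointwise_colimit' D F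
    exact preservesColimit_of_preserves_colimit_cocone (isColimit_of_pointwise s hs).some
      (hs f).some

end Shapes

end Pointwise

/-! ### Transfinite recursion for functors -/

section Recursion

open SmallObject SmallObject.SuccStruct SmallObject.SuccStruct.Iteration.subsingleton

variable {K : Type*} [Category* K] {J : Type*} [LinearOrder J]
  (next : ∀ (j : J) (F : Set.Iio j ⥤ K), Cocone F)

/-- A functor on the elements `≤ j` whose value at each `i ≤ j`, with the maps into it from the
previous values, is the cocone prescribed by `next`. -/
structure RecStage (j : J) where
  /-- The underlying functor. -/
  F : Set.Iic j ⥤ K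
  obj_eq (i : J) (hi : i ≤ j) : F.obj ⟨i, hi⟩ = (next i (restrictionLT F hi)).pt
  arrow_eq (i : J) (hi : i ≤ j) (k : J) (hk : k < i) :
    arrowMap F k i hk.le hi = Arrow.mk ((next i (restrictionLT F hi)).ι.app ⟨k, hk⟩)

namespace RecStage

variable {next}

/-- The truncation of a stage. -/
def trunc {j : J} (S : RecStage next j) {i : J} (h : i ≤ j) : RecStage next i where
  F := restrictionLE S.F h
  obj_eq k hk := S.obj_eq k (hk.trans h)
  arrow_eq k hk := S.arrow_eq k (hk.trans h)

theorem arrowMap_eq [WellFoundedLT J] {j : J} (S S' : RecStage next j) (k₁ k₂ : J) (h₁₂ : k₁ ≤ k₂)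
    (h₂ : k₂ ≤ j) : arrowMap S.F k₁ k₂ h₁₂ h₂ = arrowMap S'.F k₁ k₂ h₁₂ h₂ := by
  induction k₂ using WellFoundedLT.induction generalizing k₁ with
  | ind k₂ ih =>
    have h : restrictionLT S.F h₂ = restrictionLT S'.F h₂ :=
      Arrow.functor_ext fun k l f => ih l.1 l.2 k.1 (leOfHom f) (l.2.le.trans h₂)
    obtain h₁₂ | rfl := h₁₂.lt_or_eq
    · rw [S.arrow_eq _ _ _ h₁₂, S'.arrow_eq _ _ _ h₁₂, h]
    · rw [arrowMap_refl, arrowMap_refl, S.obj_eq, S'.obj_eq, h]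

theorem arrowMap_eq' [WellFoundedLT J] {j j' : J} (S : RecStage next j) (S' : RecStage next j')
    (k₁ k₂ : J) (h₁₂ : k₁ ≤ k₂) (h₂ : k₂ ≤ j) (h₂' : k₂ ≤ j') :
    arrowMap S.F k₁ k₂ h₁₂ h₂ = arrowMap S'.F k₁ k₂ h₁₂ h₂' :=
  arrowMap_eq (S.trunc h₂) (S'.trunc h₂') k₁ k₂ h₁₂ le_rfl

theorem obj_congr [WellFoundedLT J] {j j' : J} (S : RecStage next j) (S' : RecStage next j')
    (k : J) (h : k ≤ j) (h' : k ≤ j') : S.F.obj ⟨k, h⟩ = S'.F.obj ⟨k, h'⟩ :=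
  congrArg Comma.left (arrowMap_eq' S S' k k le_rfl h h')

/-- The transition maps of a stage. -/
def mapLE {j : J} (S : RecStage next j) {k₁ k₂ : J} (h₁₂ : k₁ ≤ k₂) (h₂ : k₂ ≤ j) :
    S.F.obj ⟨k₁, h₁₂.trans h₂⟩ ⟶ S.F.obj ⟨k₂, h₂⟩ :=
  S.F.map (homOfLE h₁₂)

theorem mapLE_comp {j : J} (S : RecStage next j) {k₁ k₂ k₃ : J} (h₁₂ : k₁ ≤ k₂) (h₂₃ : k₂ ≤ k₃)
    (h₃ : k₃ ≤ j) :
    S.mapLE h₁₂ (h₂₃.trans h₃) ≫ S.mapLE h₂₃ h₃ = S.mapLE (h₁₂.trans h₂₃) h₃ :=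
  (S.F.map_comp _ _).symm

theorem mapLE_congr [WellFoundedLT J] {j j' : J} (S : RecStage next j) (S' : RecStage next j')
    {k₁ k₂ : J} (h₁₂ : k₁ ≤ k₂) (h₂ : k₂ ≤ j) (h₂' : k₂ ≤ j') :
    S.mapLE h₁₂ h₂ = eqToHom (obj_congr S S' k₁ _ _) ≫ S'.mapLE h₁₂ h₂' ≫
      eqToHom (obj_congr S S' k₂ _ _).symm :=
  ((Arrow.mk_eq_mk_iff _ _).1 (arrowMap_eq' S S' k₁ k₂ h₁₂ h₂ h₂')).2.2

/-- The functor on a set of indices obtained by glueing stages along their common truncations. -/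
def glue [WellFoundedLT J] (s : Set J) (S : ∀ i ∈ s, RecStage next i) : s ⥤ K where
  obj i := (S i.1 i.2).F.obj ⟨i.1, Set.mem_Iic.2 le_rfl⟩
  map {i j} f := eqToHom (obj_congr (S i.1 i.2) (S j.1 j.2) i.1 le_rfl (leOfHom f)) ≫
    (S j.1 j.2).mapLE (leOfHom f) le_rfl
  map_id i := (Category.id_comp _).trans ((S i.1 i.2).F.map_id _)
  map_comp {i j k} f g := by
    rw [mapLE_congr (S j.1 j.2) (S k.1 k.2) (leOfHom f) le_rfl (leOfHom g),
      ← mapLE_comp (S k.1 k.2) (leOfHom f) (leOfHom g) le_rfl]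
    simp

theorem arrow_glue [WellFoundedLT J] (s : Set J) (S : ∀ i ∈ s, RecStage next i) {i j : s} (f : i ⟶ j)
    {k : J} (S' : RecStage next k) (h : j.1 ≤ k) :
    Arrow.mk ((glue s S).map f) = arrowMap S'.F i.1 j.1 (leOfHom f) h := by
  rw [← arrowMap_eq' (S j.1 j.2) S' i.1 j.1 (leOfHom f) le_rfl h]
  exact (Arrow.mk_eq_mk_iff _ _).2 
    ⟨obj_congr (S i.1 i.2) (S j.1 j.2) i.1 le_rfl (leOfHom f), rfl,
      congrArg (eqToHom _ ≫ ·) (Category.comp_id _).symm⟩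

theorem nonempty [WellFoundedLT J] (j : J) : Nonempty (RecStage next j) := by
  induction j using WellFoundedLT.induction with
  | ind j ih =>
    let S (i : J) (hi : i ∈ Set.Iio j) : RecStage next i := (ih i hi).some
    let G := glue (Set.Iio j) S
    let F := ofCocone (next j G)
    have hlt (i : J) (hi : i < j) (h' : i ≤ j) : restrictionLT F h' = restrictionLT (S i hi).F le_rfl :=
      Arrow.functor_ext fun k l f => by
        refine (arrowMap_ofCocone (next j G) k.1 l.1 (leOfHom f) (l.2.trans hi)).trans ?_
        exact arrow_glue _ S (i := ⟨k.1, k.2.trans hi⟩) (j := ⟨l.1, l.2.trans hi⟩) _ (S i hi) l.2.le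
    have htop : restrictionLT F le_rfl = G := Arrow.functor_ext fun k l f =>
      arrowMap_ofCocone (next j G) k.1 l.1 (leOfHom f) l.2
    refine ⟨⟨F, fun i hi => ?_, fun i hi k hk => ?_⟩⟩
    · obtain hi' | rfl := hi.lt_or_eq
      · rw [hlt i hi' hi, ← (S i hi').obj_eq]
        exact ofCocone_obj_eq (next j G) i hi'
      · rw [htop]
        exact ofCocone_obj_eq_pt (next i G)
    · obtain hi' | rfl := hi.lt_or_eq
      · rw [hlt i hi' hi, ← (S i hi').arrow_eq]
        refine (arrowMap_ofCocone (next j G) k i hk.le hi').trans ?_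
        exact arrow_glue _ S (i := ⟨k, hk.trans hi'⟩) (j := ⟨i, hi'⟩) _ (S i hi') le_rfl
      · rw [htop]
        exact arrowMap_ofCocone_to_top (next i G) k hk

end RecStage

theorem comp_eqToHom_of_arrow_eq {X Y Z : K} {f : X ⟶ Y} {g : X ⟶ Z}
    (h : Arrow.mk f = Arrow.mk g) (e : Y = Z) : f ≫ eqToHom e = g := by
  subst e
  exact (Category.comp_id _).trans (Arrow.mk_injective _ _ h)

/-- Transfinite recursion: if every functor on a proper initial segment comes with a cocone, then
there is a functor on the whole well-ordered type whose value at each element, with the maps into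
it from the previous values, is the cocone so prescribed. -/
theorem exists_functor_of_next [WellFoundedLT J] :
    ∃ G : J ⥤ K, ∀ j : J, ∃ e : G.obj j ≅
      (next j ((Set.principalSegIio j).monotone.functor ⋙ G)).pt,
      ∀ (k : J) (hk : k < j), G.map (homOfLE hk.le) ≫ e.hom =
        (next j ((Set.principalSegIio j).monotone.functor ⋙ G)).ι.app ⟨k, hk⟩ := by
  let S (i : J) (_ : i ∈ Set.univ) : RecStage next i := (RecStage.nonempty i).some
  let inc : J ⥤ (Set.univ : Set J) := Monotone.functor (f := fun j => ⟨j, trivial⟩) fun _ _ h => h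
  let G : J ⥤ K := inc ⋙ RecStage.glue Set.univ S
  have hG {i j : J} (h : i ≤ j) {k : J} (hk : j ≤ k) :
      Arrow.mk (G.map (homOfLE h)) = arrowMap (S k trivial).F i j h hk :=
    RecStage.arrow_glue Set.univ S (inc.map (homOfLE h)) (S k trivial) hk
  refine ⟨G, fun j => ?_⟩
  have hres : (Set.principalSegIio j).monotone.functor ⋙ G = restrictionLT (S j trivial).F le_rfl :=
    Arrow.functor_ext fun k l f => hG (leOfHom f) l.2.le
  have key (F : Set.Iio j ⥤ K) (hF : (Set.principalSegIio j).monotone.functor ⋙ G = F)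
      (h : G.obj j = (next j F).pt)
      (h' : ∀ (k : J) (hk : k < j), Arrow.mk (G.map (homOfLE hk.le)) =
        Arrow.mk ((next j F).ι.app ⟨k, hk⟩)) :
      ∃ e : G.obj j ≅ (next j ((Set.principalSegIio j).monotone.functor ⋙ G)).pt,
      ∀ (k : J) (hk : k < j), G.map (homOfLE hk.le) ≫ e.hom =
        (next j ((Set.principalSegIio j).monotone.functor ⋙ G)).ι.app ⟨k, hk⟩ := by
    subst hF
    exact ⟨eqToIso h, fun k hk => comp_eqToHom_of_arrow_eq (h' k hk) h⟩
  exact key _ hres ((S j trivial).obj_eq j le_rfl) fun k hk =>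
    (hG hk.le le_rfl).trans ((S j trivial).arrow_eq j le_rfl k hk)

end Recursion

/-! ### The free algebra sequence of a pointed endofunctor -/

section AlgebraSequence

variable {V : Type*} [Category* V]

/-- An algebra sequence for a pointed endofunctor `(T, t)`: a transfinite sequence `X` with maps
`T (X β) ⟶ X (β + 1)` that are natural and extend the transition maps along the pointing. -/
structure AlgSeq (T : V ⥤ V) (t : 𝟭 V ⟶ T) where
  /-- The underlying transfinite sequence. -/
  X : Ordinal.{w} ⥤ V
  /-- The partial action. -/
  act (β : Ordinal.{w}) : T.obj (X.obj β) ⟶ X.obj (Order.succ β)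
  act_nat {β ν : Ordinal.{w}} (h : β ≤ ν) : T.map (X.map (homOfLE h)) ≫ act ν =
    act β ≫ X.map (homOfLE (Order.succ_le_succ h))
  point_act (β : Ordinal.{w}) : t.app (X.obj β) ≫ act β = X.map (homOfLE (Order.le_succ β))

namespace AlgSeq

variable {T : V ⥤ V} {t : 𝟭 V ⟶ T}

/-- An algebra sequence is free as seen by a functor `H` if the image under `H` of each `act δ` is
universal among morphisms out of `H (T (X δ))` that are compatible with all previous `act ξ`, and
the images under `H` of the maps into the stage at a limit ordinal form a colimit cocone. -/
structure IsFreeAt (S : AlgSeq.{w} T t) {D : Type*} [Category* D] (H : V ⥤ D) : Prop where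
  existsUnique_act (δ : Ordinal.{w}) {Z : D} (g : H.obj (T.obj (S.X.obj δ)) ⟶ Z)
    (hg : ∀ (ξ : Ordinal.{w}) (h : ξ < δ),
      H.map (S.act ξ ≫ S.X.map (homOfLE (Order.succ_le_of_lt h)) ≫ t.app (S.X.obj δ)) ≫ g =
        H.map (T.map (S.X.map (homOfLE h.le))) ≫ g) :
    ∃! k : H.obj (S.X.obj (Order.succ δ)) ⟶ Z, H.map (S.act δ) ≫ k = g
  existsUnique_limit (δ : Ordinal.{w}) (hδ : Order.IsSuccLimit δ) {Z : D}
    (k : ∀ ξ < δ, H.obj (S.X.obj ξ) ⟶ Z)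
    (hk : ∀ (ξ ξ' : Ordinal.{w}) (h : ξ ≤ ξ') (h' : ξ' < δ),
      H.map (S.X.map (homOfLE h)) ≫ k ξ' h' = k ξ (h.trans_lt h')) :
    ∃! l : H.obj (S.X.obj δ) ⟶ Z, ∀ (ξ : Ordinal.{w}) (h : ξ < δ),
      H.map (S.X.map (homOfLE h.le)) ≫ l = k ξ h

theorem map_comp (S : AlgSeq.{w} T t) {a b c : Ordinal.{w}} (h : a ≤ b) (h' : b ≤ c) :
    S.X.map (homOfLE h) ≫ S.X.map (homOfLE h') = S.X.map (homOfLE (h.trans h')) :=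
  (S.X.map_comp _ _).symm

theorem act_compat (S : AlgSeq.{w} T t) {ξ δ : Ordinal.{w}} (h : ξ < δ) :
    (S.act ξ ≫ S.X.map (homOfLE (Order.succ_le_of_lt h)) ≫ t.app (S.X.obj δ)) ≫ S.act δ =
      T.map (S.X.map (homOfLE h.le)) ≫ S.act δ := by
  rw [S.act_nat, Category.assoc, Category.assoc, S.point_act, S.map_comp]

end AlgSeq

variable (T : V ⥤ V) (t : 𝟭 V ⟶ T)

section Next

variable {I : Type*} [Category* I] (G : I ⥤ Comma T (𝟭 V))

/-- The map `A ⟶ B` underlying a partial algebra `T A ⟶ B`. -/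
abbrev partialUnit (P : Comma T (𝟭 V)) : P.left ⟶ P.right := t.app P.left ≫ P.hom

theorem partialUnit_nat {P Q : Comma T (𝟭 V)} (a : P ⟶ Q) :
    a.left ≫ partialUnit T t Q = partialUnit T t P ≫ a.right := by
  have h := t.naturality a.left
  have h' : T.map a.left ≫ Q.hom = P.hom ≫ a.right := a.w
  change a.left ≫ t.app Q.left ≫ Q.hom = (t.app P.left ≫ P.hom) ≫ a.right
  rw [Category.assoc, ← h', ← Category.assoc, ← Category.assoc]
  exact congrArg (· ≫ Q.hom) h

variable [HasColimit (G ⋙ Comma.snd T (𝟭 V))]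

/-- The next object of the free algebra sequence after a diagram of partial algebras `T A ⟶ B`: the
colimit of the objects `B`. -/
noncomputable abbrev nextObj : V := colimit (G ⋙ Comma.snd T (𝟭 V))

/-- The inclusion into the next object. -/
noncomputable abbrev nextι (k : I) : (G.obj k).right ⟶ nextObj T G :=
  colimit.ι (G ⋙ Comma.snd T (𝟭 V)) k

theorem nextι_w {k l : I} (a : k ⟶ l) : (G.map a).right ≫ nextι T G l = nextι T G k :=
  colimit.w (G ⋙ Comma.snd T (𝟭 V)) a

variable [HasColimit (G ⋙ Comma.fst T (𝟭 V) ⋙ T)]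

/-- The first of the two maps to be coequalised by the next partial action. -/
noncomputable abbrev nextFst : colimit (G ⋙ Comma.fst T (𝟭 V) ⋙ T) ⟶ T.obj (nextObj T G) :=
  colimit.desc (G ⋙ Comma.fst T (𝟭 V) ⋙ T) ⟨_,
    { app := fun k => (G.obj k).hom ≫ nextι T G k ≫ t.app (nextObj T G)
      naturality := fun k l a => by
        have h : T.map (G.map a).left ≫ (G.obj l).hom = (G.obj k).hom ≫ (G.map a).right := (G.map a).w
        refine ((Category.assoc _ _ _).symm.trans ((congrArg (· ≫ _) h).trans
          (Category.assoc _ _ _))).trans (Eq.trans ?_ (Category.comp_id _).symm)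
        rw [← nextι_w T G a, Category.assoc] }⟩

/-- The second of the two maps to be coequalised by the next partial action. -/
noncomputable abbrev nextSnd : colimit (G ⋙ Comma.fst T (𝟭 V) ⋙ T) ⟶ T.obj (nextObj T G) :=
  colimit.desc (G ⋙ Comma.fst T (𝟭 V) ⋙ T) ⟨_,
    { app := fun k => T.map (partialUnit T t (G.obj k) ≫ nextι T G k)
      naturality := fun k l a => by
        refine (T.map_comp _ _).symm.trans (Eq.trans (congrArg T.map ?_) (Category.comp_id _).symm)
        refine ((Category.assoc _ _ _).symm.trans (congrArg (· ≫ _)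
          (partialUnit_nat T t (G.map a)))).trans ((Category.assoc _ _ _).trans ?_)
        exact congrArg (_ ≫ ·) (nextι_w T G a) }⟩

theorem ι_nextFst (k : I) : colimit.ι (G ⋙ Comma.fst T (𝟭 V) ⋙ T) k ≫ nextFst T t G =
    (G.obj k).hom ≫ nextι T G k ≫ t.app (nextObj T G) :=
  colimit.ι_desc _ _

theorem ι_nextSnd (k : I) : colimit.ι (G ⋙ Comma.fst T (𝟭 V) ⋙ T) k ≫ nextSnd T t G =
    T.map (partialUnit T t (G.obj k) ≫ nextι T G k) :=
  colimit.ι_desc _ _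

variable [HasCoequalizer (nextFst T t G) (nextSnd T t G)]

theorem next_condition (k : I) :
    T.map (partialUnit T t (G.obj k) ≫ nextι T G k) ≫ coequalizer.π (nextFst T t G) (nextSnd T t G) =
      (G.obj k).hom ≫ nextι T G k ≫ t.app (nextObj T G) ≫
        coequalizer.π (nextFst T t G) (nextSnd T t G) := by
  rw [← ι_nextSnd, Category.assoc, ← coequalizer.condition, ← Category.assoc, ι_nextFst,
    Category.assoc, Category.assoc]

/-- The next partial algebra of the free algebra sequence, with the maps into it. -/
noncomputable abbrev nextCocone : Cocone G where
  pt :=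
    { left := nextObj T G
      right := coequalizer (nextFst T t G) (nextSnd T t G)
      hom := coequalizer.π (nextFst T t G) (nextSnd T t G) }
  ι :=
    { app := fun k =>
        { left := partialUnit T t (G.obj k) ≫ nextι T G k
          right := nextι T G k ≫ t.app (nextObj T G) ≫ coequalizer.π (nextFst T t G) (nextSnd T t G)
          w := next_condition T t G k }
      naturality := fun k l a => by
        refine CommaMorphism.ext ?_ ?_
        · refine Eq.trans ?_ (Category.comp_id _).symm
          refine ((Category.assoc _ _ _).symm.trans (congrArg (· ≫ _)
            (partialUnit_nat T t (G.map a)))).trans ((Category.assoc _ _ _).trans ?_)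
          exact congrArg (_ ≫ ·) (nextι_w T G a)
        · refine Eq.trans ?_ (Category.comp_id _).symm
          exact (Category.assoc _ _ _).symm.trans (congrArg (· ≫ _) (nextι_w T G a)) }

end Next

section Sequence

variable {T t} {Ψ : Ordinal.{w} ⥤ Comma T (𝟭 V)}

/-- The restriction of a functor on the ordinals to the ordinals less than `j`. -/
abbrev below {K : Type*} [Category* K] (Ψ : Ordinal.{w} ⥤ K) (j : Ordinal.{w}) : Set.Iio j ⥤ K :=
  (Set.principalSegIio j).monotone.functor ⋙ Ψ

variable [∀ j : Ordinal.{w}, HasColimitsOfShape (Set.Iio j) V] [HasCoequalizers V]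
  (e : ∀ j, Ψ.obj j ≅ (nextCocone T t (below Ψ j)).pt)
  (he : ∀ (j k : Ordinal.{w}) (hk : k < j), Ψ.map (homOfLE hk.le) ≫ (e j).hom =
    (nextCocone T t (below Ψ j)).ι.app ⟨k, hk⟩)

/-- The map from the codomain of a partial algebra of the sequence to the domain of a later one. -/
noncomputable def stepMap {k j : Ordinal.{w}} (h : k < j) : (Ψ.obj k).right ⟶ (Ψ.obj j).left :=
  nextι T (below Ψ j) ⟨k, h⟩ ≫ (e j).inv.left

theorem stepMap_hom {k j : Ordinal.{w}} (h : k < j) :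
    stepMap e h ≫ (e j).hom.left = nextι T (below Ψ j) ⟨k, h⟩ :=
  (Category.assoc _ _ _).trans ((congrArg (_ ≫ ·)
    (congrArg CommaMorphism.left (e j).inv_hom_id)).trans (Category.comp_id _))

theorem map_eq_of_next (he : ∀ (j k : Ordinal.{w}) (hk : k < j), Ψ.map (homOfLE hk.le) ≫ (e j).hom =
    (nextCocone T t (below Ψ j)).ι.app ⟨k, hk⟩) {k j : Ordinal.{w}} (h : k < j) :
    Ψ.map (homOfLE h.le) = (nextCocone T t (below Ψ j)).ι.app ⟨k, h⟩ ≫ (e j).inv :=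
  (Iso.eq_comp_inv (e j)).2 (he j k h)

theorem map_left_eq (he : ∀ (j k : Ordinal.{w}) (hk : k < j), Ψ.map (homOfLE hk.le) ≫ (e j).hom =
    (nextCocone T t (below Ψ j)).ι.app ⟨k, hk⟩) {k j : Ordinal.{w}} (h : k < j) :
    (Ψ.map (homOfLE h.le)).left = partialUnit T t (Ψ.obj k) ≫ stepMap e h :=
  (congrArg CommaMorphism.left (map_eq_of_next e he h)).trans (Category.assoc _ _ _)

theorem map_right_eq (he : ∀ (j k : Ordinal.{w}) (hk : k < j), Ψ.map (homOfLE hk.le) ≫ (e j).hom =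
    (nextCocone T t (below Ψ j)).ι.app ⟨k, hk⟩) {k j : Ordinal.{w}} (h : k < j) :
    (Ψ.map (homOfLE h.le)).right = stepMap e h ≫ partialUnit T t (Ψ.obj j) := by
  refine (congrArg CommaMorphism.right (map_eq_of_next e he h)).trans ?_
  refine Eq.trans ?_ (Category.assoc _ _ _).symm
  refine Eq.trans ?_ (congrArg (_ ≫ ·) (partialUnit_nat T t (e j).inv).symm)
  exact Category.assoc _ _ _

theorem map_right_stepMap {k k' j : Ordinal.{w}} (h : k ≤ k') (h' : k' < j) :
    (Ψ.map (homOfLE h)).right ≫ stepMap e h' = stepMap e (h.trans_lt h') := by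
  have := nextι_w T (below Ψ j) (homOfLE h : (⟨k, h.trans_lt h'⟩ : Set.Iio j) ⟶ ⟨k', h'⟩)
  exact (Category.assoc _ _ _).symm.trans (congrArg (· ≫ _) this)

theorem stepMap_map_left (he : ∀ (j k : Ordinal.{w}) (hk : k < j), Ψ.map (homOfLE hk.le) ≫ (e j).hom =
    (nextCocone T t (below Ψ j)).ι.app ⟨k, hk⟩) {k j l : Ordinal.{w}} (h : k < j) (h' : j ≤ l) :
    stepMap e h ≫ (Ψ.map (homOfLE h')).left = stepMap e (h.trans_le h') := by
  obtain h' | rfl := h'.lt_or_eq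
  · rw [map_left_eq e he h', ← Category.assoc, ← map_right_eq e he h, map_right_stepMap]
  · exact (congrArg (_ ≫ ·) (congrArg CommaMorphism.left (Ψ.map_id j))).trans (Category.comp_id _)

theorem existsUnique_stepMap {D : Type*} [Category* D] (H : V ⥤ D) (j : Ordinal.{w})
    [PreservesColimitsOfShape (Set.Iio j) H] {Z : D} (k : ∀ ξ < j, H.obj (Ψ.obj ξ).right ⟶ Z)
    (hk : ∀ (ξ ξ' : Ordinal.{w}) (h : ξ ≤ ξ') (h' : ξ' < j),
      H.map (Ψ.map (homOfLE h)).right ≫ k ξ' h' = k ξ (h.trans_lt h')) :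
    ∃! l : H.obj (Ψ.obj j).left ⟶ Z, ∀ (ξ : Ordinal.{w}) (h : ξ < j),
      H.map (stepMap e h) ≫ l = k ξ h := by
  let hc := isColimitOfPreserves H (colimit.isColimit (below Ψ j ⋙ Comma.snd T (𝟭 V)))
  let s : Cocone ((below Ψ j ⋙ Comma.snd T (𝟭 V)) ⋙ H) := ⟨Z,
    { app := fun ξ => k ξ.1 ξ.2
      naturality := fun ξ ξ' a => (hk ξ.1 ξ'.1 (leOfHom a) ξ'.2).trans (Category.comp_id _).symm }⟩
  have h₂ : (e j).hom.left ≫ (e j).inv.left = 𝟙 _ := congrArg CommaMorphism.left (e j).hom_inv_id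
  refine ⟨H.map (e j).hom.left ≫ hc.desc s, fun ξ h => ?_, fun l hl => ?_⟩
  · rw [← Category.assoc, ← H.map_comp, stepMap_hom]
    exact hc.fac s ⟨ξ, h⟩
  · have : H.map (e j).inv.left ≫ l = hc.desc s := hc.hom_ext fun ξ => by
      rw [hc.fac s ξ]
      refine (Category.assoc _ _ _).symm.trans ((congrArg (· ≫ l) (H.map_comp _ _).symm).trans ?_)
      exact hl ξ.1 ξ.2
    rw [← this, ← Category.assoc, ← H.map_comp, h₂, H.map_id, Category.id_comp]

theorem existsUnique_hom (he : ∀ (j k : Ordinal.{w}) (hk : k < j), Ψ.map (homOfLE hk.le) ≫ (e j).hom =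
    (nextCocone T t (below Ψ j)).ι.app ⟨k, hk⟩) {D : Type*} [Category* D] (H : V ⥤ D)
    (j : Ordinal.{w}) [PreservesColimitsOfShape WalkingParallelPair H]
    (hH : j ≠ 0 → PreservesColimitsOfShape (Set.Iio j) H) {Z : D}
    (g : H.obj (T.obj (Ψ.obj j).left) ⟶ Z)
    (hg : ∀ (ξ : Ordinal.{w}) (h : ξ < j), H.map ((Ψ.obj ξ).hom ≫ stepMap e h ≫ t.app _) ≫ g =
      H.map (T.map (Ψ.map (homOfLE h.le)).left) ≫ g) :
    ∃! k : H.obj (Ψ.obj j).right ⟶ Z, H.map (Ψ.obj j).hom ≫ k = g := by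
  have h₂ : (e j).hom.left ≫ (e j).inv.left = 𝟙 _ := congrArg CommaMorphism.left (e j).hom_inv_id
  have h₃ : (e j).hom.right ≫ (e j).inv.right = 𝟙 _ := congrArg CommaMorphism.right (e j).hom_inv_id
  let π := coequalizer.π (nextFst T t (below Ψ j)) (nextSnd T t (below Ψ j))
  have hπ : (Ψ.obj j).hom ≫ (e j).hom.right = T.map (e j).hom.left ≫ π := (e j).hom.w.symm
  have hπ' : T.map (e j).inv.left ≫ (Ψ.obj j).hom = π ≫ (e j).inv.right := (e j).inv.w
  let g' := H.map (T.map (e j).inv.left) ≫ g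
  have hfork : H.map (nextFst T t (below Ψ j)) ≫ g' = H.map (nextSnd T t (below Ψ j)) ≫ g' := by
    rcases eq_or_ne j 0 with rfl | hj
    · refine congrArg (fun a => H.map a ≫ g') (colimit.hom_ext fun k => ?_)
      exact absurd k.2 (not_lt_bot (α := Ordinal))
    · have := hH hj
      refine (isColimitOfPreserves H (colimit.isColimit
        (below Ψ j ⋙ Comma.fst T (𝟭 V) ⋙ T))).hom_ext fun k => ?_
      change H.map (colimit.ι _ k) ≫ _ = H.map (colimit.ι _ k) ≫ _
      have hk := hg k.1 k.2
      rw [map_left_eq e he k.2] at hk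
      have hcomp (a : colimit (below Ψ j ⋙ Comma.fst T (𝟭 V) ⋙ T) ⟶ T.obj (nextObj T (below Ψ j))) :
          H.map (colimit.ι (below Ψ j ⋙ Comma.fst T (𝟭 V) ⋙ T) k) ≫ H.map a ≫ g' =
            H.map ((colimit.ι (below Ψ j ⋙ Comma.fst T (𝟭 V) ⋙ T) k ≫ a) ≫
              T.map (e j).inv.left) ≫ g := by
        rw [H.map_comp, H.map_comp, Category.assoc, Category.assoc]
      rw [hcomp, hcomp, ι_nextFst, ι_nextSnd, ← T.map_comp]
      refine Eq.trans (congrArg (fun a => H.map a ≫ g) ?_) (hk.trans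
        (congrArg (fun a => H.map (T.map a) ≫ g) (Category.assoc _ _ _).symm))
      refine (Category.assoc _ _ _).trans ((congrArg (_ ≫ ·) (Category.assoc _ _ _)).trans ?_)
      refine congrArg ((Ψ.obj k.1).hom ≫ ·) (Eq.trans ?_ (Category.assoc _ _ _).symm)
      exact congrArg (nextι T (below Ψ j) k ≫ ·) (t.naturality (e j).inv.left).symm
  have hc := isColimitCoforkMapOfIsColimit H
    (coequalizer.condition (nextFst T t (below Ψ j)) (nextSnd T t (below Ψ j)))
    (coequalizerIsCoequalizer _ _)
  obtain ⟨l, hl⟩ := Cofork.IsColimit.desc' hc g' hfork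
  have hl' : H.map π ≫ l = g' := hl
  refine ⟨H.map (e j).hom.right ≫ l, ?_, fun l' h' => ?_⟩
  · change H.map (Ψ.obj j).hom ≫ H.map (e j).hom.right ≫ l = g
    rw [← Category.assoc, ← H.map_comp, hπ, H.map_comp, Category.assoc, hl', ← Category.assoc,
      ← H.map_comp, ← T.map_comp, h₂, T.map_id, H.map_id, Category.id_comp]
  · have : H.map (e j).inv.right ≫ l' = l := Cofork.IsColimit.hom_ext hc (by
      change H.map π ≫ _ = H.map π ≫ _
      rw [hl', ← Category.assoc, ← H.map_comp, ← hπ', H.map_comp, Category.assoc, h'])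
    rw [← this, ← Category.assoc, ← H.map_comp, h₃, H.map_id, Category.id_comp]

/-- The algebra sequence extracted from a transfinite sequence of partial algebras. -/
noncomputable abbrev seqOfNext (he : ∀ (j k : Ordinal.{w}) (hk : k < j),
    Ψ.map (homOfLE hk.le) ≫ (e j).hom = (nextCocone T t (below Ψ j)).ι.app ⟨k, hk⟩) :
    AlgSeq.{w} T t where
  X := Ψ ⋙ Comma.fst T (𝟭 V)
  act β := (Ψ.obj β).hom ≫ stepMap e (Order.lt_succ β)
  act_nat {β ν} h := by
    have h' : T.map (Ψ.map (homOfLE h)).left ≫ (Ψ.obj ν).hom =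
      (Ψ.obj β).hom ≫ (Ψ.map (homOfLE h)).right := (Ψ.map (homOfLE h)).w
    change T.map (Ψ.map (homOfLE h)).left ≫ _ = _ ≫ (Ψ.map (homOfLE _)).left
    rw [← Category.assoc, h', Category.assoc, Category.assoc, map_right_stepMap,
      stepMap_map_left e he]
  point_act β := (Category.assoc _ _ _).symm.trans (map_left_eq e he (Order.lt_succ β)).symm

end Sequence

/-- The free algebra sequence of a pointed endofunctor on an initial object exists in the presence
of colimits, and remains free under every functor that preserves connected colimits of small chains
and coequalisers. -/
theorem exists_isFreeAt [∀ j : Ordinal.{w}, HasColimitsOfShape (Set.Iio j) V] [HasCoequalizers V] :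
    ∃ S : AlgSeq.{w} T t, Nonempty (IsInitial (S.X.obj 0)) ∧
      ∀ {D : Type u} [Category.{v} D] (H : V ⥤ D) [PreservesColimitsOfShape WalkingParallelPair H]
        (_ : ∀ j : Ordinal.{w}, j ≠ 0 → PreservesColimitsOfShape (Set.Iio j) H), S.IsFreeAt H := by
  obtain ⟨Ψ, hΨ⟩ := exists_functor_of_next (J := Ordinal.{w}) (K := Comma T (𝟭 V))
    fun j F => nextCocone T t F
  choose e he using hΨ
  refine ⟨seqOfNext e he, ?_, fun {D} _ H _ hH => ⟨fun δ Z g hg => ?_, fun δ hδ Z k hk => ?_⟩⟩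
  · have key (Z : V) := existsUnique_stepMap e (𝟭 V) 0 (Z := Z)
      (fun ξ h => absurd h (not_lt_bot (α := Ordinal)))
      (fun ξ ξ' h h' => absurd h' (not_lt_bot (α := Ordinal)))
    exact ⟨IsInitial.ofUniqueHom (fun Z => (key Z).choose) fun Z l =>
      (key Z).choose_spec.2 l fun ξ h => absurd h (not_lt_bot (α := Ordinal))⟩
  · obtain ⟨k, hk, hk'⟩ := existsUnique_hom e he H δ (hH δ) g fun ξ h => by
      refine Eq.trans (congrArg (fun a => H.map a ≫ g) ?_) (hg ξ h)
      rw [← stepMap_map_left e he (Order.lt_succ ξ) (Order.succ_le_of_lt h)]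
      simp only [Category.assoc]
      rfl
    -- the map to the next stage is invertible, since the ordinals below `δ + 1` have a maximum
    obtain ⟨b, hb, -⟩ := existsUnique_stepMap e (𝟭 V) (Order.succ δ)
      (fun ξ h => (Ψ.map (homOfLE (Order.le_of_lt_succ h))).right)
      (fun ξ ξ' h h' => (congrArg CommaMorphism.right (Ψ.map_comp _ _)).symm)
    have hb₁ : stepMap e (Order.lt_succ δ) ≫ b = 𝟙 _ :=
      (hb δ (Order.lt_succ δ)).trans (congrArg CommaMorphism.right (Ψ.map_id δ))
    have hb₂ : b ≫ stepMap e (Order.lt_succ δ) = 𝟙 _ :=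
      (existsUnique_stepMap e (𝟭 V) (Order.succ δ) (fun ξ h => stepMap e h)
        (fun ξ ξ' h h' => map_right_stepMap e h h')).unique
        (fun ξ h => by
          refine (Category.assoc _ _ _).symm.trans ((congrArg (· ≫ _) (hb ξ h)).trans ?_)
          exact map_right_stepMap e _ _)
        (fun ξ h => Category.comp_id _)
    refine ⟨H.map b ≫ k, ?_, fun l hl => ?_⟩
    · change H.map (_ ≫ _) ≫ _ = _
      rw [← Category.assoc, ← H.map_comp, Category.assoc, hb₁]
      exact (congrArg (fun a => H.map a ≫ k) (Category.comp_id _)).trans hk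
    · rw [← hk' (H.map (stepMap e (Order.lt_succ δ)) ≫ l) (by
        rw [← hl]; exact (Category.assoc _ _ _).symm.trans (congrArg (· ≫ l) (H.map_comp _ _).symm)),
        ← Category.assoc, ← H.map_comp, hb₂]
      exact ((congrArg (· ≫ l) (H.map_id _)).trans (Category.id_comp l)).symm
  · have := hH δ hδ.ne_bot
    have hs {ξ : Ordinal.{w}} (h : ξ < δ) : Order.succ ξ < δ := hδ.succ_lt h
    have hX {ξ : Ordinal.{w}} (h : ξ < δ) : (Ψ.map (homOfLE h.le)).left = _ := map_left_eq e he h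
    obtain ⟨l, hl, hl'⟩ := existsUnique_stepMap e H δ
      (fun ξ h => H.map (stepMap e (Order.lt_succ ξ)) ≫ k (Order.succ ξ) (hs h))
      (fun ξ ξ' h h' => by
        rw [← Category.assoc, ← H.map_comp, map_right_stepMap e h (Order.lt_succ ξ'),
          ← stepMap_map_left e he (Order.lt_succ ξ) (Order.succ_le_succ h), H.map_comp,
          Category.assoc]
        exact congrArg (_ ≫ ·) (hk _ _ _ _))
    refine ⟨l, fun ξ h => ?_, fun l' h' => hl' l' fun ξ h => ?_⟩
    · change H.map (Ψ.map (homOfLE h.le)).left ≫ l = _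
      rw [map_left_eq e he h, H.map_comp, Category.assoc, hl, ← Category.assoc, ← H.map_comp,
        ← map_left_eq e he (Order.lt_succ ξ)]
      exact hk _ _ _ _
    · rw [← stepMap_map_left e he (Order.lt_succ ξ) (Order.succ_le_of_lt h), H.map_comp,
          Category.assoc]
      exact congrArg (_ ≫ ·) (h' _ _)

end AlgebraSequence

/-! ### Filtered ordinals closed under a function -/

theorem IsFilteredOrdinal.mono {α κ : Cardinal.{w}} (h : α ≤ κ) {β : Ordinal.{w}}
    (hβ : IsFilteredOrdinal κ β) : IsFilteredOrdinal α β :=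
  ⟨hβ.1, fun S hS hS' => hβ.2 S hS (hS'.trans (Cardinal.lift_le.2 h))⟩

/-- For every cardinal `κ`, there are `κ`-filtered ordinals closed under any given function. -/
theorem exists_isFilteredOrdinal_closed (κ : Cardinal.{w}) (γ : Ordinal.{w} → Ordinal.{w}) :
    ∃ B : Ordinal.{w}, IsFilteredOrdinal κ B ∧ ∀ β < B, γ β < B := by
  -- `B` is the supremum of a sequence of length a regular cardinal `ν > κ`, whose next term exceeds
  -- all values of `γ` up to the present one
  let h (x : Ordinal.{w}) : Ordinal.{w} := ⨆ β : Set.Iic x, Order.succ (max (γ β) β)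
  have hγ {β x : Ordinal.{w}} (hβ : β ≤ x) : Order.succ (max (γ β) β) ≤ h x :=
    Ordinal.le_iSup (fun β : Set.Iic x => Order.succ (max (γ β) β)) ⟨β, hβ⟩
  have hx (x : Ordinal.{w}) : x < h x :=
    (Order.lt_succ_of_le (le_max_right _ _)).trans_le (hγ le_rfl)
  let b : Ordinal.{w} → Ordinal.{w} := WellFounded.fix (wellFounded_lt (α := Ordinal.{w}))
    fun ξ r => ⨆ η : Set.Iio ξ, h (r η η.2)
  have hb (ξ : Ordinal.{w}) : b ξ = ⨆ η : Set.Iio ξ, h (b η) := WellFounded.fix_eq _ _ _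
  have hb' {η ξ : Ordinal.{w}} (hη : η < ξ) : h (b η) ≤ b ξ := by
    rw [hb ξ]
    exact Ordinal.le_iSup (fun η : Set.Iio ξ => h (b η)) ⟨η, hη⟩
  have hlt {x ξ : Ordinal.{w}} (hxξ : x < b ξ) : ∃ η < ξ, x < h (b η) := by
    rw [hb ξ] at hxξ
    obtain ⟨η, hη⟩ := (Ordinal.lt_iSup_iff).1 hxξ
    exact ⟨η, η.2, hη⟩
  let c : Cardinal.{w} := max κ Cardinal.aleph0
  have hc : (Order.succ c).IsRegular := Cardinal.isRegular_succ (le_max_right _ _)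
  let ν : Ordinal.{w} := (Order.succ c).ord
  have hν : Order.IsSuccLimit ν := Cardinal.isSuccLimit_ord hc.aleph0_le
  refine ⟨b ν, ⟨⟨?_, ?_⟩, fun S hS hS' => ?_⟩, fun β hβ => ?_⟩
  · have h0 : (0 : Ordinal.{w}) < ν := bot_lt_iff_ne_bot.2 hν.ne_bot
    intro hm
    exact hm.not_lt ((bot_le.trans_lt (hx _)).trans_le (hb' h0))
  · refine Order.isSuccPrelimit_of_succ_lt fun x hxν => ?_
    obtain ⟨η, hη, hη'⟩ := hlt hxν
    exact (Order.succ_le_of_lt hη').trans_lt ((hb' (Order.lt_succ η)).trans_lt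
      ((hx _).trans_le (hb' (hν.succ_lt hη))))
  · choose η hη hη' using fun s : S => hlt (hS s.2)
    have hsup : ⨆ s, η s < ν := by
      refine Ordinal.lift_iSup_lt_of_lt_cof ?_ hη
      rw [← Ordinal.lift_cof, hc.cof_ord, Cardinal.lift_id'.{w, w + 1}]
      exact hS'.trans_lt (Cardinal.lift_lt.2 (Order.lt_succ_of_le (le_max_left _ _)))
    refine lt_of_le_of_lt (csSup_le' fun s hs => ?_) ((hx _).trans_le (hb' (hν.succ_lt hsup)))
    have : Small.{w} S := small_subset hS
    exact (hη' ⟨s, hs⟩).le.trans (hb' (Order.lt_succ_of_le (Ordinal.le_iSup η ⟨s, hs⟩)))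
  · obtain ⟨η, hη, hη'⟩ := hlt hβ
    exact (Order.lt_succ_of_le (le_max_left _ β)).trans_le ((hγ (hη'.le.trans
      (hb' (Order.lt_succ η)))).trans (hb' (hν.succ_lt hη)))

/-! ### Transfinite sequences seen by a small object -/

variable {C : Type u} [Category.{v} C]

/-- A transfinite sequence is continuous if its stage at a limit ordinal is the colimit of the
previous stages. -/
def IsContinuousSeq (G : Ordinal.{w} ⥤ C) : Prop :=
  ∀ (δ : Ordinal.{w}) (_ : Order.IsSuccLimit δ) {Z : C} (k : ∀ ξ < δ, G.obj ξ ⟶ Z)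
    (_ : ∀ (ξ ξ' : Ordinal.{w}) (h : ξ ≤ ξ') (h' : ξ' < δ),
      G.map (homOfLE h) ≫ k ξ' h' = k ξ (h.trans_lt h')),
    ∃! l : G.obj δ ⟶ Z, ∀ (ξ : Ordinal.{w}) (h : ξ < δ), G.map (homOfLE h.le) ≫ l = k ξ h

/-- A transfinite sequence is seen by `A` as small at an ordinal `B` if every morphism from `A`
to the stage at `B` factors through an earlier stage, essentially uniquely. -/
structure IsSmallAt (A : C) (G : Ordinal.{w} ⥤ C) (B : Ordinal.{w}) : Prop where
  exists_lift (h : A ⟶ G.obj B) : ∃ (β : Ordinal.{w}) (hβ : β < B) (h' : A ⟶ G.obj β),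
    h' ≫ G.map (homOfLE hβ.le) = h
  exists_eq (β : Ordinal.{w}) (hβ : β < B) (a b : A ⟶ G.obj β)
    (_ : a ≫ G.map (homOfLE hβ.le) = b ≫ G.map (homOfLE hβ.le)) :
    ∃ (β' : Ordinal.{w}) (h : β ≤ β'), β' < B ∧ a ≫ G.map (homOfLE h) = b ≫ G.map (homOfLE h)

theorem seq_map_comp (G : Ordinal.{w} ⥤ C) {a b c : Ordinal.{w}} (h : a ≤ b) (h' : b ≤ c) :
    G.map (homOfLE h) ≫ G.map (homOfLE h') = G.map (homOfLE (h.trans h')) :=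
  (G.map_comp _ _).symm

/-- The restriction of a transfinite sequence to the ordinals below `B`. -/
noncomputable abbrev chainBelow (Z : Ordinal.{w} ⥤ C) (B : Ordinal.{w}) : B.ToType ⥤ C :=
  (show Monotone fun x : B.ToType => (x.toOrd : Ordinal.{w}) from
    fun _ _ h => Ordinal.ToType.mk.symm.monotone h).functor ⋙ Z

/-- If a sequence `Z` is interleaved with a continuous sequence `G` below a limit ordinal `B`, and
homming out of `A` preserves the colimit of `Z` below `B`, then `A` sees `G` as small at `B`. -/
theorem isSmallAt_of_interleaving {G : Ordinal.{v} ⥤ C} (hG : IsContinuousSeq G)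
    (Z : Ordinal.{v} ⥤ C) {γ : Ordinal.{v} → Ordinal.{v}} (hγ : ∀ β, β ≤ γ β)
    (e : G ⟶ Z) (m : ∀ β, Z.obj β ⟶ G.obj (γ β))
    (hem : ∀ β, e.app β ≫ m β = G.map (homOfLE (hγ β)))
    (hme : ∀ β, m β ≫ e.app (γ β) = Z.map (homOfLE (hγ β)))
    (hm : ∀ (x y δ : Ordinal.{v}) (h : x ≤ y) (hx : γ x ≤ δ) (hy : γ y ≤ δ),
      Z.map (homOfLE h) ≫ m y ≫ G.map (homOfLE hy) = m x ≫ G.map (homOfLE hx))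
    {B : Ordinal.{v}} (hB : Order.IsSuccLimit B) (hγB : ∀ β < B, γ β < B) (A : C)
    [PreservesColimit (chainBelow Z B) (coyoneda.obj (Opposite.op A))] : IsSmallAt A G B := by
  let c : Cocone (chainBelow Z B) :=
    { pt := G.obj B
      ι :=
        { app := fun x => m x.toOrd ≫ G.map (homOfLE (hγB _ x.toOrd.2).le)
          naturality := fun x y a => (hm _ _ B _ _ _).trans (Category.comp_id _).symm } }
  let mk (β : Ordinal.{v}) (h : β < B) : B.ToType := Ordinal.ToType.mk ⟨β, h⟩
  have hmk {β : Ordinal.{v}} (h : β < B) : ((mk β h).toOrd : Ordinal.{v}) = β :=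
    congrArg Subtype.val (Ordinal.ToType.mk.symm_apply_apply _)
  have hx (x : B.ToType) : (x.toOrd : Ordinal.{v}) < B := x.toOrd.2
  have hme' (β : Ordinal.{v}) : m β ≫ e.app (γ β) = Z.map (homOfLE (hγ β)) := hme β
  have hGB {β : Ordinal.{v}} (h : β < B) {W : C} (l : G.obj B ⟶ W) :
      e.app β ≫ m β ≫ G.map (homOfLE (hγB β h).le) ≫ l = G.map (homOfLE h.le) ≫ l := by
    rw [← Category.assoc, hem, ← Category.assoc, seq_map_comp]
  have key {W : C} (a : ∀ x : B.ToType, Z.obj (x.toOrd : Ordinal.{v}) ⟶ W)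
      (ha : ∀ (x y : B.ToType) (h : (x.toOrd : Ordinal.{v}) ≤ y.toOrd),
        Z.map (homOfLE h) ≫ a y = a x) :
      ∃! l : G.obj B ⟶ W, ∀ x : B.ToType,
        m x.toOrd ≫ G.map (homOfLE (hγB _ (hx x)).le) ≫ l = a x := by
    obtain ⟨l, hl, hl'⟩ := hG B hB
      (fun ξ h => e.app ξ ≫ Z.map (homOfLE (hmk h).ge) ≫ a (mk ξ h)) fun ξ ξ' h h' => by
        rw [← Category.assoc, e.naturality, Category.assoc, ← Category.assoc (Z.map _),
          seq_map_comp, ← ha (mk ξ (h.trans_lt h')) (mk ξ' h')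
            (by rw [hmk, hmk]; exact h), ← Category.assoc (Z.map _), seq_map_comp]
    refine ⟨l, fun x => ?_, fun l' h' => hl' l' fun ξ h => ?_⟩
    · rw [hl _ (hγB _ (hx x)), ← Category.assoc, hme', ← Category.assoc, seq_map_comp, ha]
    · rw [← hGB h, ← h', ← Category.assoc (Z.map _),
        ← Category.assoc (m ξ), ← Category.assoc (Z.map _ ≫ _)]
      refine congrArg (fun t => e.app ξ ≫ t ≫ l') ?_
      rw [Category.assoc]
      exact (hm ξ _ B _ (hγB ξ h).le (hγB _ (hx _)).le).symm
  have hc : Nonempty (IsColimit c) := by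
    have key' (s : Cocone (chainBelow Z B)) := key s.ι.app fun x y h =>
      s.w (homOfLE (Ordinal.ToType.mk.symm.le_iff_le.1 h) : x ⟶ y)
    exact ⟨{ desc := fun s => (key' s).choose
             fac := fun s x => (Category.assoc _ _ _).trans ((key' s).choose_spec.1 x)
             uniq := fun s l hl => (key' s).choose_spec.2 l fun x =>
              (Category.assoc _ _ _).symm.trans (hl x) }⟩
  have hBne : Nonempty B.ToType := ⟨mk 0 (bot_lt_iff_ne_bot.2 hB.ne_bot)⟩
  have hc' := isColimitOfPreserves (coyoneda.obj (Opposite.op A)) hc.some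
  refine ⟨fun h => ?_, fun β hβ a b hab => ?_⟩
  · obtain ⟨x, y, hy⟩ := Types.jointly_surjective_of_isColimit hc' h
    refine ⟨γ x.toOrd, hγB _ x.toOrd.2, y ≫ m x.toOrd, (Category.assoc _ _ _).trans hy⟩
  · have h0 := (Types.FilteredColimit.isColimit_eq_iff _ hc' (i := mk β hβ) (j := mk β hβ)
      (xi := a ≫ e.app β ≫ Z.map (homOfLE (hmk hβ).ge))
      (xj := b ≫ e.app β ≫ Z.map (homOfLE (hmk hβ).ge))).1 (by
        have h1 (a : A ⟶ G.obj β) : (a ≫ e.app β ≫ Z.map (homOfLE (hmk hβ).ge)) ≫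
            m (mk β hβ).toOrd ≫ G.map (homOfLE (hγB _ (mk β hβ).toOrd.2).le) =
              a ≫ G.map (homOfLE hβ.le) := by
          rw [Category.assoc, Category.assoc, hm β _ B _ (hγB β hβ).le, ← Category.assoc (e.app β),
            hem, seq_map_comp]
        exact (h1 a).trans (hab.trans (h1 b).symm))
    obtain ⟨y, p, q, hpq⟩ := h0
    have h2 : β ≤ (y.toOrd : Ordinal.{v}) :=
      (hmk hβ).ge.trans (Ordinal.ToType.mk.symm.monotone (leOfHom p))
    refine ⟨γ y.toOrd, h2.trans (hγ _), hγB _ y.toOrd.2, ?_⟩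
    have h3 (a : A ⟶ G.obj β) : ((a ≫ e.app β ≫ Z.map (homOfLE (hmk hβ).ge)) ≫
        Z.map (homOfLE (Ordinal.ToType.mk.symm.monotone (leOfHom p)))) ≫ m y.toOrd =
          a ≫ G.map (homOfLE (h2.trans (hγ _))) := by
      rw [Category.assoc, Category.assoc, Category.assoc, ← Category.assoc (Z.map _),
        seq_map_comp, ← Category.assoc (e.app β), ← e.naturality, Category.assoc, hem, seq_map_comp]
    rw [← h3 a, ← h3 b]
    exact congrArg (· ≫ m y.toOrd) hpq

/-! ### Cowellpowered factorisation systems and images in transfinite sequences -/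

section Images

variable {C : Type u} [Category.{v} C] {P M : MorphismProperty C}

/-- The left class of a cowellpowered factorisation system on a cocomplete category consists of
epimorphisms: two distinct extensions `r`, `s` of a morphism along `e : X ⟶ Y` would give `2 ^ κ`
morphisms out of the image of `X` in the pushout of `κ` copies of `e`, for arbitrarily large `κ`. -/
theorem IsOrthogonalFactorisationSystem.epi [HasColimits C]
    (hPM : IsOrthogonalFactorisationSystem P M) (hP : IsCowellpowered.{v} P) {X Y : C} (e : X ⟶ Y)
    (he : P e) : Epi e := by
  refine ⟨fun {Y'} r s hrs => by_contra fun hne => ?_⟩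
  obtain ⟨Q, hQ, hQ'⟩ := hP X
  let κ : Type v := Σ a : Shrink.{v} (Subtype Q), (((equivShrink _).symm a).1.right ⟶ Y')
  obtain ⟨d⟩ := hPM.factorisation.nonempty_mapFactorizationData
    (WidePushout.head (fun _ : κ => e))
  have hd (k : κ) : ∃ l : Y ⟶ d.Z, l ≫ d.p = WidePushout.ι (fun _ : κ => e) k :=
    (hPM.unique_lifting e d.p he d.hp d.i (WidePushout.ι (fun _ : κ => e) k)
      (d.fac.trans (WidePushout.arrow_ι (fun _ : κ => e) k).symm)).exists.imp fun _ h => h.2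
  choose l hl using hd
  classical
  let g (φ : Set κ) : d.Z ⟶ Y' := d.p ≫ WidePushout.desc (e ≫ r)
    (fun k => if k ∈ φ then r else s) fun k => by
      split_ifs
      · rfl
      · exact hrs.symm
  have hg (φ : Set κ) (k : κ) : l k ≫ g φ = if k ∈ φ then r else s := by
    rw [← Category.assoc, hl]
    exact WidePushout.ι_desc _ _ _ _ _
  have hginj : Function.Injective g := fun φ ψ h => by
    ext k
    have h1 := (hg φ k).symm.trans ((congrArg (l k ≫ ·) h).trans (hg ψ k))
    split_ifs at h1 with h2 h3 h3
    · exact iff_of_true h2 h3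
    · exact absurd h1 hne
    · exact absurd h1.symm hne
    · exact iff_of_false h2 h3
  obtain ⟨a, ha, ⟨i⟩⟩ := hQ' (Under.mk d.i) d.hi
  let a' : Shrink.{v} (Subtype Q) := equivShrink _ ⟨a, ha⟩
  have ha' : ((equivShrink (Subtype Q)).symm a').1 = a :=
    congrArg Subtype.val ((equivShrink (Subtype Q)).symm_apply_apply _)
  let i' : ((equivShrink (Subtype Q)).symm a').1 ≅ Under.mk d.i := eqToIso ha' ≪≫ i.symm
  let j (φ : Set κ) : κ := ⟨a', i'.hom.right ≫ g φ⟩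
  refine Function.cantor_injective j fun φ ψ h => hginj ?_
  have h1 : i'.hom.right ≫ g φ = i'.hom.right ≫ g ψ := eq_of_heq (Sigma.mk.inj h).2
  have h2 : i'.inv.right ≫ i'.hom.right = 𝟙 d.Z := congrArg CommaMorphism.right i'.inv_hom_id
  have h3 (t : d.Z ⟶ Y') : i'.inv.right ≫ i'.hom.right ≫ t = t := by
    rw [← Category.assoc, h2]
    exact Category.id_comp t
  exact (h3 _).symm.trans ((congrArg (i'.inv.right ≫ ·) h1).trans (h3 _))

theorem isIso_of_epi_of_comp_eq_id {X Y : C} (a : X ⟶ Y) [Epi a] (b : Y ⟶ X) (h : a ≫ b = 𝟙 X) :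
    IsIso a :=
  ⟨b, h, by rw [← cancel_epi a, ← Category.assoc, h, Category.id_comp, Category.comp_id]⟩

theorem IsOrthogonalFactorisationSystem.respectsIso_right
    (hPM : IsOrthogonalFactorisationSystem P M) : M.RespectsIso :=
  have := hPM.retract_right
  inferInstance

theorem IsOrthogonalFactorisationSystem.of_comp [HasColimits C]
    (hPM : IsOrthogonalFactorisationSystem P M) (hP : IsCowellpowered.{v} P) {X Y Z : C} (z : X ⟶ Y)
    (m : Y ⟶ Z) (h : M (z ≫ m)) : M z := by
  have := hPM.respectsIso_right
  obtain ⟨d⟩ := hPM.factorisation.nonempty_mapFactorizationData z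
  obtain ⟨l, hl, -⟩ := (hPM.unique_lifting d.i (z ≫ m) d.hi h (𝟙 _) (d.p ≫ m)
    (by rw [Category.id_comp, ← Category.assoc, d.fac])).exists
  have := hPM.epi hP d.i d.hi
  have := isIso_of_epi_of_comp_eq_id d.i l hl
  rw [← d.fac]
  exact (M.cancel_left_of_respectsIso d.i d.p).2 d.hp

/-- A function on the ordinals above `β` with a small set of values takes each of them below some
bound. -/
theorem exists_bound_of_small_values {T : Type w} {β : Ordinal.{w}} (f : Set.Ici β → T) :
    ∃ γ : Set.Ici β, ∀ δ, ∃ δ' ≤ γ, f δ' = f δ := by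
  have : Nonempty (Set.Ici β) := ⟨⟨β, Set.mem_Ici.2 le_rfl⟩⟩
  let g (t : T) : Ordinal.{w} := (Function.invFun f t).1
  exact ⟨⟨max β (⨆ t, g t), Set.mem_Ici.2 (le_max_left _ _)⟩, fun δ =>
    ⟨Function.invFun f (f δ), (Ordinal.le_iSup g _).trans (le_max_right _ _),
      Function.invFun_eq ⟨δ, rfl⟩⟩⟩

/-- The images of a stage of a transfinite sequence in the later stages are eventually constant. -/
theorem IsOrthogonalFactorisationSystem.exists_stable_image [HasColimits C]
    (hPM : IsOrthogonalFactorisationSystem P M) (hP : IsCowellpowered.{v} P) (G : Ordinal.{v} ⥤ C)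
    (β : Ordinal.{v}) :
    ∃ (γ : Ordinal.{v}) (h : β ≤ γ) (Z : C) (e : G.obj β ⟶ Z) (m : Z ⟶ G.obj γ), P e ∧
      e ≫ m = G.map (homOfLE h) ∧ ∀ (δ : Ordinal.{v}) (hδ : γ ≤ δ), M (m ≫ G.map (homOfLE hδ)) := by
  have := hPM.respectsIso_right
  obtain ⟨Q, hQ, hQ'⟩ := hP (G.obj β)
  have hfac (δ : Set.Ici β) : Nonempty (P.MapFactorizationData M (G.map (homOfLE δ.2))) :=
    hPM.factorisation.nonempty_mapFactorizationData _
  let d (δ : Set.Ici β) := (hfac δ).some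
  have hepi (δ : Set.Ici β) : Epi (d δ).i := hPM.epi hP _ (d δ).hi
  choose a ha ha' using fun δ => hQ' (Under.mk (d δ).i) (d δ).hi
  obtain ⟨γ, hγ⟩ := exists_bound_of_small_values fun δ => equivShrink (Subtype Q) ⟨a δ, ha δ⟩
  -- comparison morphisms between the images
  have hcomp {δ ν : Set.Ici β} (h : δ ≤ ν) :
      ∃ l : (d δ).Z ⟶ (d ν).Z, (d δ).i ≫ l = (d ν).i ∧ l ≫ (d ν).p =
        (d δ).p ≫ G.map (homOfLE (show δ.1 ≤ ν.1 from h)) :=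
    (hPM.unique_lifting (d δ).i (d ν).p (d δ).hi (d ν).hp (d ν).i _
      (by rw [(d ν).fac, ← Category.assoc, (d δ).fac]; exact (seq_map_comp G _ _).symm)).exists
  refine ⟨γ, γ.2, (d γ).Z, (d γ).i, (d γ).p, (d γ).hi, (d γ).fac, fun δ hδ => ?_⟩
  let ν : Set.Ici β := ⟨δ, γ.2.trans hδ⟩
  obtain ⟨δ', hδ', h⟩ := hγ ν
  have h : a δ' = a ν := congrArg Subtype.val ((equivShrink _).injective h)
  let k : Under.mk (d δ').i ≅ Under.mk (d ν).i :=
    (ha' δ').some ≪≫ eqToIso h ≪≫ (ha' ν).some.symm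
  have hk : (d δ').i ≫ k.hom.right = (d ν).i := Under.w k.hom
  have hk' : (d ν).i ≫ k.inv.right = (d δ').i := Under.w k.inv
  obtain ⟨l, hl, -⟩ := hcomp hδ'
  obtain ⟨r, hr, hr'⟩ := hcomp (show γ ≤ ν from hδ)
  have : Epi l := epi_of_epi_fac hl
  have : Epi r := epi_of_epi_fac hr
  -- all of these morphisms are under `G β`, hence determined by their ends
  have h1 : r ≫ k.inv.right ≫ l = 𝟙 _ := by
    rw [← cancel_epi (d γ).i, ← Category.assoc, hr, ← Category.assoc, hk', hl, Category.comp_id]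
  have : IsIso r := isIso_of_epi_of_comp_eq_id r _ h1
  rw [← hr']
  exact (M.cancel_left_of_respectsIso r _).2 (d ν).hp

variable {J : Type v} (A : J → C)

/-- If homming out of each `A j` is small, then all continuous sequences are seen as small by each
`A j` at the same ordinal. -/
theorem exists_isSmallAt_of_isSmallFunctor
    (h : ∀ j, ∃ α : Cardinal.{v}, IsSmallFunctor α (coyoneda.obj (Opposite.op (A j)))) :
    ∃ B : Ordinal.{v}, ∀ G : Ordinal.{v} ⥤ C, IsContinuousSeq G → ∀ j, IsSmallAt (A j) G B := by
  choose α hα using h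
  obtain ⟨B, hB, -⟩ := exists_isFilteredOrdinal_closed (⨆ j, α j) id
  refine ⟨B, fun G hG j => ?_⟩
  have : PreservesColimit (chainBelow G B) (coyoneda.obj (Opposite.op (A j))) :=
    hα j B (hB.mono (le_ciSup Cardinal.bddAbove_of_small j)) _
  exact isSmallAt_of_interleaving hG G (γ := id) (fun _ => le_rfl) (𝟙 G) (fun _ => 𝟙 _)
    (fun β => (Category.comp_id _).trans (G.map_id β).symm)
    (fun β => (Category.comp_id _).trans (G.map_id β).symm)
    (fun x y δ h _ hy => by
      rw [Category.id_comp, Category.id_comp]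
      exact seq_map_comp G _ _) hB.1 (fun β => id) (A j)

/-- If homming out of each `A j` is small relative to the right class of a cowellpowered
factorisation system, then every continuous sequence is seen as small by all `A j` at some ordinal:
the stable images of its stages form a chain of maps in the right class that is interleaved with it.
-/
theorem IsOrthogonalFactorisationSystem.exists_isSmallAt [HasColimits C]
    (hPM : IsOrthogonalFactorisationSystem P M) (hP : IsCowellpowered.{v} P)
    (h : ∀ j, ∃ α : Cardinal.{v}, IsSmallFunctorRel M α (coyoneda.obj (Opposite.op (A j))))
    (G : Ordinal.{v} ⥤ C) (hG : IsContinuousSeq G) :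
    ∃ B : Ordinal.{v}, ∀ j, IsSmallAt (A j) G B := by
  choose α hα using h
  choose γ hγ Z e m he hem hm using hPM.exists_stable_image hP G
  have hepi (β : Ordinal.{v}) : Epi (e β) := hPM.epi hP _ (he β)
  have hz (β ν : Ordinal.{v}) (h : β ≤ ν) : ∃ z : Z β ⟶ Z ν, M z ∧
      e β ≫ z = G.map (homOfLE h) ≫ e ν := by
    obtain ⟨z, hz, hz'⟩ := (hPM.unique_lifting (e β)
      (m ν ≫ G.map (homOfLE (le_max_right (γ β) (γ ν)))) (he β) (hm _ _ _)
      (G.map (homOfLE h) ≫ e ν) (m β ≫ G.map (homOfLE (le_max_left (γ β) (γ ν)))) (by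
        rw [Category.assoc, ← Category.assoc (e ν), ← Category.assoc (e β), hem, hem,
          seq_map_comp, seq_map_comp, seq_map_comp])).exists
    exact ⟨z, hPM.of_comp hP z _ (by rw [hz']; exact hm _ _ _), hz⟩
  choose z hzM hze using hz
  let Z' : Ordinal.{v} ⥤ C :=
    { obj := Z
      map := fun f => z _ _ (leOfHom f)
      map_id := fun β => by
        rw [← cancel_epi (e β), hze, Category.comp_id]
        exact (congrArg (· ≫ e β) (G.map_id β)).trans (Category.id_comp _)
      map_comp := fun {a b c} f g => by
        rw [← cancel_epi (e a), ← Category.assoc, hze, hze, Category.assoc, hze, ← Category.assoc,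
          seq_map_comp] }
  obtain ⟨B, hB, hB'⟩ := exists_isFilteredOrdinal_closed (⨆ j, α j) γ
  refine ⟨B, fun j => ?_⟩
  have : PreservesColimit (chainBelow Z' B) (coyoneda.obj (Opposite.op (A j))) :=
    hα j B (hB.mono (le_ciSup Cardinal.bddAbove_of_small j)) _ fun _ _ _ => hzM _ _ _
  exact isSmallAt_of_interleaving hG Z' hγ
    { app := e, naturality := fun _ _ f => (hze _ _ (leOfHom f)).symm } m hem
    (fun β => by
      rw [← cancel_epi (e β), ← Category.assoc, hem]
      exact (hze _ _ _).symm)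
    (fun x y δ h hx hy => by
      have h1 : e x ≫ Z'.map (homOfLE h) = G.map (homOfLE h) ≫ e y := hze _ _ _
      rw [← cancel_epi (e x), ← Category.assoc, h1, Category.assoc, ← Category.assoc (e y), hem,
        ← Category.assoc (e x), hem, seq_map_comp, seq_map_comp, seq_map_comp])
    hB.1 hB' (A j)

end Images

/-! ### Convergence of the free algebra sequence -/

section Convergence

namespace AlgSeq

variable {V : Type*} [Category* V] {T : V ⥤ V} {t : 𝟭 V ⟶ T} (S : AlgSeq.{w} T t)
  {D : Type*} [Category* D] (H : V ⥤ D)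

theorem map_map_comp {a b c : Ordinal.{w}} (h : a ≤ b) (h' : b ≤ c) :
    H.map (S.X.map (homOfLE h)) ≫ H.map (S.X.map (homOfLE h')) =
      H.map (S.X.map (homOfLE (h.trans h'))) := by
  rw [← H.map_comp, S.map_comp]

theorem map_map_self (a : Ordinal.{w}) (h : a ≤ a) : H.map (S.X.map (homOfLE h)) = 𝟙 _ :=
  (congrArg H.map (S.X.map_id a)).trans (H.map_id _)

theorem map_T_map_comp {a b c : Ordinal.{w}} (h : a ≤ b) (h' : b ≤ c) :
    H.map (T.map (S.X.map (homOfLE h))) ≫ H.map (T.map (S.X.map (homOfLE h'))) =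
      H.map (T.map (S.X.map (homOfLE (h.trans h')))) := by
  rw [← H.map_comp, ← T.map_comp, S.map_comp]

theorem map_act_nat {β ν : Ordinal.{w}} (h : β ≤ ν) :
    H.map (T.map (S.X.map (homOfLE h))) ≫ H.map (S.act ν) =
      H.map (S.act β) ≫ H.map (S.X.map (homOfLE (Order.succ_le_succ h))) := by
  rw [← H.map_comp, S.act_nat, H.map_comp]

theorem map_point_act (β : Ordinal.{w}) : H.map (t.app (S.X.obj β)) ≫ H.map (S.act β) =
    H.map (S.X.map (homOfLE (Order.le_succ β))) :=
  (H.map_comp _ _).symm.trans (congrArg H.map (S.point_act β))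

theorem map_point_nat {β ν : Ordinal.{w}} (h : β ≤ ν) :
    H.map (S.X.map (homOfLE h)) ≫ H.map (t.app (S.X.obj ν)) =
      H.map (t.app (S.X.obj β)) ≫ H.map (T.map (S.X.map (homOfLE h))) :=
  (H.map_comp _ _).symm.trans ((congrArg H.map (t.naturality _)).trans (H.map_comp _ _))

variable {S H}

/-- The free algebra sequence stops at a stage that carries a retraction of the pointing
compatible with the partial actions. -/
theorem IsFreeAt.isIso_map_succ (hS : S.IsFreeAt H) (δ : Ordinal.{w})
    (r : H.obj (T.obj (S.X.obj δ)) ⟶ H.obj (S.X.obj δ))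
    (hr : H.map (t.app (S.X.obj δ)) ≫ r = 𝟙 _)
    (hr' : ∀ (ξ : Ordinal.{w}) (h : ξ < δ), H.map (T.map (S.X.map (homOfLE h.le))) ≫ r =
      H.map (S.act ξ) ≫ H.map (S.X.map (homOfLE (Order.succ_le_of_lt h))))
    (hact : r ≫ H.map (S.X.map (homOfLE (Order.le_succ δ))) = H.map (S.act δ)) :
    IsIso (H.map (S.X.map (homOfLE (Order.le_succ δ)))) := by
  obtain ⟨k, hk, -⟩ := hS.existsUnique_act δ r fun ξ h => by
    rw [hr' ξ h, H.map_comp, H.map_comp, Category.assoc, Category.assoc]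
    exact congrArg (_ ≫ ·) ((congrArg (_ ≫ ·) hr).trans (Category.comp_id _))
  refine ⟨k, ?_, ?_⟩
  · rw [← map_point_act, Category.assoc, hk]
    exact hr
  · refine (hS.existsUnique_act δ (H.map (S.act δ)) fun ξ h => by
      rw [← H.map_comp, S.act_compat h, H.map_comp]).unique ?_ (Category.comp_id _)
    rw [← Category.assoc, hk, hact]

/-- Once the free algebra sequence stops, it is constant. -/
theorem IsFreeAt.isIso_map (hS : S.IsFreeAt H)
    (hT : ∀ {X Y : V} (a : X ⟶ Y), IsIso (H.map a) → IsIso (H.map (T.map a))) {B : Ordinal.{w}}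
    (hB : IsIso (H.map (S.X.map (homOfLE (Order.le_succ B))))) (δ : Ordinal.{w}) (h : B ≤ δ) :
    IsIso (H.map (S.X.map (homOfLE h))) := by
  induction δ using WellFoundedLT.induction with | ind δ ih =>
  rcases eq_or_lt_of_le h with rfl | hBδ
  · rw [map_map_self]
    infer_instance
  by_cases hδ : Order.IsSuccPrelimit δ
  · have hδ : Order.IsSuccLimit δ := ⟨fun hm => hm.not_lt hBδ, hδ⟩
    have hm {ξ : Ordinal.{w}} (hξ : ξ < δ) := ih (max ξ B) (max_lt hξ hBδ) (le_max_right _ _)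
    -- the inverse is given by the inverses at the earlier stages
    obtain ⟨l, hl, -⟩ := hS.existsUnique_limit δ hδ (fun ξ hξ =>
      have := hm hξ
      H.map (S.X.map (homOfLE (le_max_left ξ B))) ≫
        inv (H.map (S.X.map (homOfLE (le_max_right ξ B))))) fun ξ ξ' hξ hξ' => by
      have := hm (hξ.trans_lt hξ')
      have := hm hξ'
      dsimp only
      rw [← Category.assoc, IsIso.comp_inv_eq, Category.assoc, S.map_map_comp,
        ← S.map_map_comp H (le_max_right ξ B) (max_le_max_right B hξ), IsIso.inv_hom_id_assoc,
        S.map_map_comp]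
    refine ⟨l, ?_, ?_⟩
    · have := hm hBδ
      rw [hl B hBδ, IsIso.comp_inv_eq, Category.id_comp]
    · refine (hS.existsUnique_limit δ hδ (fun ξ hξ => H.map (S.X.map (homOfLE hξ.le)))
        fun ξ ξ' hξ hξ' => S.map_map_comp H _ _).unique (fun ξ hξ => ?_) fun ξ hξ => Category.comp_id _
      have := hm hξ
      rw [← Category.assoc, hl ξ hξ, Category.assoc,
        ← S.map_map_comp H (le_max_right ξ B) (max_lt hξ hBδ).le, IsIso.inv_hom_id_assoc,
        S.map_map_comp]
  · obtain ⟨δ, -, rfl⟩ := Order.not_isSuccPrelimit_iff_mem_range_succ.1 hδ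
    have h := Order.le_of_lt_succ hBδ
    have hδ : δ < Order.succ δ := Order.lt_succ δ
    have := ih δ hδ h
    rw [← map_map_comp S H h (Order.le_succ δ)]
    suffices IsIso (H.map (S.X.map (homOfLE (Order.le_succ δ)))) by infer_instance
    rcases eq_or_lt_of_le h with rfl | hlt
    · exact hB
    have hTi := hT _ (ih δ hδ h)
    -- the retraction is transported from the action at the stage `B`
    let r : H.obj (T.obj (S.X.obj δ)) ⟶ H.obj (S.X.obj δ) :=
      inv (H.map (T.map (S.X.map (homOfLE h)))) ≫ H.map (S.act B) ≫
        H.map (S.X.map (homOfLE (Order.succ_le_of_lt hlt)))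
    have hr : H.map (T.map (S.X.map (homOfLE h))) ≫ r = H.map (S.act B) ≫
        H.map (S.X.map (homOfLE (Order.succ_le_of_lt hlt))) :=
      IsIso.hom_inv_id_assoc _ _
    refine hS.isIso_map_succ δ r ?_ (fun ξ hξ => ?_) ?_
    · rw [← cancel_epi (H.map (S.X.map (homOfLE h))), ← Category.assoc, S.map_point_nat,
        Category.assoc, hr, ← Category.assoc, S.map_point_act, S.map_map_comp]
      exact (Category.comp_id _).symm
    · rcases le_total ξ B with hξB | hξB
      · rw [← S.map_T_map_comp H hξB h, Category.assoc, hr, ← Category.assoc, S.map_act_nat,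
          Category.assoc, S.map_map_comp]
      · have := hT _ (ih ξ (hξ.trans hδ) hξB)
        rw [← cancel_epi (H.map (T.map (S.X.map (homOfLE hξB)))), ← Category.assoc,
          S.map_T_map_comp, hr, ← Category.assoc, S.map_act_nat, Category.assoc, S.map_map_comp]
    · rw [← cancel_epi (H.map (T.map (S.X.map (homOfLE h)))), ← Category.assoc, hr, Category.assoc,
        S.map_map_comp, S.map_act_nat]

end AlgSeq

variable {V : Type u} [Category.{v} V] [MonoidalCategory V]

/-- The pointing of the endofunctor `T ⊗ -` given by a pointed object. -/
abbrev tensorPoint {T : V} (τ : 𝟙_ V ⟶ T) : 𝟭 V ⟶ tensorLeft T where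
  app X := pointTensor τ X
  naturality X Y a := by
    change a ≫ (λ_ Y).inv ≫ τ ▷ Y = ((λ_ X).inv ≫ τ ▷ X) ≫ T ◁ a
    rw [leftUnitor_inv_naturality_assoc, Category.assoc, whisker_exchange]

end Convergence

section OneStepConvergence

variable {C : Type u} [Category.{v} C]

theorem whiskerRight_ev {X X' : Comon (Ff C)} (a : X ⟶ X') (Y : Comon (Ff C)) (f : Arrow C) :
    (ev f).map (a ▷ Y) = (ev (Arrow.mk (Y.X.rho f))).map a :=
  (congrArg (· ≫ _) (X.X.map_eq_id rfl rfl)).trans (Category.id_comp _)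

theorem whiskerLeft_ev (X : Comon (Ff C)) {Y Y' : Comon (Ff C)} (b : Y ⟶ Y') (f : Arrow C) :
    (ev f).map (X ◁ b) = X.X.E.map (Ff.Hom.right b.hom f) :=
  Category.comp_id _

theorem pointTensor_ev (T X : Comon (Ff C)) (f : Arrow C) :
    (ev f).map (pointTensor (point T) X) = T.X.lam (Arrow.mk (X.X.rho f)) :=
  (Category.id_comp _).trans (whiskerRight_ev _ _ _)

theorem isIso_whiskerLeft_ev (X : Comon (Ff C)) {Y Y' : Comon (Ff C)} (b : Y ⟶ Y') (f : Arrow C)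
    (h : IsIso ((ev f).map b)) : IsIso ((ev f).map (X ◁ b)) := by
  rw [whiskerLeft_ev]
  have : IsIso (Ff.Hom.right b.hom f) := by
    have h1 : IsIso (Ff.Hom.right b.hom f).left := h
    have h2 : IsIso (Ff.Hom.right b.hom f).right := inferInstanceAs (IsIso (𝟙 f.right))
    exact Arrow.isIso_of_isIso_left_of_isIso_right _
  infer_instance

variable [HasColimits C] {J : Type v} {A B : J → C} (i : ∀ j, A j ⟶ B j)
  {S : AlgSeq.{v} (tensorLeft (oneStep i)) (tensorPoint (point (oneStep i)))} {f : Arrow C}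

theorem AlgSeq.IsFreeAt.isContinuousSeq (hS : S.IsFreeAt (ev f)) : IsContinuousSeq (S.X ⋙ ev f) :=
  fun δ hδ _ k hk => hS.existsUnique_limit δ hδ k hk

/-- The retraction of one-step cell attachment at a stage `β` that the domains of the generating
maps see as small: a lifting problem for this stage comes from an earlier one, and is solved in the
stage after that. -/
theorem exists_retraction_of_isSmallAt (G : Ordinal.{v} ⥤ C) {Y : C} (ρ : ∀ ξ, G.obj ξ ⟶ Y)
    (hρ : ∀ (ξ ν : Ordinal.{v}) (h : ξ ≤ ν), ρ ξ ≫ 𝟙 Y = G.map (homOfLE h) ≫ ρ ν)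
    (a : ∀ ξ, cellObj i (Arrow.mk (ρ ξ)) ⟶ G.obj (Order.succ ξ))
    (hlam : ∀ ξ, cellLam i (Arrow.mk (ρ ξ)) ≫ a ξ = G.map (homOfLE (Order.le_succ ξ)))
    (hnat : ∀ (ξ ν : Ordinal.{v}) (h : ξ ≤ ν),
      cellMap i (Arrow.homMk' (f := ρ ξ) (g := ρ ν) (G.map (homOfLE h)) (𝟙 Y) (hρ ξ ν h).symm) ≫
        a ν = a ξ ≫ G.map (homOfLE (Order.succ_le_succ h)))
    {β : Ordinal.{v}} (hsmall : ∀ j, IsSmallAt (A j) G β) :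
    ∃ r : cellObj i (Arrow.mk (ρ β)) ⟶ G.obj β, cellLam i (Arrow.mk (ρ β)) ≫ r = 𝟙 _ ∧
      (∀ (ξ : Ordinal.{v}) (h : ξ < β), cellMap i (Arrow.homMk' (f := ρ ξ) (g := ρ β)
        (G.map (homOfLE h.le)) (𝟙 Y) (hρ ξ β h.le).symm) ≫ r =
          a ξ ≫ G.map (homOfLE (Order.succ_le_of_lt h))) ∧
      r ≫ G.map (homOfLE (Order.le_succ β)) = a β := by
  let X {ξ ν : Ordinal.{v}} (h : ξ ≤ ν) : Arrow.mk (ρ ξ) ⟶ Arrow.mk (ρ ν) :=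
    Arrow.homMk' (f := ρ ξ) (g := ρ ν) (G.map (homOfLE h)) (𝟙 Y) (hρ ξ ν h).symm
  have hX {ξ ν : Ordinal.{v}} (h : ξ ≤ ν) : cellMap i (X h) ≫ a ν =
      a ξ ≫ G.map (homOfLE (Order.succ_le_succ h)) := hnat ξ ν h
  have hcell {ξ ν : Ordinal.{v}} (h : ξ ≤ ν) (x : LiftingProblem i (Arrow.mk (ρ ξ))) :
      cell i (Arrow.mk (ρ ν)) ⟨x.1, x.2 ≫ X h⟩ ≫ a ν =
        cell i (Arrow.mk (ρ ξ)) x ≫ a ξ ≫ G.map (homOfLE (Order.succ_le_succ h)) := by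
    rw [← hX, ← Category.assoc, cell_map]
  -- the solution of a lifting problem for an earlier stage
  let sol (ξ : Ordinal.{v}) (h : ξ < β) (x : LiftingProblem i (Arrow.mk (ρ ξ))) : B x.1 ⟶ G.obj β :=
    cell i (Arrow.mk (ρ ξ)) x ≫ a ξ ≫ G.map (homOfLE (Order.succ_le_of_lt h))
  have hsol {ξ ν : Ordinal.{v}} (h : ξ ≤ ν) (h' : ν < β) (x : LiftingProblem i (Arrow.mk (ρ ξ))) :
      sol ν h' ⟨x.1, x.2 ≫ X h⟩ = sol ξ (h.trans_lt h') x := by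
    dsimp only [sol]
    rw [← Category.assoc, hcell, Category.assoc, Category.assoc, seq_map_comp]
  have hlift (x : LiftingProblem i (Arrow.mk (ρ β))) :
      ∃ (ξ : Ordinal.{v}) (h : ξ < β) (y : Arrow.mk (i x.1) ⟶ Arrow.mk (ρ ξ)), y ≫ X h.le = x.2 := by
    obtain ⟨ξ, h, u, hu⟩ := (hsmall x.1).exists_lift x.2.left
    have hw : x.2.left ≫ ρ β = i x.1 ≫ x.2.right := x.2.w
    refine ⟨ξ, h, Arrow.homMk' (f := i x.1) (g := ρ ξ) u x.2.right ?_,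
      Arrow.hom_ext _ _ hu (Category.comp_id _)⟩
    rw [← hw, ← hu, Category.assoc, ← hρ, Category.comp_id]
  choose ξ hξ y hy using hlift
  -- the solution does not depend on the stage and on the lifting problem there
  have hindep (x : LiftingProblem i (Arrow.mk (ρ β))) (ν : Ordinal.{v}) (hν : ν < β)
      (z : Arrow.mk (i x.1) ⟶ Arrow.mk (ρ ν)) (hz : z ≫ X hν.le = x.2) :
      sol (ξ x) (hξ x) ⟨x.1, y x⟩ = sol ν hν ⟨x.1, z⟩ := by
    let m := max (ξ x) ν
    have h1 : (y x).left ≫ G.map (homOfLE (hξ x).le) = z.left ≫ G.map (homOfLE hν.le) :=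
      congrArg CommaMorphism.left ((hy x).trans hz.symm)
    obtain ⟨m', hm, hm', h2⟩ := (hsmall x.1).exists_eq m (max_lt (hξ x) hν)
      ((y x).left ≫ G.map (homOfLE (le_max_left _ _)))
      (z.left ≫ G.map (homOfLE (le_max_right _ _))) (by
        rw [Category.assoc, Category.assoc, seq_map_comp, seq_map_comp, h1])
    rw [Category.assoc, Category.assoc, seq_map_comp, seq_map_comp] at h2
    rw [← hsol ((le_max_left _ _).trans hm) hm' ⟨x.1, y x⟩,
      ← hsol ((le_max_right _ _).trans hm) hm' ⟨x.1, z⟩]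
    have h3 : (y x).right = z.right :=
      (Category.comp_id _).symm.trans
        ((congrArg CommaMorphism.right ((hy x).trans hz.symm)).trans (Category.comp_id _))
    exact congrArg (· ≫ _) (cell_congr i _ h2 (congrArg (· ≫ 𝟙 Y) h3))
  let r : cellObj i (Arrow.mk (ρ β)) ⟶ G.obj β := cellDesc i (Arrow.mk (ρ β)) (𝟙 _)
    (fun x => sol (ξ x) (hξ x) ⟨x.1, y x⟩) fun x => by
      have h1 : (y x).left ≫ G.map (homOfLE (hξ x).le) = x.2.left := congrArg CommaMorphism.left (hy x)
      have h2 := cell_w i (Arrow.mk (ρ (ξ x))) ⟨x.1, y x⟩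
      dsimp only [sol]
      rw [← Category.assoc, ← h2, Category.assoc, ← Category.assoc (cellLam i _), hlam,
        seq_map_comp]
      exact (Category.comp_id _).trans h1.symm
  have hr : cellLam i (Arrow.mk (ρ β)) ≫ r = 𝟙 _ := cellLam_desc i _ _ _ _
  have hr' (x) : cell i (Arrow.mk (ρ β)) x ≫ r = sol (ξ x) (hξ x) ⟨x.1, y x⟩ := cell_desc i _ _ _ _ _
  refine ⟨r, hr, fun ν hν => ?_, ?_⟩
  · refine cell_hom_ext i _ ?_ fun z => ?_
    · rw [← Category.assoc, cellLam_map, Category.assoc, hr, ← Category.assoc, hlam, seq_map_comp]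
      exact Category.comp_id _
    · rw [← Category.assoc, cell_map, hr']
      exact hindep ⟨z.1, z.2 ≫ X hν.le⟩ ν hν z.2 rfl
  · refine cell_hom_ext i _ ?_ fun x => ?_
    · rw [← Category.assoc, hr, hlam]
      exact Category.id_comp _
    · rw [← Category.assoc, hr']
      have h1 := hcell (hξ x).le ⟨x.1, y x⟩
      dsimp only [sol]
      rw [Category.assoc, Category.assoc, seq_map_comp, ← h1]
      exact congrArg (· ≫ a β) (cell_congr i _ (congrArg CommaMorphism.left (hy x))
        (congrArg CommaMorphism.right (hy x)))

/-- The free algebra sequence of the one-step comonad stops, at a given arrow, at every stage that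
the domains of the generating maps see as small. -/
theorem AlgSeq.IsFreeAt.isIso_map_of_isSmallAt (hS : S.IsFreeAt (ev f)) {β : Ordinal.{v}}
    (hsmall : ∀ j, IsSmallAt (A j) (S.X ⋙ ev f) β)
    (δ : Ordinal.{v}) (h : β ≤ δ) :
    IsIso ((ev f).map (S.X.map (homOfLE h))) := by
  refine hS.isIso_map (fun a ha => isIso_whiskerLeft_ev _ a f ha) ?_ δ h
  have ht (ξ : Ordinal.{v}) : (ev f).map ((tensorPoint (point (oneStep i))).app (S.X.obj ξ)) =
    cellLam i (Arrow.mk ((S.X.obj ξ).X.rho f)) := pointTensor_ev _ _ _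
  have hT {ξ ν : Ordinal.{v}} (h : ξ ≤ ν) :
      (ev f).map ((tensorLeft (oneStep i)).map (S.X.map (homOfLE h))) =
        cellMap i (Ff.Hom.right (S.X.map (homOfLE h)).hom f) := whiskerLeft_ev _ _ _
  obtain ⟨r, hr, hr', hr''⟩ := exists_retraction_of_isSmallAt i (S.X ⋙ ev f)
    (fun ξ => (S.X.obj ξ).X.rho f)
    (fun ξ ν h => (Category.comp_id _).trans (ev_rho (S.X.map (homOfLE h)) f).symm)
    (fun ξ => (ev f).map (S.act ξ))
    (fun ξ => (congrArg (· ≫ _) (ht ξ).symm).trans (S.map_point_act (ev f) ξ))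
    (fun ξ ν h => (congrArg (· ≫ _) (hT h).symm).trans (S.map_act_nat (ev f) h)) hsmall
  exact hS.isIso_map_succ β r ((congrArg (· ≫ r) (ht β)).trans hr)
    (fun ξ h => (congrArg (· ≫ r) (hT h.le)).trans (hr' ξ h)) hr''

end OneStepConvergence

/-! ### Colimits of eventually constant sequences -/

section EventuallyConstant

variable {D : Type*} [Category* D] {F : Ordinal.{w} ⥤ D} {β : Ordinal.{w}}

/-- The cocone on an eventually constant sequence whose vertex is the constant value. -/
noncomputable abbrev eventualCocone (hβ : ∀ (δ : Ordinal.{w}) (h : β ≤ δ), IsIso (F.map (homOfLE h))) :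
    Cocone F where
  pt := F.obj β
  ι :=
    { app := fun δ =>
        have := hβ (max δ β) (le_max_right _ _)
        F.map (homOfLE (le_max_left δ β)) ≫ inv (F.map (homOfLE (le_max_right δ β)))
      naturality := fun δ ν f => by
        have := hβ (max δ β) (le_max_right _ _)
        have := hβ (max ν β) (le_max_right _ _)
        have h : δ ≤ ν := leOfHom f
        refine Eq.trans ?_ (Category.comp_id _).symm
        rw [← Category.assoc, IsIso.comp_inv_eq, Category.assoc,
          ← seq_map_comp F (le_max_right δ β) (max_le_max_right β h), IsIso.inv_hom_id_assoc,
          seq_map_comp]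
        exact seq_map_comp F h _ }

theorem eventualCocone_ι (hβ : ∀ (δ : Ordinal.{w}) (h : β ≤ δ), IsIso (F.map (homOfLE h)))
    (δ : Ordinal.{w}) (h : β ≤ δ) :
    F.map (homOfLE h) ≫ (eventualCocone hβ).ι.app δ = 𝟙 _ := by
  have := hβ (max δ β) (le_max_right _ _)
  rw [← Category.assoc, IsIso.comp_inv_eq, seq_map_comp, Category.id_comp]

theorem isIso_eventualCocone_ι (hβ : ∀ (δ : Ordinal.{w}) (h : β ≤ δ), IsIso (F.map (homOfLE h)))
    (δ : Ordinal.{w}) (h : β ≤ δ) : IsIso ((eventualCocone hβ).ι.app δ) := by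
  have := hβ δ h
  have h1 : IsIso (F.map (homOfLE h) ≫ (eventualCocone hβ).ι.app δ) := by
    rw [eventualCocone_ι]
    infer_instance
  exact IsIso.of_isIso_comp_left (F.map (homOfLE h)) _

/-- A cocone on a transfinite sequence whose components are eventually invertible is a colimit. -/
theorem isColimit_of_isIso_ι (c : Cocone F)
    (hβ : ∀ (δ : Ordinal.{w}), β ≤ δ → IsIso (c.ι.app δ)) : Nonempty (IsColimit c) := by
  have := hβ β le_rfl
  refine ⟨{ desc := fun s => inv (c.ι.app β) ≫ s.ι.app β, fac := fun s δ => ?_,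
            uniq := fun s l hl => ?_ }⟩
  · have := hβ (max δ β) (le_max_right _ _)
    have h1 := c.w (homOfLE (le_max_right δ β))
    have h2 := s.w (homOfLE (le_max_right δ β))
    have h3 : inv (c.ι.app β) ≫ s.ι.app β = inv (c.ι.app (max δ β)) ≫ s.ι.app (max δ β) := by
      rw [IsIso.inv_comp_eq, ← h1, Category.assoc, IsIso.hom_inv_id_assoc, h2]
    rw [h3, ← c.w (homOfLE (le_max_left δ β)), Category.assoc, IsIso.hom_inv_id_assoc]
    exact s.w _
  · rw [IsIso.eq_inv_comp, hl]

theorem isIso_ι_of_isColimit (hβ : ∀ (δ : Ordinal.{w}) (h : β ≤ δ), IsIso (F.map (homOfLE h)))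
    {c : Cocone F} (hc : IsColimit c) (δ : Ordinal.{w}) (h : β ≤ δ) : IsIso (c.ι.app δ) := by
  have h1 : c.ι.app β ≫ hc.desc (eventualCocone hβ) = 𝟙 _ := by
    rw [hc.fac]
    have := eventualCocone_ι hβ β le_rfl
    rwa [show F.map (homOfLE (le_refl β)) = 𝟙 _ from F.map_id β, Category.id_comp] at this
  have : IsIso (c.ι.app β) := by
    refine ⟨_, h1, hc.hom_ext fun ν => ?_⟩
    have := hβ (max ν β) (le_max_right _ _)
    rw [← Category.assoc, hc.fac]
    change (_ ≫ inv _) ≫ _ = _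
    rw [← c.w (homOfLE (le_max_right ν β)), Category.assoc, IsIso.inv_hom_id_assoc,
      c.w]
    exact (Category.comp_id _).symm
  have := hβ δ h
  have h2 : IsIso (F.map (homOfLE h) ≫ c.ι.app δ) := by rwa [c.w]
  exact IsIso.of_isIso_comp_left (F.map (homOfLE h)) _

end EventuallyConstant

/-! ### The free monoid as the colimit of the free algebra sequence -/

section FreeMonoidSequence

variable {V : Type u} [Category.{v} V] [MonoidalCategory V] {T : V} {τ : 𝟙_ V ⟶ T}

theorem pointTensor_whiskerRight (X Y : V) :
    pointTensor τ X ▷ Y ≫ (α_ T X Y).hom = pointTensor τ (X ⊗ Y) := by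
  simp [pointTensor]

theorem pointTensor_naturality {X Y : V} (a : X ⟶ Y) :
    a ≫ pointTensor τ Y = pointTensor τ X ≫ T ◁ a :=
  (tensorPoint τ).naturality a

namespace AlgSeq

variable (S : AlgSeq.{w} (tensorLeft T) (tensorPoint τ)) (z : 𝟙_ V ≅ S.X.obj 0) {Y W : V}
  (y : Y ⟶ W) (a : T ⊗ W ⟶ W)

/-- A morphism from `X β ⊗ Y` to a module `W` is a partial module morphism extending `y : Y ⟶ W`. -/
structure IsPartialExt (β : Ordinal.{w}) (s : S.X.obj β ⊗ Y ⟶ W) : Prop where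
  unit : (λ_ Y).inv ≫ z.hom ▷ Y ≫ S.X.map (homOfLE (zero_le (a := β))) ▷ Y ≫ s = y
  act (ξ : Ordinal.{w}) (h : ξ < β) :
    S.act ξ ▷ Y ≫ S.X.map (homOfLE (Order.succ_le_of_lt h)) ▷ Y ≫ s =
      (α_ T (S.X.obj ξ) Y).hom ≫ T ◁ (S.X.map (homOfLE h.le) ▷ Y ≫ s) ≫ a

variable {S z y a}

theorem map_whisker_comp {a b c : Ordinal.{w}} (h : a ≤ b) (h' : b ≤ c) {W : V}
    (s : S.X.obj c ⊗ Y ⟶ W) :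
    S.X.map (homOfLE h) ▷ Y ≫ S.X.map (homOfLE h') ▷ Y ≫ s =
      S.X.map (homOfLE (h.trans h')) ▷ Y ≫ s := by
  rw [← Category.assoc, ← comp_whiskerRight, S.map_comp]

theorem IsPartialExt.restrict {β ν : Ordinal.{w}} (h : ν ≤ β) {s : S.X.obj β ⊗ Y ⟶ W}
    (hs : S.IsPartialExt z y a β s) :
    S.IsPartialExt z y a ν (S.X.map (homOfLE h) ▷ Y ≫ s) where
  unit := by
    rw [map_whisker_comp]
    exact hs.unit
  act ξ hξ := by
    rw [map_whisker_comp, map_whisker_comp]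
    exact hs.act ξ (hξ.trans_le h)

theorem existsUnique_isPartialExt (hS : S.IsFreeAt (tensorRight Y)) (ha : pointTensor τ W ≫ a = 𝟙 W)
    (β : Ordinal.{w}) : ∃! s, S.IsPartialExt z y a β s := by
  induction β using WellFoundedLT.induction with | ind β ih =>
  by_cases hβ : Order.IsSuccPrelimit β
  · rcases eq_or_ne β 0 with rfl | h0
    · refine ⟨z.inv ▷ Y ≫ (λ_ Y).hom ≫ y, ⟨?_, fun ξ h => absurd h (not_lt_bot (α := Ordinal))⟩,
        fun s hs => ?_⟩
      · have h1 : S.X.map (homOfLE (zero_le (a := (0 : Ordinal.{w})))) = 𝟙 _ := S.X.map_id _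
        rw [h1]
        simp
      · have h1 : S.X.map (homOfLE (zero_le (a := (0 : Ordinal.{w})))) = 𝟙 _ := S.X.map_id _
        have h2 := hs.unit
        rw [h1] at h2
        rw [← h2]
        simp
    · have hβ : Order.IsSuccLimit β := ⟨fun hm => h0 (le_antisymm (hm zero_le) zero_le), hβ⟩
      choose s hs hs' using ih
      have hcomp (ξ ξ' : Ordinal.{w}) (h : ξ ≤ ξ') (h' : ξ' < β) :
          S.X.map (homOfLE h) ▷ Y ≫ s ξ' h' = s ξ (h.trans_lt h') :=
        hs' _ _ _ ((hs ξ' h').restrict h)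
      obtain ⟨l, hl, hl'⟩ := hS.existsUnique_limit β hβ s hcomp
      have hl (ξ : Ordinal.{w}) (h : ξ < β) : S.X.map (homOfLE h.le) ▷ Y ≫ l = s ξ h := hl ξ h
      refine ⟨l, ⟨?_, fun ξ h => ?_⟩, fun t ht => hl' t fun ξ h => hs' _ _ _ (ht.restrict h.le)⟩
      · have h := hβ.bot_lt
        have h1 := (hs 0 h).unit
        rw [show S.X.map (homOfLE (zero_le (a := (0 : Ordinal.{w})))) = 𝟙 _ from S.X.map_id _,
          id_whiskerRight, Category.id_comp] at h1
        rw [hl 0 h]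
        exact h1
      · have h' := hβ.succ_lt h
        rw [hl _ h, hl _ h', ← hcomp ξ (Order.succ ξ) (Order.le_succ ξ) h',
          ← (hs _ h').act ξ (Order.lt_succ ξ), show S.X.map (homOfLE (Order.succ_le_of_lt
            (Order.lt_succ ξ))) = 𝟙 _ from S.X.map_id _, id_whiskerRight, Category.id_comp]
  · obtain ⟨β, -, rfl⟩ := Order.not_isSuccPrelimit_iff_mem_range_succ.1 hβ
    obtain ⟨s, hs, hs'⟩ := ih β (Order.lt_succ β)
    -- the morphism with which the next stage has to be compatible
    let g : (T ⊗ S.X.obj β) ⊗ Y ⟶ W := (α_ T (S.X.obj β) Y).hom ≫ T ◁ s ≫ a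
    have hg : pointTensor τ (S.X.obj β) ▷ Y ≫ g = s := by
      dsimp only [g]
      rw [← Category.assoc, pointTensor_whiskerRight, ← Category.assoc, ← pointTensor_naturality,
        Category.assoc, ha, Category.comp_id]
    have hact {ξ : Ordinal.{w}} (h : ξ ≤ β) : (T ◁ S.X.map (homOfLE h)) ▷ Y ≫ g =
        (α_ T (S.X.obj ξ) Y).hom ≫ T ◁ (S.X.map (homOfLE h) ▷ Y ≫ s) ≫ a := by
      simp [g]
    obtain ⟨k, hk, hk'⟩ := hS.existsUnique_act β g fun ξ h => by
      change (S.act ξ ≫ S.X.map _ ≫ pointTensor τ _) ▷ Y ≫ g = (T ◁ S.X.map _) ▷ Y ≫ g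
      rw [hact, ← hs.act ξ h, comp_whiskerRight, comp_whiskerRight, Category.assoc, Category.assoc,
        hg]
    have hk : S.act β ▷ Y ≫ k = g := hk
    have hXk : S.X.map (homOfLE (Order.le_succ β)) ▷ Y ≫ k = s := by
      rw [← S.point_act, comp_whiskerRight, Category.assoc, hk]
      exact hg
    refine ⟨k, ⟨?_, fun ξ h => ?_⟩, fun t ht => hk' t ?_⟩
    · rw [← map_whisker_comp zero_le (Order.le_succ β), hXk]
      exact hs.unit
    · have h := Order.le_of_lt_succ h
      have h1 : S.act ξ ▷ Y ≫ S.X.map (homOfLE (Order.succ_le_succ h)) ▷ Y ≫ k =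
          (T ◁ S.X.map (homOfLE h)) ▷ Y ≫ g := by
        rw [← hk, ← Category.assoc, ← Category.assoc, ← comp_whiskerRight, ← comp_whiskerRight]
        exact congrArg (fun t => t ▷ Y ≫ k) (S.act_nat h).symm
      refine h1.trans ((hact h).trans ?_)
      rw [← hXk, map_whisker_comp]
    · have h1 := ht.act β (Order.lt_succ β)
      have h2 := hs' _ (ht.restrict (Order.le_succ β))
      rw [h2, show S.X.map (homOfLE (Order.succ_le_of_lt (Order.lt_succ β))) = 𝟙 _ from
        S.X.map_id _, id_whiskerRight, Category.id_comp] at h1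
      exact h1

variable (c : Cocone S.X)

/-- The action of `T` on the colimit of the free algebra sequence. -/
def colimitAct (hT : IsColimit ((tensorLeft T).mapCocone c)) : T ⊗ c.pt ⟶ c.pt :=
  hT.desc ⟨c.pt,
    { app := fun β => S.act β ≫ c.ι.app (Order.succ β)
      naturality := fun β ν f => by
        have h := S.act_nat (leOfHom f)
        have h' := c.w (homOfLE (Order.succ_le_succ (leOfHom f)))
        refine Eq.trans ?_ (Category.comp_id _).symm
        change (tensorLeft T).map (S.X.map f) ≫ S.act ν ≫ _ = _
        rw [← h', ← Category.assoc, ← Category.assoc]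
        exact congrArg (· ≫ _) h }⟩

variable {c} (hT : IsColimit ((tensorLeft T).mapCocone c))

theorem whiskerLeft_colimitAct (β : Ordinal.{w}) :
    T ◁ c.ι.app β ≫ colimitAct c hT = S.act β ≫ c.ι.app (Order.succ β) :=
  hT.fac _ β

theorem pointTensor_colimitAct (hc : IsColimit c) : pointTensor τ c.pt ≫ colimitAct c hT = 𝟙 _ := by
  refine hc.hom_ext fun β => ?_
  have h := pointTensor_naturality (τ := τ) (c.ι.app β)
  rw [← Category.assoc]
  refine (congrArg (· ≫ _) h).trans ?_
  rw [Category.assoc, whiskerLeft_colimitAct, ← Category.assoc]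
  refine (congrArg (· ≫ _) (S.point_act β)).trans ?_
  exact (c.w _).trans (Category.comp_id _).symm

variable (c z) in
/-- The unit of the colimit of the free algebra sequence. -/
def colimitUnit : 𝟙_ V ⟶ c.pt := z.hom ≫ c.ι.app 0

/-- The colimit of the free algebra sequence, tensored with `Y`, is the free module on `Y`. -/
theorem existsUnique_extension (hS : S.IsFreeAt (tensorRight Y))
    (hY : IsColimit ((tensorRight Y).mapCocone c))
    (hTY : IsColimit ((tensorLeft T ⋙ tensorRight Y).mapCocone c))
    (ha : pointTensor τ W ≫ a = 𝟙 W) :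
    ∃! t : c.pt ⊗ Y ⟶ W, (λ_ Y).inv ≫ colimitUnit z c ▷ Y ≫ t = y ∧
      colimitAct c hT ▷ Y ≫ t = (α_ T c.pt Y).hom ≫ T ◁ t ≫ a := by
  choose s hs hs' using existsUnique_isPartialExt (z := z) (y := y) hS ha
  have hcY {β ν : Ordinal.{w}} (h : β ≤ ν) {Z : V} (t : c.pt ⊗ Y ⟶ Z) :
      S.X.map (homOfLE h) ▷ Y ≫ c.ι.app ν ▷ Y ≫ t = c.ι.app β ▷ Y ≫ t := by
    rw [← Category.assoc, ← comp_whiskerRight]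
    exact congrArg (fun b => b ▷ Y ≫ t) (c.w (homOfLE h))
  have hcT (β : Ordinal.{w}) (t : c.pt ⊗ Y ⟶ W) :
      (T ◁ c.ι.app β) ▷ Y ≫ (α_ T c.pt Y).hom ≫ T ◁ t ≫ a =
        (α_ T (S.X.obj β) Y).hom ≫ T ◁ (c.ι.app β ▷ Y ≫ t) ≫ a := by
    have h := associator_naturality_middle T (c.ι.app β) Y
    rw [← Category.assoc]
    refine (congrArg (· ≫ _) h).trans ?_
    rw [Category.assoc, MonoidalCategory.whiskerLeft_comp, Category.assoc]
  have hcA (β : Ordinal.{w}) (t : c.pt ⊗ Y ⟶ W) :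
      (T ◁ c.ι.app β) ▷ Y ≫ colimitAct c hT ▷ Y ≫ t =
        S.act β ▷ Y ≫ c.ι.app (Order.succ β) ▷ Y ≫ t := by
    have h := congrArg (fun b => b ▷ Y ≫ t) (whiskerLeft_colimitAct hT β)
    rw [comp_whiskerRight, comp_whiskerRight, Category.assoc, Category.assoc] at h
    exact h
  -- the module morphisms extending `y` are determined by, and glued from, their partial versions
  have hpart (t : c.pt ⊗ Y ⟶ W) (h1 : (λ_ Y).inv ≫ colimitUnit z c ▷ Y ≫ t = y)
      (h2 : colimitAct c hT ▷ Y ≫ t = (α_ T c.pt Y).hom ≫ T ◁ t ≫ a) (β : Ordinal.{w}) :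
      c.ι.app β ▷ Y ≫ t = s β := by
    refine hs' β _ ⟨?_, fun ξ h => ?_⟩
    · rw [hcY, ← h1, colimitUnit, comp_whiskerRight, Category.assoc]
    · rw [hcY, hcY, ← hcA, h2, hcT]
  let t : c.pt ⊗ Y ⟶ W := hY.desc ⟨W,
    { app := s
      naturality := fun β ν f =>
        (hs' _ _ ((hs ν).restrict (leOfHom f))).trans (Category.comp_id _).symm }⟩
  have ht (β : Ordinal.{w}) : c.ι.app β ▷ Y ≫ t = s β := hY.fac _ β
  refine ⟨t, ⟨?_, hTY.hom_ext fun β => ?_⟩, fun t' h => hY.hom_ext fun β => ?_⟩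
  · have h1 := (hs 0).unit
    rw [← ht, hcY] at h1
    rw [colimitUnit, comp_whiskerRight, Category.assoc]
    exact h1
  · refine (hcA β t).trans (Eq.trans ?_ (hcT β t).symm)
    have h1 := (hs (Order.succ β)).act β (Order.lt_succ β)
    rw [← ht, hcY, hcY] at h1
    exact h1
  · exact (hpart t' h.1 h.2 β).trans (ht β).symm

end AlgSeq

end FreeMonoidSequence

/-! ### Free monoids from free algebras -/

section FreeAlgebra

variable {V : Type u} [Category.{v} V] [MonoidalCategory V] {T : V}

open MonObj

/-- A module `N` over the pointed object `(T, τ)`, with a morphism `𝟙_ V ⟶ N`, is stably free if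
`N ⊗ Y` is the free module on `Y` for all `Y`. -/
structure IsStablyFree (τ : 𝟙_ V ⟶ T) (N : V) (e : 𝟙_ V ⟶ N) (a : T ⊗ N ⟶ N) : Prop where
  point_act : pointTensor τ N ≫ a = 𝟙 N
  existsUnique_ext {Y W : V} (y : Y ⟶ W) (b : T ⊗ W ⟶ W) (hb : pointTensor τ W ≫ b = 𝟙 W) :
    ∃! t : N ⊗ Y ⟶ W, (λ_ Y).inv ≫ e ▷ Y ≫ t = y ∧ a ▷ Y ≫ t = (α_ T N Y).hom ≫ T ◁ t ≫ b

namespace IsStablyFree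

variable {τ : 𝟙_ V ⟶ T} {N : V} {e : 𝟙_ V ⟶ N} {a : T ⊗ N ⟶ N} (hN : IsStablyFree τ N e a)

theorem hom_ext (hN : IsStablyFree τ N e a) {Y W : V} {b : T ⊗ W ⟶ W}
    (hb : pointTensor τ W ≫ b = 𝟙 W) {t t' : N ⊗ Y ⟶ W}
    (he : (λ_ Y).inv ≫ e ▷ Y ≫ t = (λ_ Y).inv ≫ e ▷ Y ≫ t')
    (ht : a ▷ Y ≫ t = (α_ T N Y).hom ≫ T ◁ t ≫ b)
    (ht' : a ▷ Y ≫ t' = (α_ T N Y).hom ≫ T ◁ t' ≫ b) : t = t' :=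
  (hN.existsUnique_ext _ b hb).unique ⟨rfl, ht⟩ ⟨he.symm, ht'⟩

/-- A stably free module is the free module on the unit. -/
theorem existsUnique_hom (hN : IsStablyFree τ N e a) {W : V} (y : 𝟙_ V ⟶ W) (b : T ⊗ W ⟶ W)
    (hb : pointTensor τ W ≫ b = 𝟙 W) : ∃! t : N ⟶ W, e ≫ t = y ∧ a ≫ t = T ◁ t ≫ b := by
  obtain ⟨t, ⟨ht, ht'⟩, hu⟩ := hN.existsUnique_ext y b hb
  have key (t : N ⟶ W) : (e ≫ t = y ∧ a ≫ t = T ◁ t ≫ b) ↔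
      ((λ_ (𝟙_ V)).inv ≫ e ▷ 𝟙_ V ≫ (ρ_ N).hom ≫ t = y ∧
        a ▷ 𝟙_ V ≫ (ρ_ N).hom ≫ t = (α_ T N (𝟙_ V)).hom ≫ T ◁ ((ρ_ N).hom ≫ t) ≫ b) := by
    refine and_congr ?_ ?_
    · rw [rightUnitor_naturality_assoc, ← unitors_equal, Iso.inv_hom_id_assoc]
    · rw [rightUnitor_naturality_assoc, MonoidalCategory.whiskerLeft_comp, Category.assoc,
        ← rightUnitor_tensor_hom_assoc, Iso.cancel_iso_hom_left]
  refine ⟨(ρ_ N).inv ≫ t, (key _).2 ?_, fun t' h => ?_⟩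
  · rw [Iso.hom_inv_id_assoc]
    exact ⟨ht, ht'⟩
  · rw [← hu _ ((key t').1 h), Iso.inv_hom_id_assoc]

/-- The multiplication of a stably free module. -/
noncomputable def mul (hN : IsStablyFree τ N e a) : N ⊗ N ⟶ N :=
  (hN.existsUnique_ext (𝟙 N) a hN.point_act).choose

theorem one_mul : (λ_ N).inv ≫ e ▷ N ≫ hN.mul = 𝟙 N :=
  (hN.existsUnique_ext (𝟙 N) a hN.point_act).choose_spec.1.1

theorem act_mul : a ▷ N ≫ hN.mul = (α_ T N N).hom ≫ T ◁ hN.mul ≫ a :=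
  (hN.existsUnique_ext (𝟙 N) a hN.point_act).choose_spec.1.2

theorem whisker_one_mul : e ▷ N ≫ hN.mul = (λ_ N).hom := by
  rw [← Iso.inv_comp_eq_id, hN.one_mul]

/-- The monoid structure on a stably free module. -/
noncomputable abbrev mon : Mon V where
  X := N
  mon :=
    { one := e
      mul := hN.mul
      one_mul := hN.whisker_one_mul
      mul_one := by
        refine hN.hom_ext hN.point_act ?_ ?_ ?_
        · rw [← whisker_exchange_assoc, hN.whisker_one_mul, rightUnitor_naturality,
            leftUnitor_naturality, unitors_equal]
        · rw [← whisker_exchange_assoc, hN.act_mul, MonoidalCategory.whiskerLeft_comp]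
          simp
        · simp
      mul_assoc := by
        rw [← Iso.inv_comp_eq]
        refine hN.hom_ext hN.point_act ?_ ?_ ?_
        · rw [← whisker_exchange_assoc, hN.whisker_one_mul, leftUnitor_naturality,
            Iso.inv_hom_id_assoc, associator_inv_naturality_left_assoc,
            ← comp_whiskerRight_assoc, hN.whisker_one_mul, leftUnitor_whiskerRight]
          simp
        · rw [associator_inv_naturality_left_assoc, ← comp_whiskerRight_assoc, hN.act_mul]
          simp only [comp_whiskerRight, Category.assoc, hN.act_mul,
            MonoidalCategory.whiskerLeft_comp]
          rw [associator_naturality_middle_assoc, ← pentagon_inv_hom_hom_hom_inv_assoc]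
        · rw [← whisker_exchange_assoc, hN.act_mul, MonoidalCategory.whiskerLeft_comp,
            Category.assoc, associator_naturality_right_assoc] }

/-- The inclusion of the generating object into a stably free module. -/
abbrev incl (e : 𝟙_ V ⟶ N) (a : T ⊗ N ⟶ N) : T ⟶ N := (ρ_ T).inv ≫ T ◁ e ≫ a

theorem point_incl (hN : IsStablyFree τ N e a) : τ ≫ incl e a = e := by
  have h : τ ≫ (ρ_ T).inv = pointTensor τ (𝟙_ V) := by
    rw [rightUnitor_inv_naturality, pointTensor, unitors_inv_equal]
  rw [← Category.assoc, h, ← Category.assoc, ← pointTensor_naturality, Category.assoc,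
    hN.point_act, Category.comp_id]

theorem incl_mul : incl e a ▷ N ≫ hN.mul = a := by
  rw [comp_whiskerRight, comp_whiskerRight, Category.assoc, Category.assoc, hN.act_mul,
    associator_naturality_middle_assoc, ← MonoidalCategory.whiskerLeft_comp_assoc,
    hN.whisker_one_mul]
  simp

theorem incl_comp {W : V} {t : N ⟶ W} {b : T ⊗ W ⟶ W} (ht : a ≫ t = T ◁ t ≫ b) :
    incl e a ≫ t = (ρ_ T).inv ≫ T ◁ (e ≫ t) ≫ b := by
  rw [Category.assoc, Category.assoc, ht, MonoidalCategory.whiskerLeft_comp, Category.assoc]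

/-- A stably free module is the free monoid on the pointed object: a morphism of pointed objects `g
: T ⟶ W` to a monoid makes `W` into a module, and morphisms of monoids `N ⟶ W` that extend `g` are
the same as morphisms of modules that preserve the units. -/
theorem isFreeMonoid : IsFreeMonoid τ hN.mon (incl e a) where
  pointed := hN.point_incl
  existsUnique W g hg := by
    let b : T ⊗ W.X ⟶ W.X := g ▷ W.X ≫ μ[W.X]
    have hb : pointTensor τ W.X ≫ b = 𝟙 W.X := by
      rw [Category.assoc, ← comp_whiskerRight_assoc, hg, MonObj.one_mul, Iso.inv_hom_id]
    obtain ⟨t, ⟨ht, ht'⟩, hu⟩ := hN.existsUnique_hom η[W.X] b hb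
    have hmul : hN.mul ≫ t = (t ⊗ₘ t) ≫ μ[W.X] := by
      rw [MonoidalCategory.tensorHom_def, Category.assoc]
      refine hN.hom_ext hb ?_ ?_ ?_
      · rw [← comp_whiskerRight_assoc, ht, ← whisker_exchange_assoc, MonObj.one_mul,
          leftUnitor_naturality, Iso.inv_hom_id_assoc, ← Category.assoc, ← Category.assoc,
          Category.assoc _ _ hN.mul, hN.one_mul, Category.id_comp]
      · rw [← Category.assoc, hN.act_mul]
        simp [ht']
      · rw [← comp_whiskerRight_assoc, ht']
        simp only [b, comp_whiskerRight, Category.assoc, MonoidalCategory.whiskerLeft_comp]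
        rw [← whisker_exchange_assoc, MonObj.mul_assoc]
        simp only [tensor_whiskerLeft, Category.assoc, Iso.inv_hom_id_assoc,
          associator_naturality_middle_assoc, whisker_exchange_assoc,
          associator_naturality_left_assoc]
    let h : hN.mon ⟶ W := @Mon.Hom.mk _ _ _ hN.mon W t (@IsMonHom.mk _ _ _ _ _ hN.mon.mon _ t ht hmul)
    refine ⟨h, (incl_comp ht').trans ?_, fun t' h => Mon.Hom.ext (hu _ ⟨?_, ?_⟩)⟩
    · rw [ht, ← Category.assoc (T ◁ _), whisker_exchange, Category.assoc, MonObj.mul_one,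
        rightUnitor_naturality, Iso.inv_hom_id_assoc]
    · exact @IsMonHom.one_hom _ _ _ _ _ hN.mon.mon _ t'.hom t'.isMonHom_hom
    · have h1 : hN.mul ≫ t'.hom = (t'.hom ⊗ₘ t'.hom) ≫ μ[W.X] :=
        @IsMonHom.mul_hom _ _ _ _ _ hN.mon.mon _ t'.hom t'.isMonHom_hom
      have h2 : a ≫ t'.hom = (incl e a ▷ N ≫ hN.mul) ≫ t'.hom := congrArg (· ≫ _) hN.incl_mul.symm
      have h3 : (incl e a ▷ N ≫ hN.mul) ≫ t'.hom =
          (incl e a ≫ t'.hom) ▷ N ≫ W.X ◁ t'.hom ≫ μ[W.X] := by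
        rw [Category.assoc, h1, MonoidalCategory.tensorHom_def, Category.assoc]
        exact (comp_whiskerRight_assoc _ _ _ _).symm
      refine h2.trans (h3.trans ((congrArg (fun x => x ▷ N ≫ W.X ◁ t'.hom ≫ μ[W.X]) h).trans ?_))
      exact (whisker_exchange_assoc _ _ _).symm

end IsStablyFree

end FreeAlgebra

/-! ### The free module sequence of the one-step comonad -/

section ModuleSequence

variable {V : Type u} [Category.{v} V] [MonoidalCategory V] {T : V} {τ : 𝟙_ V ⟶ T}
  {S : AlgSeq.{w} (tensorLeft T) (tensorPoint τ)}

namespace AlgSeq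

theorem act_compat' {ξ δ : Ordinal.{w}} (h : ξ < δ) :
    (S.act ξ ≫ S.X.map (homOfLE (Order.succ_le_of_lt h)) ≫ pointTensor τ (S.X.obj δ)) ≫ S.act δ =
      T ◁ S.X.map (homOfLE h.le) ≫ S.act δ :=
  S.act_compat h

/-- At a successor stage, compatibility with all previous partial actions reduces to compatibility
with the last one. -/
theorem IsFreeAt.existsUnique_act_succ (hS : S.IsFreeAt (𝟭 V)) (β : Ordinal.{w}) {Z : V}
    (g : T ⊗ S.X.obj (Order.succ β) ⟶ Z)
    (hg : (S.act β ≫ pointTensor τ (S.X.obj (Order.succ β))) ≫ g =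
      (T ◁ pointTensor τ (S.X.obj β) ≫ T ◁ S.act β) ≫ g) :
    ∃! k : S.X.obj (Order.succ (Order.succ β)) ⟶ Z, S.act (Order.succ β) ≫ k = g := by
  have hs : (S.act β ≫ pointTensor τ (S.X.obj (Order.succ β))) ≫ g =
      T ◁ S.X.map (homOfLE (Order.le_succ β)) ≫ g := by
    rw [hg, ← S.point_act, ← MonoidalCategory.whiskerLeft_comp]
  refine hS.existsUnique_act (Order.succ β) g fun ξ h => ?_
  have h := Order.le_of_lt_succ h
  have hact : T ◁ S.X.map (homOfLE h) ≫ S.act β =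
    S.act ξ ≫ S.X.map (homOfLE (Order.succ_le_succ h)) := S.act_nat h
  change (S.act ξ ≫ S.X.map _ ≫ pointTensor τ _) ≫ g = T ◁ S.X.map _ ≫ g
  rw [← S.map_comp h (Order.le_succ β), MonoidalCategory.whiskerLeft_comp,
    Category.assoc (T ◁ _), ← hs,
    ← Category.assoc (T ◁ _) (_ ≫ _), ← Category.assoc (T ◁ _) (S.act β), hact]
  simp only [Category.assoc]

/-- A free algebra sequence for `T ⊗ -` is a free module sequence. -/
noncomputable def IsFreeAt.freeModuleSequence (hS : S.IsFreeAt (𝟭 V)) {A : V} (z : A ≅ S.X.obj 0) :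
    FreeModuleSequence.{w} τ A where
  X := S.X
  act := S.act
  act_nat := S.act_nat
  point_act := S.point_act
  zero := z
  isIso_act_zero := by
    obtain ⟨k, hk, -⟩ := hS.existsUnique_act 0 (𝟙 (T ⊗ S.X.obj 0))
      fun ξ h => absurd h (not_lt_bot (α := Ordinal))
    refine ⟨k, hk, ?_⟩
    refine (hS.existsUnique_act 0 (S.act 0) fun ξ h => absurd h (not_lt_bot (α := Ordinal))).unique
      ?_ (Category.comp_id _)
    have hk : S.act 0 ≫ k = 𝟙 _ := hk
    exact (Category.assoc _ _ _).symm.trans ((congrArg (· ≫ S.act 0) hk).trans (Category.id_comp _))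
  succ_w β := by
    rw [← MonoidalCategory.whiskerLeft_comp]
    refine Eq.trans ?_ ((S.act_compat' (Order.lt_succ β)).trans ?_)
    · rw [show S.X.map (homOfLE (Order.succ_le_of_lt (Order.lt_succ β))) = 𝟙 _ from S.X.map_id _,
        Category.id_comp]
    · rw [← S.point_act]
  isColimit_succ β := ⟨Cofork.IsColimit.ofExistsUnique fun s =>
    hS.existsUnique_act_succ β s.π s.condition⟩
  continuous := ⟨fun ν hν => by
    have key (s : Cocone ((Set.principalSegIio ν).monotone.functor ⋙ S.X)) :=
      hS.existsUnique_limit ν hν (fun ξ h => s.ι.app ⟨ξ, h⟩) fun ξ ξ' h h' =>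
        s.w (homOfLE h : (⟨ξ, h.trans_lt h'⟩ : Set.Iio ν) ⟶ ⟨ξ', h'⟩)
    exact ⟨{ desc := fun s => (key s).choose
             fac := fun s x => (key s).choose_spec.1 x.1 x.2
             uniq := fun s l hl => (key s).choose_spec.2 l fun ξ h => hl ⟨ξ, h⟩ }⟩⟩
  limit_w hν h := S.act_compat' h
  existsUnique_limit _ _ g hg := hS.existsUnique_act _ g hg

end AlgSeq

end ModuleSequence

section Pointwise

variable {C : Type u} [Category.{v} C]

/-- An algebra sequence of `⊙`-comonoids is free as seen by `H` if it is so pointwise. -/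
theorem isFreeAt_of_pointwise {T : Comon (Ff C) ⥤ Comon (Ff C)} {t : 𝟭 _ ⟶ T} {S : AlgSeq.{w} T t}
    (H : Comon (Ff C) ⥤ Comon (Ff C)) (h : ∀ f, S.IsFreeAt (H ⋙ ev f)) : S.IsFreeAt H where
  existsUnique_act δ {Z} g hg := by
    have key (f : Arrow C) {W : C} (b : (ev f).obj (H.obj (T.obj (S.X.obj δ))) ⟶ W)
        (hb : ∀ (ξ : Ordinal.{w}) (h : ξ < δ), (ev f).map (H.map (S.act ξ ≫
          S.X.map (homOfLE (Order.succ_le_of_lt h)) ≫ t.app (S.X.obj δ))) ≫ b =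
            (ev f).map (H.map (T.map (S.X.map (homOfLE h.le)))) ≫ b) :
        ∃! k, (ev f).map (H.map (S.act δ)) ≫ k = b := (h f).existsUnique_act δ b hb
    have hk (f : Arrow C) : ∃ k, ∀ _ : Unit, (ev f).map (H.map (S.act δ)) ≫ k = (ev f).map g :=
      ((key f ((ev f).map g) fun ξ hξ => by
        rw [← (ev f).map_comp, hg ξ hξ, (ev f).map_comp]).exists).imp fun _ h _ => h
    have hp (f : Arrow C) {W : C} (a b : (ev f).obj (H.obj (S.X.obj (Order.succ δ))) ⟶ W)
        (hab : ∀ _ : Unit, (ev f).map (H.map (S.act δ)) ≫ a = (ev f).map (H.map (S.act δ)) ≫ b) :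
        a = b :=
      (key f ((ev f).map (H.map (S.act δ)) ≫ b) fun ξ hξ => by
        rw [← (ev f).map_comp_assoc, ← (ev f).map_comp_assoc, ← H.map_comp, ← H.map_comp,
          S.act_compat hξ]).unique (hab ()) rfl
    obtain ⟨k, hk, hk'⟩ := existsUnique_hom_of_pointwise (D := Unit) (fun _ => H.map (S.act δ))
      (fun _ => g) hp hk
    exact ⟨k, hk (), fun l hl => hk' l fun _ => hl⟩
  existsUnique_limit δ hδ {Z} k hk := by
    have : Nonempty {ξ // ξ < δ} := ⟨⟨0, hδ.bot_lt⟩⟩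
    have key (f : Arrow C) {W : C} (l : ∀ ξ < δ, (ev f).obj (H.obj (S.X.obj ξ)) ⟶ W)
        (hl : ∀ (ξ ξ' : Ordinal.{w}) (h : ξ ≤ ξ') (h' : ξ' < δ),
          (ev f).map (H.map (S.X.map (homOfLE h))) ≫ l ξ' h' = l ξ (h.trans_lt h')) :
        ∃! r, ∀ (ξ : Ordinal.{w}) (h : ξ < δ),
          (ev f).map (H.map (S.X.map (homOfLE h.le))) ≫ r = l ξ h := (h f).existsUnique_limit δ hδ l hl
    obtain ⟨l, hl, hl'⟩ := existsUnique_hom_of_pointwise (D := {ξ // ξ < δ})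
      (fun ξ => H.map (S.X.map (homOfLE ξ.2.le))) (fun ξ => k ξ.1 ξ.2)
      (fun f W a b hab => (key f (fun ξ h => (ev f).map (H.map (S.X.map (homOfLE h.le))) ≫ b)
        fun ξ ξ' h h' => by
          rw [← Category.assoc, ← (ev f).map_comp, ← H.map_comp, S.map_comp]).unique
        (fun ξ h => hab ⟨ξ, h⟩) fun ξ h => rfl)
      (fun f => (key f (fun ξ h => (ev f).map (k ξ h)) fun ξ ξ' h h' => by
        rw [← (ev f).map_comp, hk]).exists.imp fun r hr ξ => hr ξ.1 ξ.2)
    exact ⟨l, fun ξ h => hl ⟨ξ, h⟩, fun l' h' => hl' l' fun ξ => h' ξ.1 ξ.2⟩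

theorem tensorRight_comp_ev (Y : Comon (Ff C)) (f : Arrow C) :
    tensorRight Y ⋙ ev f = ev (Arrow.mk (Y.X.rho f)) :=
  CategoryTheory.Functor.ext (fun _ => rfl) fun _ _ a =>
    (whiskerRight_ev a Y f).trans ((Category.id_comp _).trans (Category.comp_id _)).symm

/-- The unit for `⊗` is initial among the `⊙`-comonoids. -/
def isInitialUnit : IsInitial (𝟙_ (Comon (Ff C))) :=
  IsInitial.ofUniqueHom point fun _ a => comon_hom_ext fun f =>
    (Category.id_comp _).symm.trans (lam_ev a f)

variable [HasColimits C]

theorem isConnected_Iio {j : Ordinal.{w}} (hj : j ≠ 0) :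
    CategoryTheory.IsConnected (Set.Iio j) := by
  have : Nonempty (Set.Iio j) := ⟨⟨0, bot_lt_iff_ne_bot.2 hj⟩⟩
  exact IsFiltered.isConnected _

theorem hasColimitsOfShape_Iio (j : Ordinal.{v}) : HasColimitsOfShape (Set.Iio j) C :=
  hasColimitsOfShape_of_essentiallySmall.{v} (Set.Iio j) C

theorem hasColimitsOfShape_Iio_comon (j : Ordinal.{v}) :
    HasColimitsOfShape (Set.Iio j) (Comon (Ff C)) := by
  rcases eq_or_ne j 0 with rfl | hj
  · have : IsEmpty (Set.Iio (0 : Ordinal.{v})) := ⟨fun x => absurd x.2 (not_lt_bot (α := Ordinal))⟩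
    have : HasInitial (Comon (Ff C)) := isInitialUnit.hasInitial
    exact hasColimitsOfShape_of_equivalence
      (equivalenceOfIsEmpty (Discrete PEmpty.{1}) (Set.Iio (0 : Ordinal.{v})))
  · have := isConnected_Iio hj
    have := hasColimitsOfShape_Iio (C := C) j
    exact hasColimitsOfShape_comon _

theorem isConnected_walkingParallelPair :
    CategoryTheory.IsConnected WalkingParallelPair := inferInstance

end Pointwise

/-! ### Natural weak factorisation systems as monoids -/

section OfMon

open ComonObj MonObj

variable {C : Type u} [Category.{v} C]

theorem one_eq_point (U : Mon (Comon (Ff C))) : U.mon.one = point U.X :=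
  isInitialUnit.hom_ext _ _

/-- The unit law of the monad half of a `⊗`-monoid. -/
theorem lam_mul (U : Mon (Comon (Ff C))) (f : Arrow C) :
    U.X.X.lam (U.X.X.R.obj f) ≫ (ev f).map U.mon.mul = 𝟙 (U.X.X.E.obj f) := by
  have h := congrArg (ev f).map U.mon.one_mul
  rw [(ev f).map_comp, one_eq_point, whiskerRight_ev] at h
  exact h

/-- The other unit law of the monad half of a `⊗`-monoid. -/
theorem map_lam_mul (U : Mon (Comon (Ff C))) (f : Arrow C) :
    U.X.X.E.map (U.X.X.Lam f) ≫ (ev f).map U.mon.mul = 𝟙 (U.X.X.E.obj f) := by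
  have h := congrArg (ev f).map U.mon.mul_one
  rw [(ev f).map_comp, one_eq_point, whiskerLeft_ev] at h
  exact h

/-- The associativity law of the monad half of a `⊗`-monoid. -/
theorem mul_mul (U : Mon (Comon (Ff C))) (f : Arrow C) :
    U.X.X.E.map (Ff.Hom.right U.mon.mul.hom f) ≫ (ev f).map U.mon.mul =
      (ev (U.X.X.R.obj f)).map U.mon.mul ≫ (ev f).map U.mon.mul := by
  have h := congrArg (ev f).map U.mon.mul_assoc
  rw [(ev f).map_comp, (ev f).map_comp, (ev f).map_comp, whiskerLeft_ev, whiskerRight_ev] at h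
  exact (h.trans (Category.id_comp _)).symm

/-- The distributive law of a `⊗`-monoid of `⊙`-comonoids, which expresses that its multiplication
is a morphism of comonoids. -/
theorem mul_comul (U : Mon (Comon (Ff C))) (f : Arrow C) :
    (ev f).map U.mon.mul ≫ Ff.Hom.app Δ[U.X.X] f = Ff.Hom.app Δ[U.X.X] (U.X.X.R.obj f) ≫
      U.X.X.E.map (Arrow.homMk' (f := U.X.X.lam (U.X.X.R.obj f)) (g := U.X.X.rho (U.X.X.L.obj f))
        (Ff.Hom.app Δ[U.X.X] f) ((ev f).map U.mon.mul)
          ((comul_rho U.X.X f).trans (lam_mul U f).symm)) ≫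
        (ev (U.X.X.L.obj f)).map U.mon.mul := by
  refine (ev_comul U.mon.mul f).trans ?_
  refine (congrArg (· ≫ _) (tensComul_app U.X.X U.X.X f)).trans ((Category.assoc _ _ _).trans ?_)
  refine congrArg (_ ≫ ·) ((Category.assoc _ _ _).symm.trans (congrArg (· ≫ _) ?_))
  refine (U.X.X.E.map_comp _ _).symm.trans (U.X.X.map_congr ?_ (Category.id_comp _))
  refine (U.X.X.comp_map _ _ _).trans ((congrArg (_ ≫ ·) (U.X.X.map_eq_id ?_ ?_)).trans
    (Category.comp_id _))
  · exact Category.comp_id _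
  · exact lam_mul U f

/-- The natural weak factorisation system given by a `⊗`-monoid in the category of `⊙`-comonoids. -/
abbrev ofMon (U : Mon (Comon (Ff C))) : NWFS C where
  toFf := U.X.X
  sig f := Ff.Hom.app Δ[U.X.X] f
  pi f := (ev f).map U.mon.mul
  sig_nat := Ff.Hom.nat Δ[U.X.X]
  pi_nat := ev_nat U.mon.mul
  lam_sig := Ff.Hom.lam_app Δ[U.X.X]
  pi_rho := ev_rho U.mon.mul
  sig_rho := comul_rho U.X.X
  sig_map_rho := comul_map_rho U.X.X
  sig_sig := comul_comul U.X.X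
  lam_pi := lam_mul U
  map_lam_pi := map_lam_mul U
  pi_pi := mul_mul U
  distrib := mul_comul U

theorem ofMon_toMon (U : Mon (Comon (Ff C))) : (ofMon U).toMon = U := by
  have h1 := one_eq_point U
  have h2 : ε[U.X.X] = Ff.toBot U.X.X := Ff.hom_ext (counit_app U.X.X)
  obtain @⟨@⟨X, comon⟩, mon⟩ := U
  obtain ⟨counit, comul, _, _, _⟩ := comon
  obtain ⟨one, mul, _, _, _⟩ := mon
  obtain rfl : counit = Ff.toBot X := h2
  obtain rfl : one = point _ := h1
  rfl

theorem exists_toMon_eq (U : Mon (Comon (Ff C))) : ∃ N : NWFS C, N.toMon = U :=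
  ⟨ofMon U, ofMon_toMon U⟩

end OfMon

/-! ### The free monoid on the one-step comonad -/

section Main

variable {C : Type u} [Category.{v} C] [HasColimits C] {J : Type v} {A B : J → C}
  (i : ∀ j, A j ⟶ B j)

/-- The free algebra sequence of the one-step comonad, on the unit, exists and is pointwise free. -/
theorem exists_oneStep_sequence :
    ∃ S : AlgSeq.{v} (tensorLeft (oneStep i)) (tensorPoint (point (oneStep i))),
      Nonempty (IsInitial (S.X.obj 0)) ∧ ∀ f, S.IsFreeAt (ev f) := by
  have := hasColimitsOfShape_Iio_comon (C := C)
  have := isConnected_walkingParallelPair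
  have : HasCoequalizers (Comon (Ff C)) := hasColimitsOfShape_comon _
  obtain ⟨S, h0, hS⟩ := exists_isFreeAt (tensorLeft (oneStep i)) (tensorPoint (point (oneStep i)))
  refine ⟨S, h0, fun f => ?_⟩
  have := preservesColimitsOfShape_ev WalkingParallelPair f
  refine hS (ev f) fun j hj => ?_
  have := isConnected_Iio hj
  have := hasColimitsOfShape_Iio (C := C) j
  exact preservesColimitsOfShape_ev _ f

variable {i} {S : AlgSeq.{v} (tensorLeft (oneStep i)) (tensorPoint (point (oneStep i)))}

/-- If the free algebra sequence of the one-step comonad stops at each arrow, then its colimit is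
the free monoid. -/
theorem exists_isFreeMonoid_of_convergence (hS : ∀ f, S.IsFreeAt (ev f))
    (z : 𝟙_ (Comon (Ff C)) ≅ S.X.obj 0)
    (hconv : ∀ f, ∃ β, ∀ (δ : Ordinal.{v}) (h : β ≤ δ), IsIso ((ev f).map (S.X.map (homOfLE h)))) :
    ∃ (N : Mon (Comon (Ff C))) (χ : oneStep i ⟶ N.X), IsFreeMonoid (point (oneStep i)) N χ ∧
      ∃ c : S.X ⟶ (Functor.const _).obj N.X, Nonempty (IsColimit (Cocone.mk N.X c)) ∧
        z.hom ≫ c.app 0 = N.mon.one ∧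
        ∀ β, S.act β ≫ c.app (Order.succ β) = (χ ⊗ₘ c.app β) ≫ N.mon.mul := by
  choose β hβ using hconv
  have : CategoryTheory.IsConnected Ordinal.{v} := IsFiltered.isConnected _
  obtain ⟨c, hc⟩ := exists_pointwise_colimit (F := S.X) (fun f => eventualCocone (hβ f)) fun f =>
    (isColimit_of_isIso_ι (β := β f) _ fun δ h => isIso_eventualCocone_ι (hβ f) δ h).some
  have hι (f : Arrow C) (δ : Ordinal.{v}) (h : β f ≤ δ) : IsIso ((ev f).map (c.ι.app δ)) :=
    isIso_ι_of_isColimit (hβ f) (hc f).some δ h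
  have hcol : Nonempty (IsColimit c) := isColimit_of_pointwise c hc
  have hT : Nonempty (IsColimit ((tensorLeft (oneStep i)).mapCocone c)) :=
    isColimit_of_pointwise _ fun f => isColimit_of_isIso_ι (β := β f) _ fun δ h =>
      isIso_whiskerLeft_ev _ _ f (hι f δ h)
  have hY (Y : Comon (Ff C)) : Nonempty (IsColimit ((tensorRight Y).mapCocone c)) :=
    isColimit_of_pointwise _ fun f => isColimit_of_isIso_ι (β := β (Arrow.mk (Y.X.rho f))) _
      fun δ h => by
        have := hι (Arrow.mk (Y.X.rho f)) δ h
        change IsIso ((ev f).map (c.ι.app δ ▷ Y))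
        rwa [whiskerRight_ev]
  have hTY (Y : Comon (Ff C)) :
      Nonempty (IsColimit ((tensorLeft (oneStep i) ⋙ tensorRight Y).mapCocone c)) :=
    isColimit_of_pointwise _ fun f => isColimit_of_isIso_ι (β := β (Arrow.mk (Y.X.rho f))) _
      fun δ h => by
        have := isIso_whiskerLeft_ev (oneStep i) _ _ (hι (Arrow.mk (Y.X.rho f)) δ h)
        change IsIso ((ev f).map ((oneStep i ◁ c.ι.app δ) ▷ Y))
        rwa [whiskerRight_ev]
  have hSY (Y : Comon (Ff C)) : S.IsFreeAt (tensorRight Y) :=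
    isFreeAt_of_pointwise _ fun f => by
      rw [tensorRight_comp_ev]
      exact hS _
  let a := AlgSeq.colimitAct c hT.some
  let e := AlgSeq.colimitUnit z c
  have hN : IsStablyFree (point (oneStep i)) c.pt e a :=
    ⟨AlgSeq.pointTensor_colimitAct _ hcol.some, fun y b hb =>
      AlgSeq.existsUnique_extension _ (hSY _) (hY _).some (hTY _).some hb⟩
  refine ⟨hN.mon, IsStablyFree.incl e a, hN.isFreeMonoid, c.ι, hcol, rfl, fun δ => ?_⟩
  have h1 := AlgSeq.whiskerLeft_colimitAct hT.some δ
  refine h1.symm.trans ((congrArg (_ ≫ ·) hN.incl_mul.symm).trans ?_)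
  refine (Category.assoc _ _ _).symm.trans (congrArg (· ≫ hN.mul) ?_)
  exact (tensorHom_def' _ _).symm

end Main

end Nwfs

theorem mainTheorem1 {C : Type u} [Category.{v} C] [HasColimits C] {J : Type v} {A B : J → C}
    (i : ∀ j, A j ⟶ B j)
    (h : (∀ j, ∃ α : Cardinal.{v}, Nwfs.IsSmallFunctor α (coyoneda.obj (Opposite.op (A j)))) ∨
      ∃ P M : MorphismProperty C, Nwfs.IsOrthogonalFactorisationSystem P M ∧
        Nwfs.IsCowellpowered.{v} P ∧
        ∀ j, ∃ α : Cardinal.{v}, Nwfs.IsSmallFunctorRel M α (coyoneda.obj (Opposite.op (A j)))) :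
    ∃ (N : Nwfs.NWFS C) (χ : Nwfs.oneStep i ⟶ N.toMon.X),
      Nwfs.IsFreeMonoid (Nwfs.point (Nwfs.oneStep i)) N.toMon χ ∧
      ∃ (S : Nwfs.FreeModuleSequence.{v} (Nwfs.point (Nwfs.oneStep i)) (𝟙_ (Comon (Nwfs.Ff C))))
        (c : S.X ⟶ (Functor.const _).obj N.toMon.X),
        Nonempty (IsColimit (Cocone.mk N.toMon.X c)) ∧
        S.zero.hom ≫ c.app 0 = N.toMon.mon.one ∧
        (∀ β, S.act β ≫ c.app (Order.succ β) = (χ ⊗ₘ c.app β) ≫ N.toMon.mon.mul) ∧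
        (∀ g : Arrow C, ∃ β, ∀ (δ : Ordinal.{v}) (hδ : β ≤ δ),
          IsIso ((S.X.map (homOfLE hδ)).hom.app g)) ∧
        ((∀ j, ∃ α : Cardinal.{v}, Nwfs.IsSmallFunctor α (coyoneda.obj (Opposite.op (A j)))) →
          ∃ β, ∀ (δ : Ordinal.{v}) (hδ : β ≤ δ), IsIso (S.X.map (homOfLE hδ))) := by
  obtain ⟨S, ⟨h0⟩, hS⟩ := Nwfs.exists_oneStep_sequence i
  have hlarge (h : ∀ j, ∃ α : Cardinal.{v}, Nwfs.IsSmallFunctor α (coyoneda.obj (Opposite.op (A j)))) :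
      ∃ β, ∀ f, ∀ (δ : Ordinal.{v}) (hδ : β ≤ δ),
        IsIso ((Nwfs.ev f).map (S.X.map (homOfLE hδ))) := by
    obtain ⟨β, hβ⟩ := Nwfs.exists_isSmallAt_of_isSmallFunctor A h
    exact ⟨β, fun f => (hS f).isIso_map_of_isSmallAt i (hβ _ (hS f).isContinuousSeq)⟩
  have hconv (f : Arrow C) : ∃ β, ∀ (δ : Ordinal.{v}) (hδ : β ≤ δ),
      IsIso ((Nwfs.ev f).map (S.X.map (homOfLE hδ))) := by
    obtain h | ⟨P, M, hPM, hP, hM⟩ := h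
    · obtain ⟨β, hβ⟩ := hlarge h
      exact ⟨β, hβ f⟩
    · obtain ⟨β, hβ⟩ := hPM.exists_isSmallAt A hP hM _ (hS f).isContinuousSeq
      exact ⟨β, (hS f).isIso_map_of_isSmallAt i hβ⟩
  let z : 𝟙_ (Comon (Nwfs.Ff C)) ≅ S.X.obj 0 := Nwfs.isInitialUnit.uniqueUpToIso h0
  obtain ⟨U, χ, hχ, c, hc, hc0, hcs⟩ := Nwfs.exists_isFreeMonoid_of_convergence hS z hconv
  obtain ⟨N, rfl⟩ := Nwfs.exists_toMon_eq U
  have hS1 : S.IsFreeAt (𝟭 _) := Nwfs.isFreeAt_of_pointwise _ hS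
  refine ⟨N, χ, hχ, hS1.freeModuleSequence z, c, hc, hc0, hcs, hconv, fun h => ?_⟩
  obtain ⟨β, hβ⟩ := hlarge h
  exact ⟨β, fun δ hδ => Nwfs.isIso_of_pointwise _ fun f => hβ f δ hδ⟩
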